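/- **Setting.** Let $1\le q\le p$ be integers, $\beta\in(0,1]$, $\mathcal F\subseteq\mathbb R^n$ closed, $x_0\in\mathcal F$, and let $f:\mathbb R^n\to\mathbb R$ be $p$ times continuously differentiable, bounded below by $f_{\rm low}$, with $\|\nabla^p f(x)-\nabla^p f(y)\|\le L\|x-y\|^\beta$ for all $x,y$, where $L\ge0$ (Euclidean norms and the induced norm of tensors). Write $(i+\beta)!=\prod_{\ell=1}^i(\ell+\beta)$, $\chi_r(\delta)=\sum_{\ell=1}^r\delta^\ell/\ell!$, $T^f_r(x,d)=f(x)+\sum_{\ell=1}^r\frac1{\ell!}\nabla^\ell f(x)[d]^\ell$, $\Delta T_r=T_r(\cdot,0)-T_r(\cdot,d)$, $\phi_{f,r}^\delta(x)=f(x)-\min\{T_r^f(x,d):x+d\in\mathcal F,\|d\|\le\delta\}$. An overbar means that the derivatives of $f$ are replaced by approximations; $\overline\phi^\delta_{h,q}(x)=\max\{0,\max\{\overline{\Delta T}{}^h_q(x,d): d \text{ feasible},\|d\|\le\delta\}\}$, where $d$ is feasible if the point of $\mathbb R^n$ it leads to lies in $\mathcal F$. **Constants.** $\theta>0$, $\mu,\delta_{-1}\in(0,1]$,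 $\sigma_{\min}\in(0,\sigma_0]$, $0<\eta_1\le\eta_2<1$, $0<\gamma_1<1<\gamma_2<\gamma_3$, $\alpha,\gamma_\varepsilon,\vartheta\in(0,1)$, $\kappa_\omega\in(0,\frac12\alpha\eta_1]$, $\kappa_\varepsilon>0$, $\omega_0=\min[\kappa_\omega,1/\sigma_0]$. Let $\epsilon\in(0,1)$. **VERIFY**$(\delta,\Delta,\{\zeta_j\}_{j=1}^r,\omega,\xi)$ returns $1$ if $\Delta=0$ and $\max_j\zeta_j\le\xi$; else $2$ if $\Delta>0$ and $\sum_j\zeta_j\delta^j/j!\le\omega\Delta$; else $3$ if $\Delta>0$ and $\sum_j\zeta_j\delta^j/j!\le\xi\chi_r(\delta)$; else $0$. **Algorithm (monotonic AR$p$DA).** Once, before iteration $k=0$, choose accuracy thresholds $0\le\varepsilon_j\le\kappa_\varepsilon$, $1\le j\le p$; they are never reset. Whenever derivatives are required at $x_k$, those of the required orders that are not already available at $x_k$ with the current thresholds are evaluated, with error at most $\varepsilon_j$ in order $j$. "Reduce" means multiplying all $\varepsilon_j$ by $\gamma_\varepsilon$. Iteration $k$ is as follows. *Step 1.* With derivatives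 of orders $1,\dots,q$, compute a global maximizer $d_k$ of $\overline{\Delta T}{}^f_q(x_k,d)$ over $x_k+d\in\mathcal F$, $\|d\|\le\delta_{k-1}$, and the flag VERIFY$(\delta_{k-1},\overline{\Delta T}{}^f_q(x_k,d_k),\{\varepsilon_j\}_{j=1}^q,\omega_k,\frac12\omega_k\epsilon)$. If it is $0$, reduce and repeat Step 1. Terminate with $x_\epsilon=x_k$ if it is $1$ or $3$, or if it is $2$ and $\overline\phi^{\delta_{k-1}}_{f,q}(x_k)\le\frac{\epsilon}{1+\omega_k}\chi_q(\delta_{k-1})$. Otherwise go to Step 2. *Step 2.* With derivatives of orders $1,\dots,p$, let $m_k(s)=\overline T{}^f_p(x_k,s)+\frac{\sigma_k}{(p+\beta)!}\|s\|^{p+\beta}$. If some $s\ne0$ with $x_k+s\in\mathcal F$ has $m_k(s)<m_k(0)$, compute such a step $s_k$ and a $\delta_k\in(0,1]$ such that $$(\ast)\qquad \|s_k\|\ge\mu\epsilon^{\frac1{p-q+\beta}}\quad\text{or}\quad \overline\phi^{\delta_k}_{m_k,q}(s_k)\le\frac{\theta\|s_k\|^{p-q+\beta}}{(p-q+\beta)!}\chi_q(\delta_k),$$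 put $\Delta^m=\max_d\overline{\Delta T}{}_q^{m_k}(s_k,d)$ (over $\|d\|\le\delta_k$, $x_k+s_k+d\in\mathcal F$) if the first alternative fails, and let ${\tt flag}_s$ be VERIFY$(\|s_k\|,\overline{\Delta T}{}^f_p(x_k,s_k),\{\varepsilon_j\}_{j=1}^p,\omega_k,\frac12\omega_k\epsilon)$. If no such $s$ exists, or if ${\tt flag}_s\in\{1,3\}$, replace $s_k$ by a global minimizer of $m_k$ over $x_k+s\in\mathcal F$, set $\Delta^m=0$, recompute ${\tt flag}_s$ in the same way and, if it is $2$, choose $\delta_k\in(0,1]$ with $(\ast)$. Then, if ${\tt flag}_s\in\{1,3\}$, terminate with $x_\epsilon=x_k$. If ${\tt flag}_s=2$ and either $\|s_k\|\ge\mu\epsilon^{1/(p-q+\beta)}$ or $$\text{VERIFY}\Big(\delta_k,\Delta^m,\Big\{3\max_{j\le\ell\le p}\varepsilon_\ell\Big\}_{j=1}^q,\omega_k,\tfrac{\vartheta(1-\kappa_\omega)}{(1+\kappa_\omega)^2}\tfrac{\omega_k\epsilon}2\Big)>0,$$ go to Step 3. Otherwise reduce and repeat Step 2. *Steps 3–5.*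 Compute $\overline f_k(x_k+s_k)$ and, unless the value from iteration $k-1$ is reused, $\overline f_k(x_k)$, both with error at most $\omega_k|\overline{\Delta T}{}^f_p(x_k,s_k)|$. Let $\rho_k=(\overline f_k(x_k)-\overline f_k(x_k+s_k))/\overline{\Delta T}{}^f_p(x_k,s_k)$. Set $x_{k+1}=x_k+s_k$ if $\rho_k\ge\eta_1$ (a successful iteration) and $x_{k+1}=x_k$ otherwise. Choose $\sigma_{k+1}$ in $[\max(\sigma_{\min},\gamma_1\sigma_k),\sigma_k]$ if $\rho_k\ge\eta_2$, in $[\sigma_k,\gamma_2\sigma_k]$ if $\eta_1\le\rho_k<\eta_2$, in $[\gamma_2\sigma_k,\gamma_3\sigma_k]$ if $\rho_k<\eta_1$. Set $\omega_{k+1}=\min[\kappa_\omega,1/\sigma_{k+1}]$ and go to iteration $k+1$. **Theorem.** Whatever admissible choices and approximations are made, the algorithm can always proceed until it terminates, it terminates after finitely many steps, and its output $x_\epsilon\in\mathcal F$ satisfies $\phi^\delta_{f,q}(x_\epsilon)\le\epsilon\chi_q(\delta)$ for some $\delta\in(0,1]$, or $\phi^{\|s\|}_{f,p}(x_\epsilon)\le\epsilon\chi_p(\|s\|)$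 where $s\neq0$ is the last step computed (in Step 2). Let $$\sigma_{\max}=\max\Big[\sigma_0,\frac{\gamma_3(L+3)}{1-\eta_2}\Big],\qquad \omega_{\min}=\min\Big[\kappa_\omega,\frac1{\sigma_{\max}}\Big],$$ $$\kappa_p=\frac{(p+\beta)!}{\eta_1(1-\alpha)\sigma_{\min}}\max\Big\{\frac1{\mu^{p+\beta}},\Big[\frac{(1+\kappa_\omega)(L+\sigma_{\max}+\theta(1+\kappa_\omega))}{(1-\kappa_\omega)(1-\vartheta)(p-q+\beta)!}\Big]^{\frac{p+\beta}{p-q+\beta}}\Big\},$$ $$N(\epsilon)=\Big\lfloor\kappa_p(f(x_0)-f_{\rm low})\epsilon^{-\frac{p+\beta}{p-q+\beta}}\Big\rfloor+1,\qquad \tau(\epsilon)=\Big\lfloor N(\epsilon)\Big(1+\frac{|\log\gamma_1|}{\log\gamma_2}\Big)+\frac1{\log\gamma_2}\log\frac{\sigma_{\max}}{\sigma_0}\Big\rfloor,$$ $$\nu_{\max}(\epsilon)=\max\Big\{0,\Big\lceil\frac1{\log\gamma_\varepsilon}\Big[\log\Big(\frac{\vartheta(1-\kappa_\omega)}{6(1+\kappa_\omega)^2}\omega_{\min}\epsilon\Big)-\log\kappa_\varepsilon\Big]\Big\rceil\Big\}.$$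 The algorithm needs at most $N(\epsilon)$ successful iterations, $\tau(\epsilon)$ completed iterations in total (the final pass, in which it terminates in Step 1 or 2, is not counted as an iteration), $2\tau(\epsilon)$ evaluations of $f$, and $\nu_{\max}(\epsilon)+\tau(\epsilon)+1$ evaluations of the derivative of each order $j\in\{1,\dots,p\}$. In particular there is a constant $C$, independent of $\epsilon$ and of the initial thresholds, such that for all $\epsilon\in(0,1)$ the numbers of iterations and of evaluations of $f$ are at most $C\,\epsilon^{-\frac{p+\beta}{p-q+\beta}}$ and the number of evaluations of each derivative is at most $C\big(|\log\epsilon|+\epsilon^{-\frac{p+\beta}{p-q+\beta}}\big)$. -/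

import Mathlib

noncomputable section

namespace ARpDA

/-! ## Taylor expansions, optimality measures and regularized models -/

/-- The generalized factorial `(i + β)! = ∏_{ℓ=1}^{i} (ℓ + β)`. -/
def genFact (i : ℕ) (β : ℝ) : ℝ := ∏ l ∈ Finset.Icc 1 i, ((l : ℝ) + β)

/-- `χ_q(δ) = ∑_{ℓ=1}^{q} δ^ℓ / ℓ!`. -/
def chi (q : ℕ) (δ : ℝ) : ℝ := ∑ l ∈ Finset.Icc 1 q, δ ^ l / (l.factorial : ℝ)

/-- A family of tensors, one of each order. The norm of a tensor is its operator norm, i.e. the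
maximum of `|S[v₁, …, v_j]|` over Euclidean unit vectors. -/
abbrev Tensors (n : ℕ) : Type :=
  (j : ℕ) → ContinuousMultilinearMap ℝ (fun _ : Fin j => EuclideanSpace ℝ (Fin n)) ℝ

/-- The exact derivative tensors of `f` at `x`. -/
def derivs {n : ℕ} (f : EuclideanSpace ℝ (Fin n) → ℝ) (x : EuclideanSpace ℝ (Fin n)) :
    Tensors n :=
  fun j => iteratedFDeriv ℝ j f x

/-- The Taylor polynomial of degree `r` in `s` with constant term `c` and derivative tensors `D`. -/
def taylor {n : ℕ} (c : ℝ) (D : Tensors n) (r : ℕ) (s : EuclideanSpace ℝ (Fin n)) : ℝ :=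
  c + ∑ l ∈ Finset.Icc 1 r, (1 / (l.factorial : ℝ)) * D l (fun _ => s)

/-- The Taylor increment `ΔT_r(s) = T_r(0) - T_r(s)`; the constant term cancels. -/
def inc {n : ℕ} (D : Tensors n) (r : ℕ) (s : EuclideanSpace ℝ (Fin n)) : ℝ :=
  taylor 0 D r 0 - taylor 0 D r s

/-- Displacements `d` with `x + d ∈ F` and `‖d‖ ≤ δ`. -/
def feas {n : ℕ} (F : Set (EuclideanSpace ℝ (Fin n))) (x : EuclideanSpace ℝ (Fin n)) (δ : ℝ) :
    Set (EuclideanSpace ℝ (Fin n)) :=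
  {d | x + d ∈ F ∧ ‖d‖ ≤ δ}

/-- The exact optimality measure
`φ_{f,q}^δ(x) = f(x) - min {T_q^f(x,d) : x + d ∈ F, ‖d‖ ≤ δ}`. -/
def phi {n : ℕ} (f : EuclideanSpace ℝ (Fin n) → ℝ) (F : Set (EuclideanSpace ℝ (Fin n)))
    (q : ℕ) (δ : ℝ) (x : EuclideanSpace ℝ (Fin n)) : ℝ :=
  f x - sInf ((fun d => taylor (f x) (derivs f x) q d) '' feas F x δ)

/-- The optimality measure computed from the tensors `D`:
`max (0, max {ΔT_q(d) : x + d ∈ F, ‖d‖ ≤ δ})`. -/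
def phiBar {n : ℕ} (D : Tensors n) (F : Set (EuclideanSpace ℝ (Fin n)))
    (q : ℕ) (δ : ℝ) (x : EuclideanSpace ℝ (Fin n)) : ℝ :=
  max 0 (sSup ((fun d => inc D q d) '' feas F x δ))

/-- The regularized Taylor model in `s`. Its constant term (an approximation of `f x`) is
irrelevant, since only differences of values and derivatives of the model are used. -/
def model {n : ℕ} (p : ℕ) (β : ℝ) (D : Tensors n) (σ : ℝ) (s : EuclideanSpace ℝ (Fin n)) : ℝ :=
  taylor 0 D p s + σ / genFact p β * ‖s‖ ^ ((p : ℝ) + β)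

open Classical in
/-- The accuracy check VERIFY, for a Taylor increment `Δ` of degree `r`, absolute accuracies
`ζ 1, …, ζ r`, a radius `δ`, a relative accuracy `ω` and an absolute accuracy `ξ`. -/
def verify (r : ℕ) (δ Δ : ℝ) (ζ : ℕ → ℝ) (ω ξ : ℝ) : ℕ :=
  if Δ = 0 ∧ ∀ j ∈ Finset.Icc 1 r, ζ j ≤ ξ then 1
  else if 0 < Δ ∧ ∑ j ∈ Finset.Icc 1 r, ζ j / (j.factorial : ℝ) * δ ^ j ≤ ω * Δ then 2
  else if 0 < Δ ∧ ∑ j ∈ Finset.Icc 1 r, ζ j / (j.factorial : ℝ) * δ ^ j ≤ ξ * chi r δ then 3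
  else 0

/-! ## The constants of the algorithm -/

/-- The constants of the algorithm, except the accuracy level `ε`; `δ_init` is the initial
optimality radius, `κe` and `γe` are the upper bound on the initial derivative accuracies and
their reduction factor, and `vth` is the constant (vartheta) of the check on the model. -/
structure Params where
  p : ℕ
  q : ℕ
  β : ℝ
  κω : ℝ
  α : ℝ
  δ_init : ℝ
  θ : ℝ
  μ : ℝ
  η₁ : ℝ
  η₂ : ℝ
  γ₁ : ℝ
  γ₂ : ℝ
  γ₃ : ℝ
  σ_min : ℝ
  σ₀ : ℝ
  γe : ℝ
  κe : ℝ
  vth : ℝ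

/-- The conditions imposed on the constants. -/
structure Params.Admissible (P : Params) : Prop where
  one_le_q : 1 ≤ P.q
  q_le_p : P.q ≤ P.p
  β_mem : P.β ∈ Set.Ioc (0 : ℝ) 1
  α_mem : P.α ∈ Set.Ioo (0 : ℝ) 1
  κω_mem : P.κω ∈ Set.Ioc (0 : ℝ) (1 / 2 * P.α * P.η₁)
  δ_init_mem : P.δ_init ∈ Set.Ioc (0 : ℝ) 1
  θ_pos : 0 < P.θ
  μ_mem : P.μ ∈ Set.Ioc (0 : ℝ) 1
  η₁_pos : 0 < P.η₁
  η₁_le_η₂ : P.η₁ ≤ P.η₂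
  η₂_lt_one : P.η₂ < 1
  γ₁_pos : 0 < P.γ₁
  γ₁_lt_one : P.γ₁ < 1
  one_lt_γ₂ : 1 < P.γ₂
  γ₂_lt_γ₃ : P.γ₂ < P.γ₃
  σ_min_pos : 0 < P.σ_min
  σ_min_le : P.σ_min ≤ P.σ₀
  γe_mem : P.γe ∈ Set.Ioo (0 : ℝ) 1
  κe_pos : 0 < P.κe
  vth_mem : P.vth ∈ Set.Ioo (0 : ℝ) 1

/-- The exponent `p - q + β`. -/
def Params.expo (P : Params) : ℝ := (P.p : ℝ) - (P.q : ℝ) + P.β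

/-- `μ ε^{1/(p-q+β)}`, the norm above which a step is long. -/
def Params.longStep (P : Params) (ε : ℝ) : ℝ := P.μ * ε ^ (1 / P.expo)

/-- The possible initial derivative accuracies `ε_{1,0}, …, ε_{p,0}`. -/
def Params.AdmissibleAcc (P : Params) (acc : ℕ → ℝ) : Prop :=
  ∀ j ∈ Finset.Icc 1 P.p, 0 ≤ acc j ∧ acc j ≤ P.κe

/-- The absolute accuracies `3 max_{j ≤ ℓ ≤ p} ε_ℓ` of the derivatives of the model at a step that
is not long, when the derivatives of `f` of order `ℓ` have accuracy `ε_ℓ`. This is `3 ε_j`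
when `ε_1 ≥ … ≥ ε_p`. -/
def Params.modelAcc (P : Params) (acc : ℕ → ℝ) (j : ℕ) : ℝ :=
  3 * sSup (acc '' Set.Icc j P.p)

/-- The absolute accuracy required in the check on the model. -/
def Params.modelTol (P : Params) (ω ε : ℝ) : ℝ :=
  P.vth * (1 - P.κω) / (1 + P.κω) ^ 2 * (ω * ε / 2)

/-! ## The states of the algorithm -/

/-- The place reached in the algorithm: about to execute Step 1.2, Step 2.1, or Step 3 (with the
step `s_k` and radius `δ_k` found in Step 2), or terminated; in the last case the last
step computed is recorded if termination occurred in Step 2. -/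
inductive Phase (n : ℕ) : Type where
  | step1 : Phase n
  | step2 : Phase n
  | step3 (s : EuclideanSpace ℝ (Fin n)) (δ : ℝ) : Phase n
  | halted (s : Option (EuclideanSpace ℝ (Fin n))) : Phase n

/-- A state of the algorithm, with counters of iterations and evaluations. -/
structure State (n : ℕ) : Type where
  phase : Phase n
  /-- the index of the current iteration, i.e. the number of completed iterations -/
  k : ℕ
  /-- the number of successful iterations so far -/
  succ : ℕ
  /-- the number of evaluations of `f` so far -/
  fEvals : ℕ
  /-- the number of evaluations of the derivative of each order so far -/
  dEvals : ℕ → ℕ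
  x : EuclideanSpace ℝ (Fin n)
  /-- the radius `δ_{k-1}` -/
  δ : ℝ
  σ : ℝ
  ω : ℝ
  /-- the current derivative accuracies -/
  acc : ℕ → ℝ
  /-- the approximate derivatives; meaningful for the orders in `avail` only -/
  D : Tensors n
  /-- the orders for which a derivative at `x` with accuracy `acc` is available -/
  avail : Finset ℕ
  /-- the approximation of `f x` obtained in the previous iteration -/
  fval : Option ℝ

/-- The initial state (Step 0 and the initialization of the derivative accuracies). -/
def start {n : ℕ} (P : Params) (x₀ : EuclideanSpace ℝ (Fin n)) (acc : ℕ → ℝ) : State n where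
  phase := Phase.step1
  k := 0
  succ := 0
  fEvals := 0
  dEvals := fun _ => 0
  x := x₀
  δ := P.δ_init
  σ := P.σ₀
  ω := min P.κω (1 / P.σ₀)
  acc := acc
  D := fun _ => 0
  avail := ∅
  fval := none

/-- `D` is a possible result of making the derivatives of orders `1, …, r` available: those that
are available are kept, the others are evaluated with the current accuracies. -/
def State.Evaluates {n : ℕ} (st : State n) (f : EuclideanSpace ℝ (Fin n) → ℝ) (r : ℕ)
    (D : Tensors n) : Prop :=
  (∀ j ∈ st.avail, D j = st.D j) ∧
    ∀ j ∈ Finset.Icc 1 r \ st.avail, ‖D j - iteratedFDeriv ℝ j f st.x‖ ≤ st.acc j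

/-- The state after that. -/
def State.withDerivs {n : ℕ} (st : State n) (r : ℕ) (D : Tensors n) : State n :=
  { st with
    D := D
    avail := st.avail ∪ Finset.Icc 1 r
    dEvals := fun j => st.dEvals j + if j ∈ Finset.Icc 1 r \ st.avail then 1 else 0 }

/-- All derivative accuracies are multiplied by `γ`; no available derivative qualifies any more. -/
def State.tighten {n : ℕ} (st : State n) (γ : ℝ) : State n :=
  { st with acc := fun j => γ * st.acc j, avail := ∅ }

/-! ## The steps of the algorithm -/

/-- A nonzero feasible step along which the model decreases. -/
def Descent {n : ℕ} (P : Params) (F : Set (EuclideanSpace ℝ (Fin n))) (D : Tensors n)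
    (x : EuclideanSpace ℝ (Fin n)) (σ : ℝ) (s : EuclideanSpace ℝ (Fin n)) : Prop :=
  s ≠ 0 ∧ x + s ∈ F ∧ model P.p P.β D σ s < model P.p P.β D σ 0

/-- The stopping test of the approximate minimization of the model, at the step `s` and with the
radius `δ`: the step is long, or the optimality measure of the model at `s` is small. -/
def ModelTest {n : ℕ} (P : Params) (ε : ℝ) (F : Set (EuclideanSpace ℝ (Fin n))) (D : Tensors n)
    (x : EuclideanSpace ℝ (Fin n)) (σ : ℝ) (s : EuclideanSpace ℝ (Fin n)) (δ : ℝ) : Prop :=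
  δ ∈ Set.Ioc (0 : ℝ) 1 ∧
    (P.longStep ε ≤ ‖s‖ ∨
      phiBar (derivs (model P.p P.β D σ) s) F P.q δ (x + s) ≤
        P.θ * ‖s‖ ^ P.expo / genFact (P.p - P.q) P.β * chi P.q δ)

/-- The flag returned by VERIFY for the step `s`. -/
def stepFlag {n : ℕ} (P : Params) (ε : ℝ) (D : Tensors n) (acc : ℕ → ℝ) (ω : ℝ)
    (s : EuclideanSpace ℝ (Fin n)) : ℕ :=
  verify P.p ‖s‖ (inc D P.p s) acc ω (1 / 2 * ω * ε)

/-- The possible outcomes of Steps 2.2 and 2.3 with derivatives `D`: the flag for the step, the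
step, the radius `δ_k`, and the increment `Δm` of the Taylor expansion of the model at the
step that is used in the check of Step 2.4. -/
inductive StepCalc {n : ℕ} (P : Params) (ε : ℝ) (F : Set (EuclideanSpace ℝ (Fin n)))
    (D : Tensors n) (acc : ℕ → ℝ) (x : EuclideanSpace ℝ (Fin n)) (σ ω : ℝ) :
    ℕ → EuclideanSpace ℝ (Fin n) → ℝ → ℝ → Prop where
  /-- Step 2.2 yields a step, and its flag does not lead to Step 2.3. -/
  | approximate (s d : EuclideanSpace ℝ (Fin n)) (δ : ℝ)
      (hs : Descent P F D x σ s)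
      (ht : ModelTest P ε F D x σ s δ)
      (hd : ‖s‖ < P.longStep ε → d ∈ feas F (x + s) δ ∧
        ∀ d' ∈ feas F (x + s) δ,
          inc (derivs (model P.p P.β D σ) s) P.q d' ≤ inc (derivs (model P.p P.β D σ) s) P.q d)
      (hflag : stepFlag P ε D acc ω s = 0 ∨ stepFlag P ε D acc ω s = 2) :
      StepCalc P ε F D acc x σ ω (stepFlag P ε D acc ω s) s δ
        (inc (derivs (model P.p P.β D σ) s) P.q d)
  /-- Step 2.3 is reached, because there is no descent step or because of the flag of the step
  found in Step 2.2. The radius matters only if the algorithm continues with the step. -/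
  | global (s : EuclideanSpace ℝ (Fin n)) (δ : ℝ)
      (hreach : (¬ ∃ s', Descent P F D x σ s') ∨
        ∃ s' δ', Descent P F D x σ s' ∧ ModelTest P ε F D x σ s' δ' ∧
          (stepFlag P ε D acc ω s' = 1 ∨ stepFlag P ε D acc ω s' = 3))
      (hs : x + s ∈ F)
      (hmin : ∀ s', x + s' ∈ F → model P.p P.β D σ s ≤ model P.p P.β D σ s')
      (ht : stepFlag P ε D acc ω s = 2 → ModelTest P ε F D x σ s δ) :
      StepCalc P ε F D acc x σ ω (stepFlag P ε D acc ω s) s δ 0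

/-- The update of the regularization parameter. -/
def SigmaUpdate (P : Params) (ρ σ σ' : ℝ) : Prop :=
  (P.η₂ ≤ ρ → max P.σ_min (P.γ₁ * σ) ≤ σ' ∧ σ' ≤ σ) ∧
  (P.η₁ ≤ ρ ∧ ρ < P.η₂ → σ ≤ σ' ∧ σ' ≤ P.γ₂ * σ) ∧
  (ρ < P.η₁ → P.γ₂ * σ ≤ σ' ∧ σ' ≤ P.γ₃ * σ)

/-- The flag of Step 1.3, for the maximizer `d` of the Taylor increment. -/
def optFlag {n : ℕ} (P : Params) (ε : ℝ) (st : State n) (D : Tensors n)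
    (d : EuclideanSpace ℝ (Fin n)) : ℕ :=
  verify P.q st.δ (inc D P.q d) st.acc st.ω (1 / 2 * st.ω * ε)

/-- The termination test of Step 1. -/
def OptTest {n : ℕ} (P : Params) (ε : ℝ) (F : Set (EuclideanSpace ℝ (Fin n))) (st : State n)
    (D : Tensors n) : Prop :=
  phiBar D F P.q st.δ st.x ≤ ε / (1 + st.ω) * chi P.q st.δ

/-- Steps 1.2 and 1.3: evaluate the first `q` derivatives if needed, and maximize the increment. -/
def Step1Calc {n : ℕ} (P : Params) (F : Set (EuclideanSpace ℝ (Fin n)))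
    (f : EuclideanSpace ℝ (Fin n) → ℝ) (st : State n) (D : Tensors n)
    (d : EuclideanSpace ℝ (Fin n)) : Prop :=
  st.phase = Phase.step1 ∧ st.Evaluates f P.q D ∧ d ∈ feas F st.x st.δ ∧
    ∀ d' ∈ feas F st.x st.δ, inc D P.q d' ≤ inc D P.q d

/-- Steps 2.1 to 2.3. -/
def Step2Calc {n : ℕ} (P : Params) (ε : ℝ) (F : Set (EuclideanSpace ℝ (Fin n)))
    (f : EuclideanSpace ℝ (Fin n) → ℝ) (st : State n) (D : Tensors n)
    (flag : ℕ) (s : EuclideanSpace ℝ (Fin n)) (δ Δm : ℝ) : Prop :=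
  st.phase = Phase.step2 ∧ st.Evaluates f P.p D ∧
    StepCalc P ε F D st.acc st.x st.σ st.ω flag s δ Δm

/-- The flag for the model in Step 2.4. -/
def modelFlag (P : Params) (ε : ℝ) (acc : ℕ → ℝ) (ω δ Δm : ℝ) : ℕ :=
  verify P.q δ Δm (P.modelAcc acc) ω (P.modelTol ω ε)

/-- Step 3: `v₁` approximates `f` at the trial point and `v₀` approximates `f` at the iterate;
`c` evaluations of `f` are used, one if `v₀` is the value of the previous iteration and two if it
is computed anew. -/
def Step3Calc {n : ℕ} (f : EuclideanSpace ℝ (Fin n) → ℝ) (p : ℕ) (st : State n)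
    (s : EuclideanSpace ℝ (Fin n)) (δ v₀ v₁ : ℝ) (c : ℕ) : Prop :=
  st.phase = Phase.step3 s δ ∧
    |v₁ - f (st.x + s)| ≤ st.ω * |inc st.D p s| ∧
    |v₀ - f st.x| ≤ st.ω * |inc st.D p s| ∧
    ((c = 1 ∧ st.fval = some v₀) ∨ c = 2)

/-- The ratio `ρ_k`. -/
def ratio {n : ℕ} (p : ℕ) (st : State n) (s : EuclideanSpace ℝ (Fin n)) (v₀ v₁ : ℝ) : ℝ :=
  (v₀ - v₁) / inc st.D p s

/-- The transitions of the monotonic variant of the algorithm: the derivative accuracies are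
carried over from one iteration to the next. Evaluations and free choices are arbitrary among
those that the algorithm allows. -/
inductive Trans {n : ℕ} (P : Params) (ε : ℝ) (F : Set (EuclideanSpace ℝ (Fin n)))
    (f : EuclideanSpace ℝ (Fin n) → ℝ) : State n → State n → Prop where
  | step1_halt (st : State n) (D : Tensors n) (d : EuclideanSpace ℝ (Fin n))
      (h : Step1Calc P F f st D d)
      (hflag : optFlag P ε st D d = 1 ∨ optFlag P ε st D d = 3 ∨
        (optFlag P ε st D d = 2 ∧ OptTest P ε F st D)) :
      Trans P ε F f st { st.withDerivs P.q D with phase := Phase.halted none }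
  | step1_pass (st : State n) (D : Tensors n) (d : EuclideanSpace ℝ (Fin n))
      (h : Step1Calc P F f st D d)
      (hflag : optFlag P ε st D d = 2 ∧ ¬ OptTest P ε F st D) :
      Trans P ε F f st { st.withDerivs P.q D with phase := Phase.step2 }
  | step1_again (st : State n) (D : Tensors n) (d : EuclideanSpace ℝ (Fin n))
      (h : Step1Calc P F f st D d)
      (hflag : optFlag P ε st D d = 0) :
      Trans P ε F f st ((st.withDerivs P.q D).tighten P.γe)
  | step2_halt (st : State n) (D : Tensors n) (flag : ℕ) (s : EuclideanSpace ℝ (Fin n))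
      (δ Δm : ℝ)
      (h : Step2Calc P ε F f st D flag s δ Δm)
      (hflag : flag = 1 ∨ flag = 3) :
      Trans P ε F f st { st.withDerivs P.p D with phase := Phase.halted (some s) }
  | step2_pass (st : State n) (D : Tensors n) (flag : ℕ) (s : EuclideanSpace ℝ (Fin n))
      (δ Δm : ℝ)
      (h : Step2Calc P ε F f st D flag s δ Δm)
      (hflag : flag = 2 ∧ (P.longStep ε ≤ ‖s‖ ∨
        (‖s‖ < P.longStep ε ∧ 0 < modelFlag P ε st.acc st.ω δ Δm))) :
      Trans P ε F f st { st.withDerivs P.p D with phase := Phase.step3 s δ }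
  | step2_again (st : State n) (D : Tensors n) (flag : ℕ) (s : EuclideanSpace ℝ (Fin n))
      (δ Δm : ℝ)
      (h : Step2Calc P ε F f st D flag s δ Δm)
      (hflag : flag = 0 ∨
        (flag = 2 ∧ ‖s‖ < P.longStep ε ∧ modelFlag P ε st.acc st.ω δ Δm = 0)) :
      Trans P ε F f st ((st.withDerivs P.p D).tighten P.γe)
  /-- Steps 3 to 5 of a successful iteration. -/
  | step3_success (st : State n) (s : EuclideanSpace ℝ (Fin n)) (δ v₀ v₁ : ℝ) (c : ℕ) (σ' : ℝ)
      (h : Step3Calc f P.p st s δ v₀ v₁ c)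
      (hρ : P.η₁ ≤ ratio P.p st s v₀ v₁)
      (hσ : SigmaUpdate P (ratio P.p st s v₀ v₁) st.σ σ') :
      Trans P ε F f st
        { st with
          phase := Phase.step1
          k := st.k + 1
          succ := st.succ + 1
          fEvals := st.fEvals + c
          x := st.x + s
          δ := δ
          σ := σ'
          ω := min P.κω (1 / σ')
          avail := ∅
          fval := some v₁ }
  /-- Steps 3 to 5 of an unsuccessful iteration. -/
  | step3_failure (st : State n) (s : EuclideanSpace ℝ (Fin n)) (δ v₀ v₁ : ℝ) (c : ℕ) (σ' : ℝ)
      (h : Step3Calc f P.p st s δ v₀ v₁ c)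
      (hρ : ratio P.p st s v₀ v₁ < P.η₁)
      (hσ : SigmaUpdate P (ratio P.p st s v₀ v₁) st.σ σ') :
      Trans P ε F f st
        { st with
          phase := Phase.step1
          k := st.k + 1
          fEvals := st.fEvals + c
          δ := δ
          σ := σ'
          ω := min P.κω (1 / σ')
          fval := some v₀ }

/-- The states that the algorithm can reach from `x₀` with initial derivative accuracies `acc`. -/
def Reachable {n : ℕ} (P : Params) (ε : ℝ) (F : Set (EuclideanSpace ℝ (Fin n)))
    (f : EuclideanSpace ℝ (Fin n) → ℝ) (x₀ : EuclideanSpace ℝ (Fin n)) (acc : ℕ → ℝ)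
    (st : State n) : Prop :=
  Relation.ReflTransGen (Trans P ε F f) (start P x₀ acc) st

/-! ## The constants of the complexity bounds -/

def Params.sigmaMax (P : Params) (L : ℝ) : ℝ :=
  max P.σ₀ (P.γ₃ * (L + 3) / (1 - P.η₂))

def Params.omegaMin (P : Params) (L : ℝ) : ℝ :=
  min P.κω (1 / P.sigmaMax L)

/-- The largest possible number of reductions of the derivative accuracies, `max (0, ⌈R⌉)`. -/
def Params.nuMax (P : Params) (L ε : ℝ) : ℕ :=
  ⌈1 / Real.log P.γe *
    (Real.log (P.vth * (1 - P.κω) / (6 * (1 + P.κω) ^ 2) * P.omegaMin L * ε)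
      - Real.log P.κe)⌉₊

def Params.kappaP (P : Params) (L : ℝ) : ℝ :=
  genFact P.p P.β / (P.η₁ * (1 - P.α) * P.σ_min) *
    max (1 / P.μ ^ ((P.p : ℝ) + P.β))
      (((1 + P.κω) * (L + P.sigmaMax L + P.θ * (1 + P.κω)) /
        ((1 - P.κω) * (1 - P.vth) * genFact (P.p - P.q) P.β)) ^ (((P.p : ℝ) + P.β) / P.expo))

/-- `ε^{-(p+β)/(p-q+β)}`. -/
def Params.rate (P : Params) (ε : ℝ) : ℝ := ε ^ (-(((P.p : ℝ) + P.β) / P.expo))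

/-- The bound on the number of successful iterations; `gap` stands for `f(x₀) - f_low`. -/
def Params.succMax (P : Params) (L gap ε : ℝ) : ℕ :=
  ⌊P.kappaP L * gap * P.rate ε⌋₊ + 1

/-- The bound `τ(ε)` on the number of iterations. -/
def Params.tau (P : Params) (L gap ε : ℝ) : ℕ :=
  ⌊(P.succMax L gap ε : ℝ) * (1 + |Real.log P.γ₁| / Real.log P.γ₂) +
    1 / Real.log P.γ₂ * Real.log (P.sigmaMax L / P.σ₀)⌋₊

end ARpDA

end

/-! Complexity follows from three bounds that hold along every run.

(1) `σ` stays bounded. A step passed on to Step 3 satisfies `σ ‖s‖^(p+β) / (p+β)! ≤ Δ`, where `Δ` is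
its computed Taylor decrease. The Taylor error of `f` is then at most `(L/σ) Δ`, and the errors in
the derivatives and in the two function values are at most `ω Δ ≤ Δ/σ` each. A large `σ` therefore
makes the iteration very successful (`GoodStep.le_ratio`, `GoodStep.sigma_le`), and `ω` stays above
`omegaMin`.

(2) Few reductions occur. VERIFY can return `0` only if some threshold exceeds a fixed multiple of
`ω ε` (`of_verify_eq_zero`). The thresholds are never reset and shrink geometrically, which gives
`nuMax` (`lt_nuMax`).

(3) Successful iterations decrease `f`, by a multiple of `‖s‖^(p+β)` (`GoodStep.decrease`). If `s`
is short, the optimality measure of `f` at `x + s` is at most a multiple of `‖s‖^(p-q+β)` plus a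
fraction of `ε` (`StepCalc.next_le`). If the next Step 1 does not terminate, that measure is not
small, so `‖s‖^(p-q+β)` is at least a multiple of `ε` (`GoodStep.long_or_of_notOptimal`). Each
successful step, except possibly the last, thus gains a fixed amount, and `f_low` limits their
number. Unsuccessful iterations are counted through the growth of `σ` (`le_tau`).

The delicate ingredient of (3) is the distance between the derivatives of `f` and of the model at
`s`. Besides the Hölder Taylor estimate it needs the sharp constant for directional derivatives of
`‖·‖^(p+β)`. Along a unit direction these are Gegenbauer-type polynomials in the cosine of an angle,
and a maximum principle for their differential equation places the maximum of the absolute value at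
the radial directions.

All this is carried by the invariant `Inv`, preserved by every transition (`Inv.trans`). The
algorithm never gets stuck because the model is coercive and its nonzero global minimizers pass the
stopping test for a small radius (`exists_stepCalc`). -/

namespace ARpDA
open Filter Topology Polynomial

/-! ## Derivatives of powers of the norm -/

/-- The polynomials `P_l` such that the `l`-th directional derivative of `‖·‖ ^ r` along a unit
vector, at a unit vector at angle `arccos c` to it, is `P_l(c)`. They are multiples of Gegenbauer
polynomials. -/
noncomputable def normPoly (r : ℝ) : ℕ → ℝ[X]
  | 0 => 1
  | 1 => C r * X
  | l + 2 => C (r - 2 * (l + 1)) * X * normPoly r (l + 1) + C ((l + 1) * (r - l)) * normPoly r l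

/-- Structure relations of Gegenbauer type. They are proved together because the inductive step for
each one uses both. -/
lemma normPoly_derivative (r : ℝ) (l : ℕ) :
    (1 - X ^ 2) * derivative (normPoly r (l + 1)) =
        C ((l + 1) * (r - l)) * normPoly r l - C ((l : ℝ) + 1) * X * normPoly r (l + 1) ∧
      X * derivative (normPoly r (l + 1)) + C ((l : ℝ) + 1) * derivative (normPoly r l) =
        C ((l : ℝ) + 1) * normPoly r (l + 1) := by
  induction l with
  | zero =>
    constructor
    · simp [normPoly]; ring
    · simp [normPoly]
  | succ l ih =>
    obtain ⟨hA, hB⟩ := ih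
    simp only [normPoly, derivative_add, derivative_mul, derivative_C, derivative_X] at hA hB ⊢
    simp only [map_add, map_sub, map_mul, map_natCast, map_one, map_ofNat, Nat.cast_add,
      Nat.cast_one] at hA hB ⊢
    constructor
    · linear_combination (C r - (l : ℝ[X])) * (1 - X ^ 2) * hB - ((l : ℝ[X]) + 2) * X * hA
    · linear_combination (C r - (l : ℝ[X])) * X * hB + ((l : ℝ[X]) + 2) * hA

/-- Differentiate the first relation of `normPoly_derivative` and eliminate the derivative of
`normPoly r l` by the second. -/
lemma normPoly_ode (r : ℝ) (l : ℕ) :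
    (1 - X ^ 2) * derivative (derivative (normPoly r (l + 1))) =
      C (((l : ℝ) + 1) * (r - (l + 1))) * normPoly r (l + 1) -
        C (r - 1) * X * derivative (normPoly r (l + 1)) := by
  obtain ⟨hA, hB⟩ := normPoly_derivative r l
  have h := congrArg derivative hA
  simp only [derivative_mul, derivative_sub, derivative_one, derivative_X_pow, derivative_C,
    derivative_X] at h
  simp only [map_add, map_sub, map_mul, map_natCast, map_one] at h hB ⊢
  norm_num at h
  linear_combination h + (C r - (l : ℝ[X])) * hB

/-- Cosine `1` is the radial direction, where the derivatives are those of `t ^ r` at `t = 1`. -/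
lemma normPoly_eval_one (r : ℝ) (l : ℕ) :
    (normPoly r l).eval 1 = ∏ i ∈ Finset.range l, (r - i) := by
  induction l using Nat.strong_induction_on with
  | _ l ih =>
    match l with
    | 0 => simp [normPoly]
    | 1 => simp [normPoly]
    | l + 2 =>
      rw [normPoly]
      simp only [eval_add, eval_mul, eval_C, eval_X, ih (l + 1) (by omega), ih l (by omega),
        Finset.prod_range_succ]
      push_cast
      ring

lemma normPoly_eval_neg (r : ℝ) (l : ℕ) (c : ℝ) :
    (normPoly r l).eval (-c) = (-1) ^ l * (normPoly r l).eval c := by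
  induction l using Nat.strong_induction_on with
  | _ l ih =>
    match l with
    | 0 => simp [normPoly]
    | 1 => simp [normPoly]
    | l + 2 =>
      rw [normPoly]
      simp only [eval_add, eval_mul, eval_C, eval_X, ih (l + 1) (by omega), ih l (by omega)]
      ring

/-- A maximum principle. -/
lemma eval_le_of_ode {y : ℝ[X]} {K b M : ℝ} (hK : 0 < K) (hM : 0 ≤ M)
    (hode : (1 - X ^ 2) * derivative (derivative y) = C K * y - C b * X * derivative y)
    (h1 : y.eval 1 ≤ M) (h2 : y.eval (-1) ≤ M) {c : ℝ} (hc : c ∈ Set.Icc (-1 : ℝ) 1) :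
    y.eval c ≤ M := by
  obtain ⟨z, hz, hmax⟩ := isCompact_Icc.exists_isMaxOn ⟨c, hc⟩ (y.continuous.continuousOn)
  refine (hmax hc).trans ?_
  change y.eval z ≤ M
  by_contra! hlt
  have hz1 : z ≠ 1 := fun h => by rw [h] at hlt; linarith
  have hz2 : z ≠ -1 := fun h => by rw [h] at hlt; linarith
  have hz3 : z < 1 := lt_of_le_of_ne hz.2 hz1
  have hz4 : -1 < z := lt_of_le_of_ne hz.1 (Ne.symm hz2)
  have hloc : IsLocalMax (fun t => y.eval t) z :=
    hmax.isLocalMax (Icc_mem_nhds hz4 hz3)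
  have hd : deriv (fun t => y.eval t) = fun t => (derivative y).eval t := by
    ext t; exact y.deriv
  have hdd : deriv (deriv fun t => y.eval t) = fun t => (derivative (derivative y)).eval t := by
    rw [hd]; ext t; exact (derivative y).deriv
  have hd0 : (derivative y).eval z = 0 := by
    have := hloc.deriv_eq_zero
    rwa [hd] at this
  have hode' := congrArg (eval z) hode
  simp only [eval_mul, eval_sub, eval_one, eval_pow, eval_X, eval_C, hd0] at hode'
  -- At the critical point `z` the equation reads `(1 - z²) y''(z) = K y(z)`, and `y(z) > M ≥ 0`.
  have hpos : 0 < (derivative (derivative y)).eval z := by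
    have : 0 < (1 - z ^ 2) * (derivative (derivative y)).eval z := by
      rw [hode']
      have := mul_pos hK (hM.trans_lt hlt)
      linarith
    exact (pos_iff_pos_of_mul_pos this).1 (by nlinarith)
  -- Positive curvature makes the local maximum also a local minimum, so `y` is constant near `z`
  -- and `y''(z) = 0`, a contradiction.
  have hmin : IsLocalMin (fun t => y.eval t) z :=
    isLocalMin_of_deriv_deriv_pos (by rw [hdd]; exact hpos) (by rw [hd]; exact hd0)
      y.continuous.continuousAt
  have hconst : (fun t => y.eval t) =ᶠ[𝓝 z] fun _ => y.eval z := by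
    filter_upwards [hloc, hmin] with t ht ht'
    exact le_antisymm ht ht'
  have h0 := hconst.deriv.deriv_eq
  rw [hdd] at h0
  simp at h0
  linarith

/-- By parity the absolute values at `1` and `-1` agree, and the maximum principle applies to the
polynomial and to its negative. The condition `l < r` makes the zeroth-order coefficient of the
equation positive. -/
lemma abs_normPoly_eval_le {r : ℝ} {l : ℕ} (hl : (l : ℝ) < r) {c : ℝ}
    (hc : c ∈ Set.Icc (-1 : ℝ) 1) :
    |(normPoly r l).eval c| ≤ ∏ i ∈ Finset.range l, (r - i) := by
  cases l with
  | zero => simp [normPoly]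
  | succ l =>
    have hM : 0 ≤ ∏ i ∈ Finset.range (l + 1), (r - i) := by
      refine Finset.prod_nonneg fun i hi => ?_
      have : (i : ℝ) ≤ ((l + 1 : ℕ) : ℝ) := by
        exact_mod_cast (Finset.mem_range.1 hi).le
      linarith
    have hK : 0 < ((l : ℝ) + 1) * (r - (l + 1)) := by
      push_cast at hl
      have : 0 < r - (l + 1) := by linarith
      positivity
    have he := normPoly_eval_one r (l + 1)
    have hone : |(normPoly r (l + 1)).eval 1| ≤ ∏ i ∈ Finset.range (l + 1), (r - i) := by
      rw [he, abs_of_nonneg hM]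
    have hneg : |(normPoly r (l + 1)).eval (-1)| ≤ ∏ i ∈ Finset.range (l + 1), (r - i) := by
      rw [normPoly_eval_neg, abs_mul, abs_pow, abs_neg, abs_one, one_pow, one_mul]
      exact hone
    have hode := normPoly_ode r l
    rw [abs_le]
    refine ⟨?_, eval_le_of_ode hK hM hode (abs_le.1 hone).2 (abs_le.1 hneg).2 hc⟩
    have := eval_le_of_ode (y := -normPoly r (l + 1)) (b := r - 1) hK hM
      (by simp only [derivative_neg]; linear_combination -hode)
      (by rw [eval_neg]; linarith [(abs_le.1 hone).1])
      (by rw [eval_neg]; linarith [(abs_le.1 hneg).1]) hc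
    rw [eval_neg] at this
    linarith

section NormPow

variable {E : Type*} [NormedAddCommGroup E] [InnerProductSpace ℝ E]

lemma contDiffAt_norm_rpow {m : WithTop ℕ∞} (r : ℝ) {y : E} (hy : y ≠ 0) :
    ContDiffAt ℝ m (fun z : E => ‖z‖ ^ r) y :=
  (contDiffAt_norm ℝ hy).rpow_const_of_ne (norm_ne_zero_iff.2 hy)

lemma hasDerivAt_iteratedFDeriv_line {g : E → ℝ} {y : E} (l : ℕ) (d : E) (t : ℝ)
    (hg : ContDiffAt ℝ (l + 1 : ℕ) g (y + t • d)) :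
    HasDerivAt (fun t : ℝ => iteratedFDeriv ℝ l g (y + t • d) fun _ => d)
      (iteratedFDeriv ℝ (l + 1) g (y + t • d) fun _ => d) t := by
  have h1 : DifferentiableAt ℝ (iteratedFDeriv ℝ l g) (y + t • d) :=
    hg.differentiableAt_iteratedFDeriv (by exact_mod_cast Nat.lt_succ_self l)
  have h2 : HasDerivAt (fun t : ℝ => y + t • d) d t := by
    simpa using ((hasDerivAt_id t).smul_const d).const_add y
  have h3 := h1.hasFDerivAt.comp_hasDerivAt t h2
  have h4 := ((ContinuousMultilinearMap.apply ℝ (fun _ : Fin l => E) ℝ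
    (fun _ => d)).hasFDerivAt).comp_hasDerivAt t h3
  rw [iteratedFDeriv_succ_apply_left]
  exact h4

/-- This is the `l`-th derivative along `d` of the identity `‖y‖² ∂_d ‖y‖^r = r ⟨y,d⟩ ‖y‖^r`; the
Leibniz sums are short because `‖y‖²` is quadratic and `⟨y,d⟩` linear. The induction differentiates
the relation once along `y + t d`. -/
lemma norm_rpow_derivs_recurrence (r : ℝ) (d : E) (l : ℕ) {y : E} (hy : y ≠ 0) :
    ‖y‖ ^ 2 * iteratedFDeriv ℝ (l + 1) (fun z : E => ‖z‖ ^ r) y (fun _ => d) =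
      (r - 2 * l) * inner ℝ y d * iteratedFDeriv ℝ l (fun z : E => ‖z‖ ^ r) y (fun _ => d) +
        l * (r - l + 1) * ‖d‖ ^ 2 *
          iteratedFDeriv ℝ (l - 1) (fun z : E => ‖z‖ ^ r) y (fun _ => d) := by
  set W : ℕ → E → ℝ := fun l y => iteratedFDeriv ℝ l (fun z : E => ‖z‖ ^ r) y (fun _ => d)
    with hW
  have hline : ∀ t : ℝ, ∀ y : E, HasDerivAt (fun t : ℝ => y + t • d) d t := fun t y => by
    simpa using ((hasDerivAt_id t).smul_const d).const_add y
  have hWd : ∀ l, ∀ y : E, y ≠ 0 →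
      HasDerivAt (fun t : ℝ => W l (y + t • d)) (W (l + 1) y) 0 := fun l y hy => by
    have := hasDerivAt_iteratedFDeriv_line (g := fun z : E => ‖z‖ ^ r) (y := y) l d 0
      (contDiffAt_norm_rpow r (by simpa using hy))
    simpa [hW] using this
  have hnorm : ∀ y : E, HasDerivAt (fun t : ℝ => ‖y + t • d‖ ^ 2) (2 * inner ℝ y d) 0 :=
    fun y => by simpa using (hline 0 y).norm_sq
  have hinner : ∀ y : E, HasDerivAt (fun t : ℝ => inner ℝ (y + t • d) d) (‖d‖ ^ 2) 0 :=
    fun y => by simpa using (hline 0 y).inner ℝ (hasDerivAt_const (0 : ℝ) d)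
  change ‖y‖ ^ 2 * W (l + 1) y = (r - 2 * l) * inner ℝ y d * W l y +
    l * (r - l + 1) * ‖d‖ ^ 2 * W (l - 1) y
  induction l generalizing y with
  | zero =>
    have hy' : 0 < ‖y‖ := norm_pos_iff.2 hy
    have h2 : HasDerivAt (fun t : ℝ => (‖y + t • d‖ ^ 2) ^ (r / 2))
        (2 * inner ℝ y d * (r / 2) * (‖y‖ ^ 2) ^ (r / 2 - 1)) 0 := by
      have := (hnorm y).rpow_const (p := r / 2) (Or.inl (by simpa using hy))
      simpa using this
    have h3 : (fun t : ℝ => (‖y + t • d‖ ^ 2) ^ (r / 2)) = fun t : ℝ => W 0 (y + t • d) := by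
      ext t
      rw [hW]
      simp only [iteratedFDeriv_zero_apply]
      rw [← Real.rpow_natCast, ← Real.rpow_mul (norm_nonneg _)]
      congr 1
      push_cast
      ring
    rw [h3] at h2
    have h4 := (hWd 0 y hy).unique h2
    have h5 : ‖y‖ ^ 2 * (‖y‖ ^ 2) ^ (r / 2 - 1) = W 0 y := by
      rw [hW]
      simp only [iteratedFDeriv_zero_apply]
      nth_rewrite 1 [← Real.rpow_one (‖y‖ ^ 2)]
      rw [← Real.rpow_add (by positivity), ← Real.rpow_natCast, ← Real.rpow_mul hy'.le]
      congr 1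
      push_cast
      ring
    rw [h4, ← h5]
    push_cast
    ring
  | succ l ih =>
    have hev : ∀ᶠ t : ℝ in 𝓝 0, y + t • d ≠ 0 :=
      (hline 0 y).continuousAt.eventually_ne (by simpa using hy)
    have hl := (hnorm y).mul (hWd (l + 1) y hy)
    -- For `l = 0` the factor `l` vanishes, so the truncated index `l - 1` does no harm.
    have hlast : HasDerivAt
        (fun t : ℝ => l * (r - l + 1) * ‖d‖ ^ 2 * W (l - 1) (y + t • d))
        (l * (r - l + 1) * ‖d‖ ^ 2 * W l y) 0 := by
      cases l with
      | zero => simpa using hasDerivAt_const (0 : ℝ) (0 : ℝ)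
      | succ l => exact (hWd l y hy).const_mul _
    have hr := (((hinner y).const_mul (r - 2 * l)).mul (hWd l y hy)).add hlast
    have heq : (fun t : ℝ => ‖y + t • d‖ ^ 2 * W (l + 1) (y + t • d)) =ᶠ[𝓝 0]
        fun t : ℝ => (r - 2 * l) * inner ℝ (y + t • d) d * W l (y + t • d) +
          l * (r - l + 1) * ‖d‖ ^ 2 * W (l - 1) (y + t • d) := by
      filter_upwards [hev] with t ht using ih ht
    have := (hl.congr_of_eventuallyEq heq.symm).unique hr
    simp only [zero_smul, add_zero] at this
    simp only [Nat.add_sub_cancel]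
    push_cast
    linear_combination this

/-- The directional derivatives of `‖·‖ ^ r` in terms of `normPoly`. -/
lemma iteratedFDeriv_norm_rpow_eq (r : ℝ) (d : E) (l : ℕ) {y : E} (hy : y ≠ 0) :
    iteratedFDeriv ℝ l (fun z : E => ‖z‖ ^ r) y (fun _ => d) =
      ‖y‖ ^ (r - l) * ‖d‖ ^ l * (normPoly r l).eval (inner ℝ y d / (‖y‖ * ‖d‖)) := by
  have hy' : 0 < ‖y‖ := norm_pos_iff.2 hy
  -- For `d = 0` the quotient is `0` by convention and both sides vanish.
  have hc : inner ℝ y d = ‖y‖ * ‖d‖ * (inner ℝ y d / (‖y‖ * ‖d‖)) := by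
    rcases eq_or_ne d 0 with rfl | hd
    · simp
    · have : ‖d‖ ≠ 0 := norm_ne_zero_iff.2 hd
      field_simp
  have hpow : ∀ a : ℝ, ∀ m : ℕ, ‖y‖ ^ a = ‖y‖ ^ (a - m) * ‖y‖ ^ m := fun a m => by
    rw [← Real.rpow_natCast, ← Real.rpow_add hy', sub_add_cancel]
  have hone : ‖y‖ ^ 2 * iteratedFDeriv ℝ 1 (fun z : E => ‖z‖ ^ r) y (fun _ => d) =
      r * inner ℝ y d * ‖y‖ ^ r := by
    simpa using norm_rpow_derivs_recurrence r d 0 hy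
  induction l using Nat.strong_induction_on with
  | _ l ih =>
    match l with
    | 0 => simp [normPoly]
    | 1 =>
      apply mul_left_cancel₀ (pow_ne_zero 2 hy'.ne')
      rw [hone]
      simp only [normPoly, eval_mul, eval_C, eval_X]
      nth_rewrite 1 [hc]
      rw [hpow r 1]
      push_cast
      ring
    | l + 2 =>
      apply mul_left_cancel₀ (pow_ne_zero 2 hy'.ne')
      rw [norm_rpow_derivs_recurrence r d (l + 1) hy, Nat.add_sub_cancel, ih (l + 1) (by omega),
        ih l (by omega)]
      rw [normPoly]
      simp only [eval_add, eval_mul, eval_C, eval_X]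
      generalize inner ℝ y d / (‖y‖ * ‖d‖) = c at hc
      rw [hc, hpow (r - (l + 1 : ℕ)) 1, hpow (r - l) 2]
      have e1 : r - ((l + 1 : ℕ) : ℝ) - (1 : ℕ) = r - ((l + 2 : ℕ) : ℝ) := by push_cast; ring
      have e2 : r - (l : ℝ) - (2 : ℕ) = r - ((l + 2 : ℕ) : ℝ) := by push_cast; ring
      rw [e1, e2]
      push_cast
      ring

/-- The sharp bound for the directional derivatives of `‖·‖ ^ r` of order `l < r`. -/
lemma abs_iteratedFDeriv_norm_rpow_le {r : ℝ} {l : ℕ} (hl : (l : ℝ) < r) (d : E) {y : E}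
    (hy : y ≠ 0) :
    |iteratedFDeriv ℝ l (fun z : E => ‖z‖ ^ r) y (fun _ => d)| ≤
      (∏ i ∈ Finset.range l, (r - i)) * ‖y‖ ^ (r - l) * ‖d‖ ^ l := by
  rw [iteratedFDeriv_norm_rpow_eq r d l hy, abs_mul, abs_of_nonneg (by positivity)]
  have hc : inner ℝ y d / (‖y‖ * ‖d‖) ∈ Set.Icc (-1 : ℝ) 1 :=
    abs_le.1 (abs_real_inner_div_norm_mul_norm_le_one y d)
  calc _ ≤ ‖y‖ ^ (r - l) * ‖d‖ ^ l * ∏ i ∈ Finset.range l, (r - i) :=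
        mul_le_mul_of_nonneg_left (abs_normPoly_eval_le hl hc) (by positivity)
    _ = _ := by ring

end NormPow
end ARpDA

namespace ARpDA
open Filter Topology

/-! ## Taylor expansions of functions with Hölder continuous derivatives -/

/-! ### Symmetry of higher derivatives. -/

section Symmetry

variable {E : Type*} [NormedAddCommGroup E] [NormedSpace ℝ E]

/-- The derivative of order `m` of a `C^m` function is symmetric. -/
lemma iteratedFDeriv_comp_perm_of_contDiff {f : E → ℝ} {m : ℕ} (hf : ContDiff ℝ m f) (x : E)
    (v : Fin m → E) (σ : Equiv.Perm (Fin m)) :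
    iteratedFDeriv ℝ m f x (v ∘ σ) = iteratedFDeriv ℝ m f x v := by
  induction m generalizing x with
  | zero => congr 1; ext i; exact i.elim0
  | succ m ih =>
    have hdiff : ∀ y, DifferentiableAt ℝ (iteratedFDeriv ℝ m f) y := fun y =>
      hf.contDiffAt.differentiableAt_iteratedFDeriv (by exact_mod_cast Nat.lt_succ_self m)
    have happly : ∀ (l : ℕ) (y a : E) (w : Fin l → E),
        DifferentiableAt ℝ (iteratedFDeriv ℝ l f) y →
        fderiv ℝ (iteratedFDeriv ℝ l f) y a w =
          fderiv ℝ (fun z => iteratedFDeriv ℝ l f z w) y a := fun l y a w hd => by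
      have h := ((ContinuousMultilinearMap.apply ℝ (fun _ : Fin l => E) ℝ w).hasFDerivAt).comp y
        hd.hasFDerivAt
      have h' : fderiv ℝ (fun z => iteratedFDeriv ℝ l f z w) y =
        (ContinuousMultilinearMap.apply ℝ (fun _ : Fin l => E) ℝ w).comp
          (fderiv ℝ (iteratedFDeriv ℝ l f) y) := h.fderiv
      rw [h']
      rfl
    -- Adjacent transpositions generate the symmetric group, so one of them suffices.
    have hσ : σ ∈ Submonoid.closure
        (Set.range fun i : Fin m => Equiv.swap i.castSucc i.succ) := by
      rw [Equiv.Perm.mclosure_swap_castSucc_succ]; trivial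
    induction hσ using Submonoid.closure_induction generalizing v with
    | one => rfl
    | mul σ τ _ _ hσ hτ =>
      have : v ∘ (σ * τ) = (v ∘ σ) ∘ τ := rfl
      rw [this, hτ, hσ]
    | mem σ h =>
      obtain ⟨i, rfl⟩ := h
      obtain ⟨m, rfl⟩ : ∃ m', m = m' + 1 := ⟨m - 1, by have := i.pos; omega⟩
      -- Exchanging the first two arguments is the symmetry of the second derivative of the `C²`
      -- function `z ↦ D^m f(z)[u]`. Any other adjacent swap fixes the first argument, and the
      -- induction hypothesis applies to the tail before the last differentiation.
      refine Fin.cases ?_ (fun i => ?_) i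
      · have h2 : ∀ w : Fin (m + 2) → E, iteratedFDeriv ℝ (m + 1 + 1) f x w =
            fderiv ℝ (fun z => fderiv ℝ (fun z => iteratedFDeriv ℝ m f z (fun k => w k.succ.succ))
              z (w 1)) x (w 0) := fun w => by
          rw [iteratedFDeriv_succ_apply_left, happly _ _ _ _ (hdiff x)]
          congr 2
          ext z
          rw [iteratedFDeriv_succ_apply_left, happly]
          · rfl
          · exact hf.contDiffAt.differentiableAt_iteratedFDeriv
              (by exact_mod_cast Nat.lt_succ_of_lt (Nat.lt_succ_self m))
        rw [h2, h2]
        set u : Fin m → E := fun k => v k.succ.succ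
        have e1 : (fun k : Fin m => (v ∘ ⇑(Equiv.swap (Fin.castSucc (0 : Fin (m + 1)))
            (Fin.succ 0))) k.succ.succ) = u := by
          ext1 k
          simp only [Function.comp_apply, u]
          rw [Equiv.swap_apply_of_ne_of_ne]
          · exact Fin.succ_ne_zero _
          · exact fun h => Fin.succ_ne_zero _ (Fin.succ_injective _ h)
        rw [e1]
        have e2 : (v ∘ ⇑(Equiv.swap (Fin.castSucc (0 : Fin (m + 1))) (Fin.succ 0))) 0 = v 1 := by
          simp
        have e3 : (v ∘ ⇑(Equiv.swap (Fin.castSucc (0 : Fin (m + 1))) (Fin.succ 0))) 1 = v 0 := by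
          simp
        rw [e2, e3]
        have hC : ContDiff ℝ 2 (fun z => iteratedFDeriv ℝ m f z u) :=
          ((ContinuousMultilinearMap.apply ℝ (fun _ : Fin m => E) ℝ u).contDiff).comp
            (hf.iteratedFDeriv_right (i := m) (m := 2) (by norm_cast; omega))
        have hs := hC.contDiffAt.isSymmSndFDerivAt (x := x) (by simp)
        have hd2 : DifferentiableAt ℝ (fderiv ℝ fun z => iteratedFDeriv ℝ m f z u) x :=
          (hC.fderiv_right (m := 1) (by norm_num)).differentiable (by norm_num) x
        have e4 : ∀ a b : E, fderiv ℝ (fun z => fderiv ℝ (fun z => iteratedFDeriv ℝ m f z u) z a)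
            x b = fderiv ℝ (fderiv ℝ fun z => iteratedFDeriv ℝ m f z u) x b a := fun a b => by
          rw [fderiv_clm_apply hd2 (by fun_prop)]
          simp
        rw [e4, e4]
        exact hs _ _
      · rw [iteratedFDeriv_succ_apply_left, iteratedFDeriv_succ_apply_left, happly _ _ _ _ (hdiff x),
          happly _ _ _ _ (hdiff x)]
        have e0 : (v ∘ ⇑(Equiv.swap i.succ.castSucc i.succ.succ)) 0 = v 0 := by
          simp only [Function.comp_apply]
          rw [Equiv.swap_apply_of_ne_of_ne]
          · rw [← Fin.succ_castSucc]; exact (Fin.succ_ne_zero _).symm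
          · exact (Fin.succ_ne_zero _).symm
        have e1 : Fin.tail (v ∘ ⇑(Equiv.swap i.succ.castSucc i.succ.succ)) =
            Fin.tail v ∘ ⇑(Equiv.swap i.castSucc i.succ) := by
          ext1 k
          simp only [Fin.tail, Function.comp_apply]
          rw [← Fin.succ_castSucc]
          congr 1
          exact (Fin.succ_injective _).swap_apply _ _ _
        rw [e0, e1]
        congr 2
        ext z
        exact ih (hf.of_le (by norm_cast; omega)) z _ _

end Symmetry

/-! ### Homogeneous polynomials attached to multilinear maps. -/

section Diagonal

variable {E : Type*} [NormedAddCommGroup E] [NormedSpace ℝ E]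

lemma contDiff_diagonal {m : WithTop ℕ∞} {j : ℕ}
    (A : ContinuousMultilinearMap ℝ (fun _ : Fin j => E) ℝ) :
    ContDiff ℝ m fun y : E => A fun _ => y :=
  A.contDiff.comp (contDiff_pi.2 fun _ => contDiff_id)

/-- The diagonal embedding into the sup-normed product has norm at most one, so the bound for the
multilinear map carries over. For `l > j` the factor `descFactorial` is zero, which later removes
the terms of lower degree. -/
lemma norm_iteratedFDeriv_diagonal_le {j : ℕ}
    (A : ContinuousMultilinearMap ℝ (fun _ : Fin j => E) ℝ) (l : ℕ) (y : E) :
    ‖iteratedFDeriv ℝ l (fun y : E => A fun _ => y) y‖ ≤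
      j.descFactorial l * ‖A‖ * ‖y‖ ^ (j - l) := by
  let g : E →L[ℝ] (Fin j → E) := ContinuousLinearMap.pi fun _ => ContinuousLinearMap.id ℝ E
  have hg : ‖g‖ ≤ 1 := ContinuousLinearMap.opNorm_le_bound _ zero_le_one fun z => by
    rw [one_mul]
    exact (pi_norm_le_iff_of_nonneg (norm_nonneg _)).2 fun _ => le_rfl
  have h1 : (fun y : E => A fun _ => y) = A ∘ g := rfl
  rw [h1, g.iteratedFDeriv_comp_right A.contDiff y (i := l) (n := l) le_rfl]
  refine (ContinuousMultilinearMap.norm_compContinuousLinearMap_le _ _).trans ?_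
  have h2 := A.norm_iteratedFDeriv_le l (g y)
  rw [Fintype.card_fin] at h2
  have h3 : ‖g y‖ ≤ ‖y‖ := (pi_norm_le_iff_of_nonneg (norm_nonneg _)).2 fun _ => le_rfl
  calc _ ≤ ‖iteratedFDeriv ℝ l (⇑A) (g y)‖ * 1 := by
        gcongr
        exact Finset.prod_le_one (fun _ _ => norm_nonneg _) fun _ _ => hg
    _ ≤ _ := by
        rw [mul_one]
        refine h2.trans ?_
        gcongr

end Diagonal

/-! ### Integration of a Hölder bound on the top derivative. -/

section Holder

variable {E : Type*} [NormedAddCommGroup E] [NormedSpace ℝ E]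

lemma genFact_succ (i : ℕ) (β : ℝ) : genFact (i + 1) β = genFact i β * ((i : ℝ) + 1 + β) := by
  rw [genFact, Finset.prod_Icc_succ_top (by omega), genFact]
  push_cast
  rfl

lemma genFact_pos {β : ℝ} (hβ : 0 < β) (i : ℕ) : 0 < genFact i β :=
  Finset.prod_pos fun _ _ => by positivity

/-- Integrate the bound on the top derivative along the segment, one order at a time. Integrating
`t^(i+β)` divides by `i+1+β`, and these divisors build up `genFact`. -/
lemma norm_iteratedFDeriv_le_of_holder {h : E → ℝ} {p : ℕ} (hh : ContDiff ℝ p h) {x : E}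
    {L β : ℝ} (hβ : 0 < β) (h0 : ∀ j < p, iteratedFDeriv ℝ j h x = 0)
    (hp : ∀ s, ‖iteratedFDeriv ℝ p h (x + s)‖ ≤ L * ‖s‖ ^ β) (i l : ℕ) (hil : l + i = p) (s : E) :
    ‖iteratedFDeriv ℝ l h (x + s)‖ ≤ L / genFact i β * ‖s‖ ^ ((i : ℝ) + β) := by
  induction i generalizing l s with
  | zero =>
    obtain rfl : l = p := hil
    simpa [genFact] using hp s
  | succ i ih =>
    have hg := genFact_pos hβ i
    have hd : ∀ t : ℝ, HasDerivAt (fun t : ℝ => iteratedFDeriv ℝ l h (x + t • s))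
        (fderiv ℝ (iteratedFDeriv ℝ l h) (x + t • s) s) t := fun t => by
      have h1 : DifferentiableAt ℝ (iteratedFDeriv ℝ l h) (x + t • s) :=
        hh.contDiffAt.differentiableAt_iteratedFDeriv (by norm_cast; omega)
      have h2 : HasDerivAt (fun t : ℝ => x + t • s) s t := by
        simpa using ((hasDerivAt_id t).smul_const s).const_add x
      exact h1.hasFDerivAt.comp_hasDerivAt t h2
    have hB : ∀ t : ℝ, HasDerivAt
        (fun t : ℝ => L / genFact (i + 1) β * ‖s‖ ^ (((i + 1 : ℕ) : ℝ) + β) *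
          t ^ ((i : ℝ) + 1 + β))
        (L / genFact i β * ‖s‖ ^ (((i + 1 : ℕ) : ℝ) + β) * t ^ ((i : ℝ) + β)) t := fun t => by
      have h3 := (Real.hasDerivAt_rpow_const (x := t) (p := (i : ℝ) + 1 + β)
        (Or.inr (by have := (Nat.cast_nonneg (α := ℝ) i); linarith))).const_mul
          (L / genFact (i + 1) β * ‖s‖ ^ (((i + 1 : ℕ) : ℝ) + β))
      have h4 : L / genFact (i + 1) β * ‖s‖ ^ (((i + 1 : ℕ) : ℝ) + β) *
          (((i : ℝ) + 1 + β) * t ^ ((i : ℝ) + 1 + β - 1)) =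
          L / genFact i β * ‖s‖ ^ (((i + 1 : ℕ) : ℝ) + β) * t ^ ((i : ℝ) + β) := by
        rw [genFact_succ, show (i : ℝ) + 1 + β - 1 = i + β by ring]
        have : (i : ℝ) + 1 + β ≠ 0 := by positivity
        field_simp
      rw [← h4]
      exact h3
    have hfin := image_norm_le_of_norm_deriv_right_le_deriv_boundary (a := 0) (b := 1)
      (f := fun t : ℝ => iteratedFDeriv ℝ l h (x + t • s))
      (fun t _ => (hd t).continuousAt.continuousWithinAt)
      (fun t _ => (hd t).hasDerivWithinAt)
      (by
        have h1 : (i : ℝ) + 1 + β ≠ 0 := by positivity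
        simp [h0 l (by omega), Real.zero_rpow h1])
      hB
      (fun t ht => by
        refine (ContinuousLinearMap.le_opNorm _ _).trans ?_
        rw [norm_fderiv_iteratedFDeriv]
        have h1 := ih (l + 1) (by omega) (t • s)
        have h2 : ‖s‖ ^ (((i + 1 : ℕ) : ℝ) + β) = ‖s‖ ^ ((i : ℝ) + β) * ‖s‖ := by
          have h3 : (((i + 1 : ℕ) : ℝ) + β) = (i : ℝ) + β + 1 := by push_cast; ring
          rw [h3, Real.rpow_add_one' (norm_nonneg _) (by positivity)]
        calc _ ≤ L / genFact i β * ‖t • s‖ ^ ((i : ℝ) + β) * ‖s‖ := by gcongr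
          _ = _ := by
            rw [norm_smul, Real.norm_of_nonneg ht.1, Real.mul_rpow ht.1 (norm_nonneg _), h2]
            ring)
      (Set.right_mem_Icc.2 zero_le_one)
    simpa using hfin

end Holder
end ARpDA

namespace ARpDA
open Filter Topology

/-! ## Taylor polynomials and the regularized model -/

lemma genFact_mono {β : ℝ} (hβ : 0 < β) : Monotone fun i => genFact i β := by
  refine monotone_nat_of_le_succ fun i => ?_
  rw [genFact_succ]
  have := genFact_pos hβ i
  have : (0 : ℝ) ≤ i := Nat.cast_nonneg i
  nlinarith

/-- With this, the sharp constant for `‖·‖^(p+β)` divided by `(p+β)!` becomes `1/(p-l+β)!`, the same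
constant as in the Taylor error. -/
lemma prod_mul_genFact (β : ℝ) {p l : ℕ} (hl : l ≤ p) :
    (∏ i ∈ Finset.range l, ((p : ℝ) + β - i)) * genFact (p - l) β = genFact p β := by
  induction l with
  | zero => simp
  | succ l ih =>
    rw [← ih (by omega), Finset.prod_range_succ, show p - l = (p - (l + 1)) + 1 by omega,
      genFact_succ]
    have : ((p - (l + 1) : ℕ) : ℝ) = p - (l + 1) := by rw [Nat.cast_sub hl]; push_cast; ring
    rw [this]
    ring

lemma chi_nonneg (q : ℕ) {δ : ℝ} (hδ : 0 ≤ δ) : 0 ≤ chi q δ :=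
  Finset.sum_nonneg fun _ _ => by positivity

lemma le_chi {q : ℕ} (hq : 1 ≤ q) {δ : ℝ} (hδ : 0 ≤ δ) : δ ≤ chi q δ := by
  have := Finset.single_le_sum (f := fun l => δ ^ l / (l.factorial : ℝ))
    (fun i _ => by positivity) (Finset.mem_Icc.2 ⟨le_rfl, hq⟩)
  simpa [chi] using this

lemma chi_pos {q : ℕ} (hq : 1 ≤ q) {δ : ℝ} (hδ : 0 < δ) : 0 < chi q δ :=
  hδ.trans_le (le_chi hq hδ.le)

variable {n : ℕ}

lemma inc_eq (D : Tensors n) (r : ℕ) (s : EuclideanSpace ℝ (Fin n)) :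
    inc D r s = -∑ l ∈ Finset.Icc 1 r, (1 / (l.factorial : ℝ)) * D l (fun _ => s) := by
  have : ∑ l ∈ Finset.Icc 1 r, (1 / (l.factorial : ℝ)) *
      D l (fun _ => (0 : EuclideanSpace ℝ (Fin n))) = 0 := by
    refine Finset.sum_eq_zero fun l hl => ?_
    have hl1 : 1 ≤ l := (Finset.mem_Icc.1 hl).1
    rw [(D l).map_coord_zero ⟨0, hl1⟩ rfl, mul_zero]
  rw [inc, taylor, taylor, this]
  ring

lemma taylor_eq (c : ℝ) (D : Tensors n) (r : ℕ) (s : EuclideanSpace ℝ (Fin n)) :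
    taylor c D r s = c - inc D r s := by
  rw [inc_eq, taylor]
  ring

lemma inc_zero (D : Tensors n) (r : ℕ) : inc D r 0 = 0 := by rw [inc, sub_self]

lemma abs_inc_sub_le {D D' : Tensors n} {r : ℕ} {ζ : ℕ → ℝ}
    (h : ∀ j ∈ Finset.Icc 1 r, ‖D j - D' j‖ ≤ ζ j) {s : EuclideanSpace ℝ (Fin n)} {δ : ℝ}
    (hs : ‖s‖ ≤ δ) :
    |inc D r s - inc D' r s| ≤ ∑ j ∈ Finset.Icc 1 r, ζ j / (j.factorial : ℝ) * δ ^ j := by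
  have h1 : inc D r s - inc D' r s =
      -∑ l ∈ Finset.Icc 1 r, (1 / (l.factorial : ℝ)) * (D l - D' l) (fun _ => s) := by
    rw [inc_eq, inc_eq, neg_sub_neg, ← Finset.sum_sub_distrib, ← Finset.sum_neg_distrib]
    refine Finset.sum_congr rfl fun l _ => ?_
    rw [sub_apply]
    ring
  rw [h1, abs_neg]
  refine (Finset.abs_sum_le_sum_abs _ _).trans (Finset.sum_le_sum fun l hl => ?_)
  rw [abs_mul, abs_of_nonneg (by positivity), one_div_mul_eq_div, div_mul_eq_mul_div]
  refine div_le_div_of_nonneg_right ?_ (by positivity)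
  have h2 := (D l - D' l).le_opNorm fun _ => s
  rw [Finset.prod_const, Finset.card_univ, Fintype.card_fin, Real.norm_eq_abs] at h2
  refine h2.trans ?_
  have h3 := h l hl
  have : 0 ≤ ζ l := (norm_nonneg _).trans h3
  gcongr

lemma contDiff_taylor {m : WithTop ℕ∞} (c : ℝ) (D : Tensors n) (r : ℕ) :
    ContDiff ℝ m (taylor c D r) :=
  contDiff_const.add (ContDiff.sum fun l _ => contDiff_const.mul (contDiff_diagonal (D l)))

lemma continuous_inc (D : Tensors n) (r : ℕ) : Continuous (inc D r) :=
  continuous_const.sub (contDiff_taylor (m := 0) 0 D r).continuous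

lemma iteratedFDeriv_taylor (c : ℝ) (D : Tensors n) (r : ℕ) {l : ℕ} (hl : l ≠ 0)
    (s : EuclideanSpace ℝ (Fin n)) :
    iteratedFDeriv ℝ l (taylor c D r) s = ∑ j ∈ Finset.Icc 1 r, (1 / (j.factorial : ℝ)) •
      iteratedFDeriv ℝ l (fun y : EuclideanSpace ℝ (Fin n) => D j fun _ => y) s := by
  have h1 : taylor c D r = (fun _ => c) + fun s => ∑ j ∈ Finset.Icc 1 r,
      (1 / (j.factorial : ℝ)) • D j fun _ => s := rfl
  rw [h1, iteratedFDeriv_add_apply contDiff_const.contDiffAt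
    (ContDiff.sum fun l _ => (contDiff_diagonal (D l)).const_smul _).contDiffAt,
    iteratedFDeriv_const_of_ne hl, Pi.zero_apply, zero_add, iteratedFDeriv_fun_sum_apply]
  · refine Finset.sum_congr rfl fun j _ => ?_
    rw [iteratedFDeriv_const_smul_apply' (contDiff_diagonal (D j)).contDiffAt]
  · exact fun j _ => ((contDiff_diagonal (D j)).const_smul _).contDiffAt

/-- The degree `j` part contributes a sum over `j!` permutations of equal terms. Lower degrees are
killed by `j` differentiations; higher ones vanish at `0`, and there are none if `j = r`. -/
lemma iteratedFDeriv_taylor_eq_self {D : Tensors n} {r j : ℕ} (hj : j ∈ Finset.Icc 1 r)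
    (hsymm : ∀ (v : Fin j → EuclideanSpace ℝ (Fin n)) (σ : Equiv.Perm (Fin j)),
      D j (v ∘ σ) = D j v)
    (c : ℝ) {s : EuclideanSpace ℝ (Fin n)} (hs : s = 0 ∨ j = r) :
    iteratedFDeriv ℝ j (taylor c D r) s = D j := by
  rw [iteratedFDeriv_taylor c D r (by have := (Finset.mem_Icc.1 hj).1; omega),
    Finset.sum_eq_single_of_mem j hj]
  · ext v
    have hσ : ∀ σ : Equiv.Perm (Fin j), D j (fun i => v (σ i)) = D j v := fun σ => hsymm v σ
    rw [smul_apply, ContinuousMultilinearMap.iteratedFDeriv_comp_diagonal,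
      Finset.sum_congr rfl fun σ _ => hσ σ, Finset.sum_const, Finset.card_univ,
      Fintype.card_perm, Fintype.card_fin, nsmul_eq_mul, smul_eq_mul, ← mul_assoc, one_div,
      inv_mul_cancel₀ (by positivity), one_mul]
  · intro i hi hij
    suffices h : iteratedFDeriv ℝ j (fun y : EuclideanSpace ℝ (Fin n) => D i fun _ => y) s = 0 by
      rw [h, smul_zero]
    rw [← norm_le_zero_iff]
    refine (norm_iteratedFDeriv_diagonal_le (D i) j s).trans (le_of_eq ?_)
    rcases lt_or_gt_of_ne hij with h | h
    · rw [Nat.descFactorial_of_lt h]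
      simp
    · rcases hs with rfl | rfl
      · rw [norm_zero, zero_pow (by omega), mul_zero]
      · have := (Finset.mem_Icc.1 hi).2
        omega

section Holder

variable {f : EuclideanSpace ℝ (Fin n) → ℝ} {p : ℕ} {L β : ℝ}

/-- The error bound for the derivatives of the Taylor polynomial of a function with Hölder
continuous derivative of order `p`. -/
lemma norm_iteratedFDeriv_sub_taylor_le (hp : 1 ≤ p) (hβ : 0 < β) (hf : ContDiff ℝ p f)
    (hL : ∀ x y, ‖iteratedFDeriv ℝ p f x - iteratedFDeriv ℝ p f y‖ ≤ L * ‖x - y‖ ^ β)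
    (x s : EuclideanSpace ℝ (Fin n)) {l : ℕ} (hl : l ≤ p) :
    ‖iteratedFDeriv ℝ l f (x + s) - iteratedFDeriv ℝ l (taylor (f x) (derivs f x) p) s‖ ≤
      L / genFact (p - l) β * ‖s‖ ^ (((p - l : ℕ) : ℝ) + β) := by
  -- The derivatives of `h` of order below `p` vanish at `0`. Its `p`-th derivative is the increment
  -- of that of `f`, because the `p`-th derivative of the Taylor polynomial is constant.
  set h : EuclideanSpace ℝ (Fin n) → ℝ :=
    fun s => f (x + s) - taylor (f x) (derivs f x) p s with hh
  have hfx : ContDiff ℝ p fun s => f (x + s) := hf.comp (contDiff_const.add contDiff_id)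
  have hh' : ContDiff ℝ p h := hfx.sub (contDiff_taylor _ _ _)
  have hsub : ∀ j ≤ p, ∀ s, iteratedFDeriv ℝ j h s =
      iteratedFDeriv ℝ j f (x + s) - iteratedFDeriv ℝ j (taylor (f x) (derivs f x) p) s := by
    intro j hj s
    have h1 : h = (fun s => f (x + s)) - taylor (f x) (derivs f x) p := rfl
    rw [h1, iteratedFDeriv_sub_apply (hfx.of_le (by norm_cast)).contDiffAt
      (contDiff_taylor _ _ _).contDiffAt, iteratedFDeriv_comp_add_left]
  have hself : ∀ j ∈ Finset.Icc 1 p, ∀ s, (s = 0 ∨ j = p) →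
      iteratedFDeriv ℝ j (taylor (f x) (derivs f x) p) s = iteratedFDeriv ℝ j f x :=
    fun j hj s hs => iteratedFDeriv_taylor_eq_self hj (fun v σ =>
      iteratedFDeriv_comp_perm_of_contDiff
        (hf.of_le (by exact_mod_cast (Finset.mem_Icc.1 hj).2)) x v σ) _ hs
  have h0 : ∀ j < p, iteratedFDeriv ℝ j h 0 = 0 := by
    intro j hj
    rcases Nat.eq_zero_or_pos j with rfl | hj0
    · ext v
      rw [iteratedFDeriv_zero_apply, hh]
      simp [taylor_eq, inc_zero]
    · rw [hsub j hj.le, hself j (Finset.mem_Icc.2 ⟨hj0, hj.le⟩) 0 (Or.inl rfl), add_zero, sub_self]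
  have hpb : ∀ s, ‖iteratedFDeriv ℝ p h (0 + s)‖ ≤ L * ‖s‖ ^ β := fun s => by
    rw [zero_add, hsub p le_rfl, hself p (Finset.mem_Icc.2 ⟨hp, le_rfl⟩) s (Or.inr rfl)]
    simpa using hL (x + s) x
  have := norm_iteratedFDeriv_le_of_holder hh' hβ h0 hpb (p - l) l (by omega) s
  rwa [zero_add, hsub l hl] at this

lemma abs_sub_sub_inc_le (hp : 1 ≤ p) (hβ : 0 < β) (hf : ContDiff ℝ p f)
    (hL : ∀ x y, ‖iteratedFDeriv ℝ p f x - iteratedFDeriv ℝ p f y‖ ≤ L * ‖x - y‖ ^ β)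
    (x s : EuclideanSpace ℝ (Fin n)) :
    |f x - f (x + s) - inc (derivs f x) p s| ≤ L / genFact p β * ‖s‖ ^ ((p : ℝ) + β) := by
  have h := norm_iteratedFDeriv_sub_taylor_le hp hβ hf hL x s (Nat.zero_le p)
  have h2 := (iteratedFDeriv ℝ 0 f (x + s) -
    iteratedFDeriv ℝ 0 (taylor (f x) (derivs f x) p) s).le_of_opNorm_le h fun _ => 0
  rw [sub_apply, iteratedFDeriv_zero_apply, iteratedFDeriv_zero_apply,
    taylor_eq, Real.norm_eq_abs] at h2
  simp only [Finset.univ_eq_empty, Finset.prod_empty, mul_one, Nat.sub_zero] at h2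
  rw [abs_sub_comm]
  convert h2 using 2
  ring

end Holder

/-- The bound `e < 3` is the origin of the factor `3` in `Params.modelAcc`. -/
lemma sum_inv_factorial_le (m : ℕ) : ∑ i ∈ Finset.range m, (1 : ℝ) / (i.factorial : ℝ) ≤ 3 := by
  have h := Real.sum_le_exp_of_nonneg (zero_le_one' ℝ) m
  simp only [one_pow] at h
  linarith [Real.exp_one_lt_d9]

/-- In the unit ball the term of degree `j ≥ l` contributes at most `acc j / (j - l)!`, and lower
degrees contribute nothing. -/
lemma abs_iteratedFDeriv_taylor_sub_le {D D' : Tensors n} {p : ℕ} {acc : ℕ → ℝ}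
    (h : ∀ j ∈ Finset.Icc 1 p, ‖D j - D' j‖ ≤ acc j) {l : ℕ} (hl : l ∈ Finset.Icc 1 p) (c c' : ℝ)
    {s : EuclideanSpace ℝ (Fin n)} (hs : ‖s‖ ≤ 1) :
    ‖iteratedFDeriv ℝ l (taylor c D p) s - iteratedFDeriv ℝ l (taylor c' D' p) s‖ ≤
      3 * sSup (acc '' Set.Icc l p) := by
  obtain ⟨hl1, hlp⟩ := Finset.mem_Icc.1 hl
  have hbdd : BddAbove (acc '' Set.Icc l p) := ((Set.finite_Icc l p).image acc).bddAbove
  have hle : ∀ j ∈ Finset.Icc l p, acc j ≤ sSup (acc '' Set.Icc l p) := fun j hj =>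
    le_csSup hbdd ⟨j, Finset.mem_Icc.1 hj, rfl⟩
  have hS : 0 ≤ sSup (acc '' Set.Icc l p) :=
    ((norm_nonneg _).trans (h l hl)).trans (hle l (Finset.mem_Icc.2 ⟨le_rfl, hlp⟩))
  rw [iteratedFDeriv_taylor c D p (by omega), iteratedFDeriv_taylor c' D' p (by omega),
    ← Finset.sum_sub_distrib]
  have hterm : ∀ j ∈ Finset.Icc 1 p, ‖(1 / (j.factorial : ℝ)) •
        iteratedFDeriv ℝ l (fun y : EuclideanSpace ℝ (Fin n) => D j fun _ => y) s -
      (1 / (j.factorial : ℝ)) •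
        iteratedFDeriv ℝ l (fun y : EuclideanSpace ℝ (Fin n) => D' j fun _ => y) s‖ ≤
      if l ≤ j then 1 / ((j - l).factorial : ℝ) * sSup (acc '' Set.Icc l p) else 0 := by
    intro j hj
    rw [← smul_sub, ← iteratedFDeriv_sub_apply (contDiff_diagonal (D j)).contDiffAt
      (contDiff_diagonal (D' j)).contDiffAt, norm_smul, Real.norm_of_nonneg (by positivity)]
    have h1 := norm_iteratedFDeriv_diagonal_le (D j - D' j) l s
    have h2 : (fun y : EuclideanSpace ℝ (Fin n) => (D j - D' j) fun _ => y) =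
      (fun y : EuclideanSpace ℝ (Fin n) => D j fun _ => y) -
        fun y : EuclideanSpace ℝ (Fin n) => D' j fun _ => y := rfl
    rw [h2] at h1
    split_ifs with hlj
    · have hf : (1 : ℝ) / (j.factorial : ℝ) * j.descFactorial l = 1 / ((j - l).factorial : ℝ) := by
        rw [← Nat.factorial_mul_descFactorial hlj]
        have : (j.descFactorial l : ℝ) ≠ 0 := by
          exact_mod_cast (Nat.descFactorial_pos.2 hlj).ne'
        push_cast
        field_simp
      have hD : ‖D j - D' j‖ * ‖s‖ ^ (j - l) ≤ sSup (acc '' Set.Icc l p) * 1 :=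
        mul_le_mul ((h j hj).trans (hle j (Finset.mem_Icc.2 ⟨hlj, (Finset.mem_Icc.1 hj).2⟩)))
          (pow_le_one₀ (norm_nonneg _) hs) (by positivity) hS
      calc _ ≤ 1 / (j.factorial : ℝ) * (j.descFactorial l * ‖D j - D' j‖ * ‖s‖ ^ (j - l)) := by
            gcongr
        _ = 1 / (j.factorial : ℝ) * j.descFactorial l * (‖D j - D' j‖ * ‖s‖ ^ (j - l)) := by ring
        _ ≤ _ := by
          rw [hf]
          rw [mul_one] at hD
          gcongr
    · rw [Nat.descFactorial_of_lt (by omega)] at h1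
      simp only [Nat.cast_zero, zero_mul] at h1
      exact mul_nonpos_of_nonneg_of_nonpos (by positivity) h1
  refine (norm_sum_le_of_le _ hterm).trans ?_
  rw [← Finset.sum_filter]
  have hfil : (Finset.Icc 1 p).filter (fun j => l ≤ j) = Finset.Ico l (p + 1) := by
    ext j
    simp only [Finset.mem_filter, Finset.mem_Icc, Finset.mem_Ico]
    omega
  rw [hfil, Finset.sum_Ico_eq_sum_range, ← Finset.sum_mul]
  simp only [Nat.add_sub_cancel_left]
  gcongr
  exact sum_inv_factorial_le _

lemma contDiffAt_model {m : WithTop ℕ∞} (p : ℕ) (β : ℝ) (D : Tensors n) (σ : ℝ)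
    {s : EuclideanSpace ℝ (Fin n)} (hs : s ≠ 0) : ContDiffAt ℝ m (model p β D σ) s :=
  (contDiff_taylor 0 D p).contDiffAt.add
    (contDiffAt_const.mul (contDiffAt_norm_rpow ((p : ℝ) + β) hs))

/-- The derivatives of the model at a short step approximate those of the objective. -/
lemma abs_iteratedFDeriv_sub_model_le {f : EuclideanSpace ℝ (Fin n) → ℝ} {p q : ℕ} {L β σ : ℝ}
    (hβ : 0 < β) (hf : ContDiff ℝ p f) (hL0 : 0 ≤ L)
    (hL : ∀ x y, ‖iteratedFDeriv ℝ p f x - iteratedFDeriv ℝ p f y‖ ≤ L * ‖x - y‖ ^ β)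
    (hqp : q ≤ p) (hσ : 0 ≤ σ) {D : Tensors n} {acc : ℕ → ℝ} {x s : EuclideanSpace ℝ (Fin n)}
    (hD : ∀ j ∈ Finset.Icc 1 p, ‖D j - iteratedFDeriv ℝ j f x‖ ≤ acc j) (hs0 : s ≠ 0)
    (hs1 : ‖s‖ ≤ 1) {l : ℕ} (hl : l ∈ Finset.Icc 1 q) (d : EuclideanSpace ℝ (Fin n)) :
    |iteratedFDeriv ℝ l f (x + s) (fun _ => d) -
        iteratedFDeriv ℝ l (model p β D σ) s (fun _ => d)| ≤
      ((L + σ) * (‖s‖ ^ ((p : ℝ) - q + β) / genFact (p - q) β) +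
        3 * sSup (acc '' Set.Icc l p)) * ‖d‖ ^ l := by
  obtain ⟨hl1, hlq⟩ := Finset.mem_Icc.1 hl
  have hlp : l ≤ p := hlq.trans hqp
  have hspos : 0 < ‖s‖ := norm_pos_iff.2 hs0
  set N : EuclideanSpace ℝ (Fin n) → ℝ := fun z => ‖z‖ ^ ((p : ℝ) + β) with hN
  have hmodel : iteratedFDeriv ℝ l (model p β D σ) s =
      iteratedFDeriv ℝ l (taylor 0 D p) s + (σ / genFact p β) • iteratedFDeriv ℝ l N s := by
    have h1 : model p β D σ = taylor 0 D p + fun z => (σ / genFact p β) • N z := rfl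
    rw [h1, iteratedFDeriv_add_apply (contDiff_taylor _ _ _).contDiffAt
      ((contDiffAt_norm_rpow _ hs0).const_smul _),
      iteratedFDeriv_const_smul_apply' (contDiffAt_norm_rpow _ hs0)]
  have happ : ∀ (A : ContinuousMultilinearMap ℝ (fun _ : Fin l => EuclideanSpace ℝ (Fin n)) ℝ)
      (K : ℝ), ‖A‖ ≤ K → |A fun _ => d| ≤ K * ‖d‖ ^ l := fun A K hK => by
    have h := A.le_of_opNorm_le hK fun _ => d
    rwa [Finset.prod_const, Finset.card_univ, Fintype.card_fin, Real.norm_eq_abs] at h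
  have hcast : ((p - l : ℕ) : ℝ) = (p : ℝ) - l := Nat.cast_sub hlp
  -- Since `‖s‖ ≤ 1`, the order `l = q` is the worst one: smallest exponent and smallest factorial.
  have hexp : ‖s‖ ^ (((p - l : ℕ) : ℝ) + β) / genFact (p - l) β ≤
      ‖s‖ ^ ((p : ℝ) - q + β) / genFact (p - q) β := by
    refine div_le_div₀ (by positivity) ?_ (genFact_pos hβ _) (genFact_mono hβ (by omega))
    refine Real.rpow_le_rpow_of_exponent_ge hspos hs1 ?_
    rw [hcast]
    have : (l : ℝ) ≤ q := by exact_mod_cast hlq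
    linarith
  have h1 := happ _ _ (norm_iteratedFDeriv_sub_taylor_le (hl1.trans hlp) hβ hf hL x s hlp)
  have h2 := happ _ _ (abs_iteratedFDeriv_taylor_sub_le (D' := derivs f x) hD
    (Finset.mem_Icc.2 ⟨hl1, hlp⟩) 0 (f x) hs1)
  have h3 := abs_iteratedFDeriv_norm_rpow_le (r := (p : ℝ) + β) (l := l)
    (by have : (l : ℝ) ≤ p := by exact_mod_cast hlp
        linarith) d hs0
  -- The sharp bound on the regularization term lets `σ` enter with exactly the same factor as `L`.
  have h4 : |σ / genFact p β * iteratedFDeriv ℝ l N s fun _ => d| ≤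
      σ * (‖s‖ ^ (((p - l : ℕ) : ℝ) + β) / genFact (p - l) β) * ‖d‖ ^ l := by
    have hg := genFact_pos hβ p
    rw [abs_mul, abs_of_nonneg (by positivity)]
    calc _ ≤ σ / genFact p β * ((∏ i ∈ Finset.range l, ((p : ℝ) + β - i)) *
          ‖s‖ ^ ((p : ℝ) + β - l) * ‖d‖ ^ l) := by gcongr
      _ = _ := by
        have hg' := genFact_pos hβ (p - l)
        have hprod := prod_mul_genFact β hlp
        rw [hcast, show (p : ℝ) - l + β = p + β - l by ring]
        have h5 : (∏ i ∈ Finset.range l, ((p : ℝ) + β - i)) =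
          genFact p β / genFact (p - l) β := by rw [← hprod]; field_simp
        rw [h5]
        field_simp
  have h6 : L / genFact (p - l) β * ‖s‖ ^ (((p - l : ℕ) : ℝ) + β) ≤
      L * (‖s‖ ^ ((p : ℝ) - q + β) / genFact (p - q) β) := by
    rw [div_mul_eq_mul_div, mul_div_assoc]
    gcongr
  have h7 : σ * (‖s‖ ^ (((p - l : ℕ) : ℝ) + β) / genFact (p - l) β) ≤
      σ * (‖s‖ ^ ((p : ℝ) - q + β) / genFact (p - q) β) := by gcongr
  rw [hmodel]
  simp only [sub_apply, add_apply,
    smul_apply, smul_eq_mul] at h1 h2 ⊢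
  have hd : 0 ≤ ‖d‖ ^ l := by positivity
  have h8 := mul_le_mul_of_nonneg_right h6 hd
  have h9 := mul_le_mul_of_nonneg_right h7 hd
  rw [abs_le] at h1 h2 h4 ⊢
  constructor <;> nlinarith [h1.1, h1.2, h2.1, h2.2, h4.1, h4.2]

end ARpDA

namespace ARpDA
open Filter Topology

/-! ## The accuracy check -/

section Verify

variable {r : ℕ} {δ Δ ω ξ : ℝ} {ζ : ℕ → ℝ}

lemma verify_mem (r : ℕ) (δ Δ : ℝ) (ζ : ℕ → ℝ) (ω ξ : ℝ) :
    verify r δ Δ ζ ω ξ = 0 ∨ verify r δ Δ ζ ω ξ = 1 ∨ verify r δ Δ ζ ω ξ = 2 ∨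
      verify r δ Δ ζ ω ξ = 3 := by
  unfold verify
  split_ifs <;> simp

lemma of_verify_eq_one (h : verify r δ Δ ζ ω ξ = 1) :
    Δ = 0 ∧ ∀ j ∈ Finset.Icc 1 r, ζ j ≤ ξ := by
  unfold verify at h
  split_ifs at h with h1
  exacts [h1, absurd h (by decide), absurd h (by decide)]

lemma of_verify_eq_two (h : verify r δ Δ ζ ω ξ = 2) :
    0 < Δ ∧ ∑ j ∈ Finset.Icc 1 r, ζ j / (j.factorial : ℝ) * δ ^ j ≤ ω * Δ := by
  unfold verify at h
  split_ifs at h with h1 h2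
  exacts [absurd h (by decide), h2, absurd h (by decide)]

/-- The strict inequality records the failure of the relative test. Combined with the absolute one
it bounds `Δ` itself. -/
lemma of_verify_eq_three (h : verify r δ Δ ζ ω ξ = 3) :
    0 < Δ ∧ ω * Δ < ∑ j ∈ Finset.Icc 1 r, ζ j / (j.factorial : ℝ) * δ ^ j ∧
      ∑ j ∈ Finset.Icc 1 r, ζ j / (j.factorial : ℝ) * δ ^ j ≤ ξ * chi r δ := by
  unfold verify at h
  split_ifs at h with h1 h2 h3
  · exact absurd h (by decide)
  · exact absurd h (by decide)
  exact ⟨h3.1, not_le.1 fun h => h2 ⟨h3.1, h⟩, h3.2⟩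

lemma sum_le_mul_chi (hδ : 0 ≤ δ) (h : ∀ j ∈ Finset.Icc 1 r, ζ j ≤ ξ) :
    ∑ j ∈ Finset.Icc 1 r, ζ j / (j.factorial : ℝ) * δ ^ j ≤ ξ * chi r δ := by
  rw [chi, Finset.mul_sum]
  refine Finset.sum_le_sum fun j hj => ?_
  rw [div_mul_eq_mul_div, mul_div_assoc]
  exact mul_le_mul_of_nonneg_right (h j hj) (by positivity)

/-- If all accuracies were at most `ξ`, the first test would succeed for `Δ = 0` and the third for
`Δ > 0`. This is what limits the number of reductions. -/
lemma of_verify_eq_zero (hδ : 0 ≤ δ) (hΔ : 0 ≤ Δ) (h : verify r δ Δ ζ ω ξ = 0) :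
    ∃ j ∈ Finset.Icc 1 r, ξ < ζ j := by
  by_contra! hc
  unfold verify at h
  split_ifs at h with h1 h2 h3
  rcases hΔ.eq_or_lt with h0 | h0
  · exact h1 ⟨h0.symm, hc⟩
  · exact h3 ⟨h0, sum_le_mul_chi hδ hc⟩

end Verify

/-! ## Optimality measures and the minimization of the model -/

variable {n : ℕ} {F : Set (EuclideanSpace ℝ (Fin n))}

lemma zero_mem_feas {x : EuclideanSpace ℝ (Fin n)} (hx : x ∈ F) {δ : ℝ} (hδ : 0 ≤ δ) :
    (0 : EuclideanSpace ℝ (Fin n)) ∈ feas F x δ := by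
  simpa [feas] using ⟨hx, hδ⟩

lemma abs_inc_le (D : Tensors n) (q : ℕ) {δ : ℝ} {d : EuclideanSpace ℝ (Fin n)} (hd : ‖d‖ ≤ δ) :
    |inc D q d| ≤ ∑ j ∈ Finset.Icc 1 q, ‖D j‖ / (j.factorial : ℝ) * δ ^ j := by
  have h := abs_inc_sub_le (D := D) (D' := fun _ => 0) (r := q) (ζ := fun j => ‖D j‖)
    (fun j _ => by simp) hd
  have h0 : inc (fun _ => 0 : Tensors n) q d = 0 := by simp [inc_eq]
  rwa [h0, sub_zero] at h

lemma phi_le {f : EuclideanSpace ℝ (Fin n) → ℝ} {q : ℕ} {δ B : ℝ} {x : EuclideanSpace ℝ (Fin n)}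
    (hx : x ∈ F) (hδ : 0 ≤ δ) (h : ∀ d ∈ feas F x δ, inc (derivs f x) q d ≤ B) :
    phi f F q δ x ≤ B := by
  rw [phi]
  have : f x - B ≤ sInf ((fun d => taylor (f x) (derivs f x) q d) '' feas F x δ) := by
    refine le_csInf ⟨_, 0, zero_mem_feas hx hδ, rfl⟩ ?_
    rintro _ ⟨d, hd, rfl⟩
    have := h d hd
    simp only [taylor_eq]
    linarith
  linarith

lemma phiBar_le {D : Tensors n} {q : ℕ} {δ B : ℝ} {x : EuclideanSpace ℝ (Fin n)}
    (hB : 0 ≤ B) (h : ∀ d ∈ feas F x δ, inc D q d ≤ B) :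
    phiBar D F q δ x ≤ B := by
  refine max_le hB (Real.sSup_le ?_ hB)
  rintro _ ⟨d, hd, rfl⟩
  exact h d hd

lemma inc_le_phiBar (D : Tensors n) (q : ℕ) {δ : ℝ} {x d : EuclideanSpace ℝ (Fin n)}
    (hd : d ∈ feas F x δ) : inc D q d ≤ phiBar D F q δ x := by
  refine le_max_of_le_right (le_csSup ?_ ⟨d, hd, rfl⟩)
  refine ⟨∑ j ∈ Finset.Icc 1 q, ‖D j‖ / (j.factorial : ℝ) * δ ^ j, ?_⟩
  rintro _ ⟨d, hd, rfl⟩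
  exact (le_abs_self _).trans (abs_inc_le D q hd.2)

lemma exists_isMax_inc (hF : IsClosed F) {x : EuclideanSpace ℝ (Fin n)} (hx : x ∈ F) {δ : ℝ}
    (hδ : 0 ≤ δ) (D : Tensors n) (q : ℕ) :
    ∃ d ∈ feas F x δ, ∀ d' ∈ feas F x δ, inc D q d' ≤ inc D q d := by
  have hcomp : IsCompact (feas F x δ) := by
    have h1 : feas F x δ = (fun d => x + d) ⁻¹' F ∩ Metric.closedBall 0 δ := by
      ext d; simp [feas]
    rw [h1, Set.inter_comm]
    exact (isCompact_closedBall _ _).inter_right (hF.preimage (by fun_prop))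
  obtain ⟨d, hd, hmax⟩ := hcomp.exists_isMaxOn ⟨0, zero_mem_feas hx hδ⟩
    (continuous_inc D q).continuousOn
  exact ⟨d, hd, fun d' hd' => hmax hd'⟩

lemma model_eq (p : ℕ) (β : ℝ) (D : Tensors n) (σ : ℝ) (s : EuclideanSpace ℝ (Fin n)) :
    model p β D σ s = σ / genFact p β * ‖s‖ ^ ((p : ℝ) + β) - inc D p s := by
  rw [model, taylor_eq]
  ring

lemma model_zero {p : ℕ} {β : ℝ} (hβ : 0 < β) (D : Tensors n) (σ : ℝ) :
    model p β D σ 0 = 0 := by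
  have : (p : ℝ) + β ≠ 0 := by positivity
  rw [model_eq, inc_zero, norm_zero, Real.zero_rpow this]
  simp

lemma continuous_model {p : ℕ} {β : ℝ} (hβ : 0 < β) (D : Tensors n) (σ : ℝ) :
    Continuous (model p β D σ) := by
  have h : model p β D σ = fun s => σ / genFact p β * ‖s‖ ^ ((p : ℝ) + β) - inc D p s := by
    ext s; exact model_eq p β D σ s
  rw [h]
  exact (continuous_const.mul (continuous_norm.rpow_const fun _ => Or.inr (by positivity))).sub
    (continuous_inc D p)

/-- The model has a global minimizer. -/
lemma exists_model_min (hF : IsClosed F) {x : EuclideanSpace ℝ (Fin n)} (hx : x ∈ F) {p : ℕ}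
    {β σ : ℝ} (hβ : 0 < β) (hσ : 0 < σ) (D : Tensors n) :
    ∃ s, x + s ∈ F ∧ ∀ s', x + s' ∈ F → model p β D σ s ≤ model p β D σ s' := by
  have hcl : IsClosed ((fun s => x + s) ⁻¹' F) := hF.preimage (by fun_prop)
  have hg := genFact_pos hβ p
  obtain ⟨s, hs, hmin⟩ := (continuous_model (p := p) hβ D σ).continuousOn.exists_isMinOn' hcl
    (x₀ := 0) (by simpa using hx) (by
      refine Filter.Eventually.filter_mono inf_le_left ?_
      rw [model_zero hβ]
      -- Coercivity: for `‖s‖ ≥ 1` the Taylor part is at most `K ‖s‖^p`, and the regularization has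
      -- the extra factor `‖s‖^β`, which tends to infinity.
      have h1 : Tendsto (fun s : EuclideanSpace ℝ (Fin n) => σ / genFact p β * ‖s‖ ^ β)
          (cocompact _) atTop :=
        ((tendsto_rpow_atTop hβ).comp tendsto_norm_cocompact_atTop).const_mul_atTop (by positivity)
      set K := ∑ j ∈ Finset.Icc 1 p, ‖D j‖ / (j.factorial : ℝ)
      filter_upwards [h1.eventually_ge_atTop K, tendsto_norm_cocompact_atTop.eventually_ge_atTop 1]
        with s hs1 hs2
      have h2 := (abs_le.1 (abs_inc_le D p (le_refl ‖s‖))).2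
      have h3 : ∑ j ∈ Finset.Icc 1 p, ‖D j‖ / (j.factorial : ℝ) * ‖s‖ ^ j ≤ K * ‖s‖ ^ p := by
        rw [Finset.sum_mul]
        refine Finset.sum_le_sum fun j hj => ?_
        have := pow_le_pow_right₀ hs2 (Finset.mem_Icc.1 hj).2
        gcongr
      have h4 : K * ‖s‖ ^ p ≤ σ / genFact p β * ‖s‖ ^ ((p : ℝ) + β) := by
        rw [Real.rpow_add (by linarith), Real.rpow_natCast]
        calc K * ‖s‖ ^ p ≤ σ / genFact p β * ‖s‖ ^ β * ‖s‖ ^ p := by gcongr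
          _ = _ := by ring
      rw [model_eq]
      linarith)
  exact ⟨s, hs, fun s' hs' => hmin hs'⟩

/-- Isolates the linear part of a Taylor decrease, so that first-order arguments work for small
radii whatever the degree. -/
lemma abs_inc_add_first_le (D : Tensors n) {q : ℕ} (hq : 1 ≤ q) :
    ∃ K, 0 ≤ K ∧ ∀ d : EuclideanSpace ℝ (Fin n), ‖d‖ ≤ 1 →
      |inc D q d + D 1 (fun _ => d)| ≤ K * ‖d‖ ^ 2 := by
  refine ⟨∑ l ∈ Finset.Icc 2 q, ‖D l‖, Finset.sum_nonneg fun _ _ => norm_nonneg _, fun d hd => ?_⟩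
  have h1 : inc D q d + D 1 (fun _ => d) =
      -∑ l ∈ Finset.Icc 2 q, (1 / (l.factorial : ℝ)) * D l (fun _ => d) := by
    rw [inc_eq, ← Finset.add_sum_Ioc_eq_sum_Icc hq]
    simp only [Nat.factorial_one, Nat.cast_one, div_one, one_mul]
    have : Finset.Ioc 1 q = Finset.Icc 2 q := by ext; simp [Finset.mem_Ioc, Finset.mem_Icc]; omega
    rw [this]
    ring
  rw [h1, abs_neg, Finset.sum_mul]
  refine (Finset.abs_sum_le_sum_abs _ _).trans (Finset.sum_le_sum fun l hl => ?_)
  have hl2 := (Finset.mem_Icc.1 hl).1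
  have h2 := (D l).le_opNorm fun _ => d
  rw [Finset.prod_const, Finset.card_univ, Fintype.card_fin, Real.norm_eq_abs] at h2
  rw [abs_mul, abs_of_nonneg (by positivity)]
  have h3 : (1 : ℝ) / (l.factorial : ℝ) ≤ 1 := by
    rw [div_le_one (by positivity)]
    exact_mod_cast Nat.one_le_iff_ne_zero.2 (Nat.factorial_ne_zero l)
  have h4 : ‖d‖ ^ l ≤ ‖d‖ ^ 2 := pow_le_pow_of_le_one (norm_nonneg _) hd hl2
  calc _ ≤ 1 * |D l fun _ => d| := by gcongr
    _ ≤ ‖D l‖ * ‖d‖ ^ l := by rw [one_mul]; exact h2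
    _ ≤ _ := by gcongr

lemma expo_pos {P : Params} (hP : P.Admissible) : 0 < P.expo := by
  have h1 : (P.q : ℝ) ≤ P.p := by exact_mod_cast hP.q_le_p
  have := hP.β_mem.1
  rw [Params.expo]
  linarith

/-- At a nonzero global minimizer of the model, the stopping test holds for some radius. -/
lemma exists_modelTest {P : Params} (hP : P.Admissible) (ε : ℝ) (D : Tensors n)
    {x s : EuclideanSpace ℝ (Fin n)} (σ : ℝ) (hs : s ≠ 0)
    (hmin : ∀ s', x + s' ∈ F → model P.p P.β D σ s ≤ model P.p P.β D σ s') :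
    ∃ δ, ModelTest P ε F D x σ s δ := by
  set m := model P.p P.β D σ with hm
  set c := P.θ * ‖s‖ ^ P.expo / genFact (P.p - P.q) P.β with hc
  have hcpos : 0 < c := by
    have := genFact_pos hP.β_mem.1 (P.p - P.q)
    have := hP.θ_pos
    have := norm_pos_iff.2 hs
    positivity
  have hdiff : DifferentiableAt ℝ m s :=
    (contDiffAt_model (m := 1) P.p P.β D σ hs).differentiableAt (by norm_num)
  obtain ⟨K, hK0, hK⟩ := abs_inc_add_first_le (derivs m s) hP.one_le_q
  have ho := (hasFDerivAt_iff_isLittleO_nhds_zero.1 hdiff.hasFDerivAt).def (half_pos hcpos)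
  obtain ⟨r, hr, hball⟩ := Metric.eventually_nhds_iff.1 ho
  -- The tolerance `c` is split in two halves, for the error of linearization (radius `r`) and for
  -- the terms of order at least two (`K δ`).
  obtain ⟨δ, hδ0, hδ⟩ : ∃ δ > 0, δ < r ∧ δ ≤ 1 ∧ K * δ ≤ c / 2 := by
    refine ⟨min (r / 2) (min 1 (c / 2 / (K + 1))), by positivity, ?_, ?_, ?_⟩
    · exact (min_le_left _ _).trans_lt (by linarith)
    · exact (min_le_right _ _).trans (min_le_left _ _)
    · have h1 : min (r / 2) (min 1 (c / 2 / (K + 1))) ≤ c / 2 / (K + 1) :=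
        (min_le_right _ _).trans (min_le_right _ _)
      calc _ ≤ (K + 1) * (c / 2 / (K + 1)) := by gcongr; linarith
        _ = c / 2 := by field_simp
  refine ⟨δ, ⟨hδ0, hδ.2.1⟩, Or.inr (phiBar_le (mul_nonneg hcpos.le (chi_nonneg _ hδ0.le)) ?_)⟩
  rintro d ⟨hdF, hdδ⟩
  have h1 := hball (y := d) (by simpa using hdδ.trans_lt hδ.1)
  have h2 := hK d (hdδ.trans hδ.2.1)
  have h3 : derivs m s 1 (fun _ => d) = fderiv ℝ m s d := by
    rw [derivs, iteratedFDeriv_one_apply]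
  rw [h3] at h2
  rw [Real.norm_eq_abs] at h1
  -- Minimality and differentiability give `-m'(s) d ≤ (c/2) ‖d‖` for feasible `d`.
  have h4 := hmin (s + d) (by rwa [← add_assoc])
  have h5 : K * ‖d‖ ^ 2 ≤ c / 2 * ‖d‖ := by
    calc K * ‖d‖ ^ 2 = K * ‖d‖ * ‖d‖ := by ring
      _ ≤ K * δ * ‖d‖ := by gcongr
      _ ≤ _ := by gcongr; exact hδ.2.2
  have h6 : c * ‖d‖ ≤ c * chi P.q δ := by
    gcongr
    exact hdδ.trans (le_chi hP.one_le_q hδ0.le)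
  have := (abs_le.1 h1).2
  have := (abs_le.1 h2).2
  linarith

/-- If the model has no descent step, the iterate is an approximate first-order point. -/
lemma exists_phi_le_of_model_nonneg {P : Params} (hP : P.Admissible) {ε ξ : ℝ} (hξ : ξ < ε)
    {f : EuclideanSpace ℝ (Fin n) → ℝ} {D : Tensors n} {x : EuclideanSpace ℝ (Fin n)}
    (hx : x ∈ F) {σ : ℝ} (hD : ‖D 1 - iteratedFDeriv ℝ 1 f x‖ ≤ ξ)
    (hmin : ∀ s, x + s ∈ F → 0 ≤ model P.p P.β D σ s) :
    ∃ δ ∈ Set.Ioc (0 : ℝ) 1, phi f F P.q δ x ≤ ε * chi P.q δ := by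
  have hp : 1 ≤ P.p := hP.one_le_q.trans hP.q_le_p
  obtain ⟨K, hK0, hK⟩ := abs_inc_add_first_le D hp
  obtain ⟨K', hK0', hK'⟩ := abs_inc_add_first_le (derivs f x) hP.one_le_q
  set c := |σ / genFact P.p P.β| with hc
  set a := (P.p : ℝ) + P.β - 1 with ha
  have ha0 : 0 < a := by
    have : (1 : ℝ) ≤ P.p := by exact_mod_cast hp
    have := hP.β_mem.1
    rw [ha]; linarith
  -- Apart from the derivative error `ξ ‖d‖`, all terms are `o(δ)`: the higher Taylor terms, and the
  -- regularization because `p + β > 1`. The gap `ε - ξ` absorbs them for small `δ`.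
  have hcont : Tendsto (fun δ : ℝ => (K + K') * δ + c * δ ^ a) (𝓝[>] 0) (𝓝 0) := by
    have h1 : Continuous fun δ : ℝ => (K + K') * δ + c * δ ^ a :=
      (continuous_const.mul continuous_id).add
        (continuous_const.mul (continuous_id.rpow_const fun _ => Or.inr ha0.le))
    have h2 := h1.tendsto 0
    simp only [mul_zero, Real.zero_rpow ha0.ne', add_zero] at h2
    exact h2.mono_left nhdsWithin_le_nhds
  obtain ⟨δ, hδ, hδ'⟩ := ((hcont.eventually (gt_mem_nhds (sub_pos.2 hξ))).and
    (Ioc_mem_nhdsGT (zero_lt_one' ℝ))).exists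
  refine ⟨δ, hδ', phi_le hx hδ'.1.le ?_⟩
  rintro d ⟨hdF, hdδ⟩
  have hd1 := hdδ.trans hδ'.2
  have h1 := (abs_le.1 (hK d hd1)).1
  have h2 := (abs_le.1 (hK' d hd1)).2
  have h3 : |(D 1 - iteratedFDeriv ℝ 1 f x) fun _ => d| ≤ ξ * ‖d‖ := by
    have h := (D 1 - iteratedFDeriv ℝ 1 f x).le_of_opNorm_le hD fun _ => d
    simpa using h
  rw [sub_apply] at h3
  have h4 := hmin d hdF
  rw [model_eq] at h4
  have h5 : σ / genFact P.p P.β * ‖d‖ ^ ((P.p : ℝ) + P.β) ≤ c * δ ^ a * δ := by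
    have h6 : δ ^ a * δ = δ ^ ((P.p : ℝ) + P.β) := by
      rw [← Real.rpow_add_one hδ'.1.ne', ha, sub_add_cancel]
    have h7 : (0 : ℝ) ≤ (P.p : ℝ) + P.β := by linarith
    rw [mul_assoc, h6]
    refine mul_le_mul (le_abs_self _) (Real.rpow_le_rpow (norm_nonneg _) hdδ h7) (by positivity)
      (abs_nonneg _)
  have h8 : (K + K') * ‖d‖ ^ 2 ≤ (K + K') * δ * δ := by
    have : ‖d‖ ^ 2 ≤ δ * δ := by nlinarith [norm_nonneg d]
    calc _ ≤ (K + K') * (δ * δ) := by gcongr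
      _ = _ := by ring
  have hξ0 : 0 ≤ ξ := (norm_nonneg _).trans hD
  have h9 : ξ * ‖d‖ ≤ ξ * δ := by gcongr
  have h10 : ε * δ ≤ ε * chi P.q δ :=
    mul_le_mul_of_nonneg_left (le_chi hP.one_le_q hδ'.1.le) (by linarith)
  have h11 : ((K + K') * δ + c * δ ^ a) * δ ≤ (ε - ξ) * δ :=
    mul_le_mul_of_nonneg_right hδ.le hδ'.1.le
  have h12 : derivs f x 1 (fun _ => d) = iteratedFDeriv ℝ 1 f x fun _ => d := rfl
  rw [h12] at h2
  have := (abs_le.1 h3).2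
  nlinarith

end ARpDA

namespace ARpDA
open Filter Topology

/-! ## Consequences of the tests of the algorithm -/

/-- The assumptions on the problem and on the constants. -/
structure Setup {n : ℕ} (P : Params) (F : Set (EuclideanSpace ℝ (Fin n)))
    (f : EuclideanSpace ℝ (Fin n) → ℝ) (f_low L : ℝ) (x₀ : EuclideanSpace ℝ (Fin n)) : Prop where
  adm : P.Admissible
  closed : IsClosed F
  smooth : ContDiff ℝ P.p f
  low_le : ∀ x, f_low ≤ f x
  L_nonneg : 0 ≤ L
  holder : ∀ x y, ‖iteratedFDeriv ℝ P.p f x - iteratedFDeriv ℝ P.p f y‖ ≤ L * ‖x - y‖ ^ P.β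
  mem : x₀ ∈ F

namespace Params.Admissible

variable {P : Params} (hP : P.Admissible)
include hP

lemma κω_pos : 0 < P.κω := hP.κω_mem.1

lemma two_κω_le : 2 * P.κω ≤ P.α * P.η₁ := by linarith [hP.κω_mem.2]

lemma η₁_lt_one : P.η₁ < 1 := hP.η₁_le_η₂.trans_lt hP.η₂_lt_one

lemma κω_lt : P.κω < 1 / 2 := by
  have := hP.two_κω_le
  have := mul_lt_mul'' hP.α_mem.2 hP.η₁_lt_one hP.α_mem.1.le hP.η₁_pos.le
  linarith

lemma one_le_p : 1 ≤ P.p := hP.one_le_q.trans hP.q_le_p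

lemma σ₀_pos : 0 < P.σ₀ := hP.σ_min_pos.trans_le hP.σ_min_le

end Params.Admissible

variable {n : ℕ} {P : Params} {F : Set (EuclideanSpace ℝ (Fin n))}
  {f : EuclideanSpace ℝ (Fin n) → ℝ} {f_low L ε ω σ : ℝ} {x₀ x : EuclideanSpace ℝ (Fin n)}
  {D : Tensors n} {acc : ℕ → ℝ}

/-- The property of the final iterate; `s` is the last step, if there is one. -/
def Conclusion (P : Params) (ε : ℝ) (F : Set (EuclideanSpace ℝ (Fin n)))
    (f : EuclideanSpace ℝ (Fin n) → ℝ) (x : EuclideanSpace ℝ (Fin n))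
    (s : Option (EuclideanSpace ℝ (Fin n))) : Prop :=
  (∃ δ ∈ Set.Ioc (0 : ℝ) 1, phi f F P.q δ x ≤ ε * chi P.q δ) ∨
    ∃ v, s = some v ∧ v ≠ 0 ∧ phi f F P.p ‖v‖ x ≤ ε * chi P.p ‖v‖

lemma inc_derivs_le {r : ℕ} (hD : ∀ j ∈ Finset.Icc 1 r, ‖D j - iteratedFDeriv ℝ j f x‖ ≤ acc j)
    {d : EuclideanSpace ℝ (Fin n)} {δ : ℝ} (hd : ‖d‖ ≤ δ) :
    inc (derivs f x) r d ≤
      inc D r d + ∑ j ∈ Finset.Icc 1 r, acc j / (j.factorial : ℝ) * δ ^ j := by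
  have := (abs_le.1 (abs_inc_sub_le (D' := derivs f x) hD hd)).1
  linarith

lemma phi_le_of_max {r : ℕ}
    (hD : ∀ j ∈ Finset.Icc 1 r, ‖D j - iteratedFDeriv ℝ j f x‖ ≤ acc j) (hx : x ∈ F) {δ Δ : ℝ}
    (hδ : 0 ≤ δ) (hmax : ∀ d ∈ feas F x δ, inc D r d ≤ Δ) :
    phi f F r δ x ≤ Δ + ∑ j ∈ Finset.Icc 1 r, acc j / (j.factorial : ℝ) * δ ^ j := by
  refine phi_le hx hδ fun d hd => ?_
  have := inc_derivs_le hD hd.2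
  have := hmax d hd
  linarith

/-- The bound guaranteed by the third outcome of the accuracy check. -/
lemma phi_le_of_verify_eq_three {r : ℕ}
    (hD : ∀ j ∈ Finset.Icc 1 r, ‖D j - iteratedFDeriv ℝ j f x‖ ≤ acc j) (hx : x ∈ F) {δ Δ : ℝ}
    (hδ : 0 ≤ δ) (hmax : ∀ d ∈ feas F x δ, inc D r d ≤ Δ) (hω : 0 < ω) (hω1 : ω ≤ 1) (hε : 0 ≤ ε)
    (hflag : verify r δ Δ acc ω (1 / 2 * ω * ε) = 3) :
    phi f F r δ x ≤ ε * chi r δ := by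
  obtain ⟨_, h2, h3⟩ := of_verify_eq_three hflag
  refine (phi_le_of_max hD hx hδ hmax).trans ?_
  have hchi := chi_nonneg r hδ
  -- The factor `ω` in the absolute tolerance cancels the one in the failed relative test.
  have h4 : Δ ≤ 1 / 2 * ε * chi r δ := by
    refine le_of_mul_le_mul_left ?_ hω
    calc ω * Δ ≤ 1 / 2 * ω * ε * chi r δ := (h2.trans_le h3).le
      _ = _ := by ring
  have h5 : 1 / 2 * ω * ε * chi r δ ≤ 1 / 2 * 1 * ε * chi r δ := by gcongr
  linarith

/-! ### Outcomes of the optimality test. -/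

section Step1

variable {st : State n} {d : EuclideanSpace ℝ (Fin n)}

lemma conclusion_of_step1 (hε : 0 < ε) (hx : st.x ∈ F) (hδ : st.δ ∈ Set.Ioc (0 : ℝ) 1)
    (hω : 0 < st.ω) (hω1 : st.ω ≤ 1)
    (hD : ∀ j ∈ Finset.Icc 1 P.q, ‖D j - iteratedFDeriv ℝ j f st.x‖ ≤ st.acc j)
    (hd : d ∈ feas F st.x st.δ) (hmax : ∀ d' ∈ feas F st.x st.δ, inc D P.q d' ≤ inc D P.q d)
    (hflag : optFlag P ε st D d = 1 ∨ optFlag P ε st D d = 3 ∨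
      (optFlag P ε st D d = 2 ∧ OptTest P ε F st D)) :
    Conclusion P ε F f st.x none := by
  refine Or.inl ⟨st.δ, hδ, ?_⟩
  have hchi := chi_nonneg P.q hδ.1.le
  rcases hflag with h | h | ⟨h, ht⟩
  · obtain ⟨h1, h2⟩ := of_verify_eq_one h
    refine (phi_le_of_max hD hx hδ.1.le hmax).trans ?_
    have h3 := sum_le_mul_chi hδ.1.le h2
    have h5 : 1 / 2 * st.ω * ε * chi P.q st.δ ≤ 1 / 2 * 1 * ε * chi P.q st.δ := by gcongr
    have : 0 ≤ ε * chi P.q st.δ := by positivity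
    linarith
  · exact phi_le_of_verify_eq_three hD hx hδ.1.le hmax hω hω1 hε.le h
  · obtain ⟨_, h2⟩ := of_verify_eq_two h
    refine (phi_le_of_max hD hx hδ.1.le hmax).trans ?_
    -- The divisor `1 + ω` in the test compensates for the relative error `ω` of the computed
    -- maximum.
    have h3 : inc D P.q d ≤ ε / (1 + st.ω) * chi P.q st.δ := (inc_le_phiBar D P.q hd).trans ht
    calc _ ≤ (1 + st.ω) * inc D P.q d := by linarith
      _ ≤ (1 + st.ω) * (ε / (1 + st.ω) * chi P.q st.δ) := by gcongr
      _ = _ := by field_simp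

/-- The exact measure of optimality is large when the algorithm passes the test of Step 1. -/
def NotOptimal (P : Params) (ε : ℝ) (F : Set (EuclideanSpace ℝ (Fin n)))
    (f : EuclideanSpace ℝ (Fin n) → ℝ) (x : EuclideanSpace ℝ (Fin n)) (δ : ℝ) : Prop :=
  ∃ d ∈ feas F x δ, (1 - P.κω) / (1 + P.κω) * ε * chi P.q δ < inc (derivs f x) P.q d

/-- The exact decrease along `d` is at least `1 - ω` times the computed one, which exceeds `ε
χ/(1+ω)`. As `(1-t)/(1+t)` decreases in `t`, replacing `ω` by `κω` gives a bound with the same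
constant in all iterations. -/
lemma notOptimal_of_step1 (hP : P.Admissible) (hε : 0 < ε) (hδ : st.δ ∈ Set.Ioc (0 : ℝ) 1)
    (hω : 0 < st.ω) (hω1 : st.ω ≤ P.κω)
    (hD : ∀ j ∈ Finset.Icc 1 P.q, ‖D j - iteratedFDeriv ℝ j f st.x‖ ≤ st.acc j)
    (hd : d ∈ feas F st.x st.δ) (hmax : ∀ d' ∈ feas F st.x st.δ, inc D P.q d' ≤ inc D P.q d)
    (hflag : optFlag P ε st D d = 2 ∧ ¬ OptTest P ε F st D) :
    NotOptimal P ε F f st.x st.δ := by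
  obtain ⟨hflag, ht⟩ := hflag
  obtain ⟨h1, h2⟩ := of_verify_eq_two hflag
  have hchi := chi_pos hP.one_le_q hδ.1
  have hκ := hP.κω_lt
  have h3 : ε / (1 + st.ω) * chi P.q st.δ < inc D P.q d :=
    (not_le.1 ht).trans_le (phiBar_le h1.le hmax)
  refine ⟨d, hd, ?_⟩
  have h4 := (abs_le.1 (abs_inc_sub_le (D' := derivs f st.x) hD hd.2)).2
  have h5 : (1 - P.κω) / (1 + P.κω) ≤ (1 - st.ω) / (1 + st.ω) :=
    div_le_div₀ (by linarith) (by linarith) (by linarith) (by linarith)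
  calc (1 - P.κω) / (1 + P.κω) * ε * chi P.q st.δ
      ≤ (1 - st.ω) / (1 + st.ω) * ε * chi P.q st.δ := by gcongr
    _ = (1 - st.ω) * (ε / (1 + st.ω) * chi P.q st.δ) := by ring
    _ < (1 - st.ω) * inc D P.q d := by
      refine mul_lt_mul_of_pos_left h3 (by linarith)
    _ ≤ _ := by linarith

lemma exists_lt_acc_of_step1 (hx : st.x ∈ F) (hδ : st.δ ∈ Set.Ioc (0 : ℝ) 1)
    (hmax : ∀ d' ∈ feas F st.x st.δ, inc D P.q d' ≤ inc D P.q d)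
    (hflag : optFlag P ε st D d = 0) : ∃ j ∈ Finset.Icc 1 P.q, 1 / 2 * st.ω * ε < st.acc j := by
  refine of_verify_eq_zero hδ.1.le ?_ hflag
  rw [← inc_zero D P.q]
  exact hmax 0 (zero_mem_feas hx hδ.1.le)

end Step1

/-! ### Outcomes of the step computation. -/

section Step2

lemma le_inc_of_model_le {p : ℕ} {β : ℝ} (hβ : 0 < β) {s : EuclideanSpace ℝ (Fin n)}
    (h : model p β D σ s ≤ model p β D σ 0) :
    σ / genFact p β * ‖s‖ ^ ((p : ℝ) + β) ≤ inc D p s := by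
  rw [model_zero hβ, model_eq] at h
  linarith

variable {flag : ℕ} {s : EuclideanSpace ℝ (Fin n)} {δ Δm : ℝ}

lemma StepCalc.flag_eq (h : StepCalc P ε F D acc x σ ω flag s δ Δm) :
    flag = stepFlag P ε D acc ω s := by
  cases h <;> rfl

lemma StepCalc.mem (h : StepCalc P ε F D acc x σ ω flag s δ Δm) : x + s ∈ F := by
  cases h with
  | approximate _ d _ hs => exact hs.2.1
  | global _ _ hreach hs => exact hs

lemma StepCalc.le_inc (hP : P.Admissible) (hx : x ∈ F)
    (h : StepCalc P ε F D acc x σ ω flag s δ Δm) :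
    σ / genFact P.p P.β * ‖s‖ ^ ((P.p : ℝ) + P.β) ≤ inc D P.p s := by
  cases h with
  | approximate _ d _ hs => exact le_inc_of_model_le hP.β_mem.1 hs.2.2.le
  | global _ _ hreach hs hmin =>
    exact le_inc_of_model_le hP.β_mem.1 (hmin 0 (by simpa using hx))

lemma StepCalc.inc_nonneg (hP : P.Admissible) (hx : x ∈ F) (hσ : 0 < σ)
    (h : StepCalc P ε F D acc x σ ω flag s δ Δm) : 0 ≤ inc D P.p s := by
  have := genFact_pos hP.β_mem.1 P.p
  exact le_trans (by positivity) (h.le_inc hP hx)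

lemma StepCalc.modelTest (h : StepCalc P ε F D acc x σ ω flag s δ Δm) (hflag : flag = 2) :
    ModelTest P ε F D x σ s δ := by
  cases h with
  | approximate _ d _ hs ht => exact ht
  | global _ _ hreach hs hmin ht => exact ht hflag

lemma ne_zero_of_inc_pos {p : ℕ} (h : 0 < inc D p s) : s ≠ 0 := by
  rintro rfl
  rw [inc_zero] at h
  exact h.false

/-- Flags `1` and `3` survive only for a global minimizer of the model. Flag `1` forces `s = 0`, so
the model has no descent at all; flag `3` bounds the order `p` measure with radius `‖s‖`. -/
lemma StepCalc.conclusion (hP : P.Admissible) (hε : 0 < ε) (hx : x ∈ F) (hσ : 0 < σ) (hω : 0 < ω)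
    (hω1 : ω ≤ 1) (hD : ∀ j ∈ Finset.Icc 1 P.p, ‖D j - iteratedFDeriv ℝ j f x‖ ≤ acc j)
    (h : StepCalc P ε F D acc x σ ω flag s δ Δm) (hflag : flag = 1 ∨ flag = 3) :
    Conclusion P ε F f x (some s) := by
  have hle := h.le_inc hP hx
  have hg := genFact_pos hP.β_mem.1 P.p
  cases h with
  | approximate _ d _ hs ht hd hf =>
    rcases hf with h | h <;> rw [h] at hflag <;> omega
  | global _ _ hreach hs hmin ht =>
    rcases hflag with h | h
    · obtain ⟨h1, h2⟩ := of_verify_eq_one h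
      have hs0 : s = 0 := by
        by_contra hne
        have : 0 < ‖s‖ := norm_pos_iff.2 hne
        have : 0 < σ / genFact P.p P.β * ‖s‖ ^ ((P.p : ℝ) + P.β) := by positivity
        linarith
      subst hs0
      have hmem : 1 ∈ Finset.Icc 1 P.p := Finset.mem_Icc.2 ⟨le_rfl, hP.one_le_p⟩
      refine Or.inl (exists_phi_le_of_model_nonneg hP (σ := σ) (ξ := 1 / 2 * ω * ε) ?_ hx
        ((hD 1 hmem).trans (h2 1 hmem)) fun s' hs' => ?_)
      · nlinarith
      · rw [← model_zero hP.β_mem.1 D σ]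
        exact hmin s' hs'
    · refine Or.inr ⟨s, rfl, ne_zero_of_inc_pos (of_verify_eq_three h).1,
        phi_le_of_verify_eq_three hD hx (norm_nonneg _) (fun d hd => ?_) hω hω1 hε.le h⟩
      -- In the ball of radius `‖s‖` the regularization is at most its value at `s`, so the
      -- minimizer of the model also maximizes the Taylor decrease there.
      have h1 := hmin d hd.1
      have h2 : σ / genFact P.p P.β * ‖d‖ ^ ((P.p : ℝ) + P.β) ≤
          σ / genFact P.p P.β * ‖s‖ ^ ((P.p : ℝ) + P.β) := by
        have := hP.β_mem.1
        exact mul_le_mul_of_nonneg_left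
          (Real.rpow_le_rpow (norm_nonneg _) hd.2 (by positivity)) (by positivity)
      rw [model_eq, model_eq] at h1
      linarith

lemma StepCalc.exists_lt_acc_of_flag (hP : P.Admissible) (hx : x ∈ F) (hσ : 0 < σ)
    (h : StepCalc P ε F D acc x σ ω flag s δ Δm) (hflag : flag = 0) :
    ∃ j ∈ Finset.Icc 1 P.p, 1 / 2 * ω * ε < acc j := by
  have h1 := h.flag_eq
  rw [hflag] at h1
  exact of_verify_eq_zero (norm_nonneg _) (h.inc_nonneg hP hx hσ) h1.symm

lemma StepCalc.Δm_nonneg (h : StepCalc P ε F D acc x σ ω flag s δ Δm)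
    (hflag : flag = 2) (hs : ‖s‖ < P.longStep ε) : 0 ≤ Δm := by
  have hδ := (h.modelTest hflag).1
  have hmem := h.mem
  cases h with
  | approximate _ d _ _ _ hd =>
    rw [← inc_zero (derivs (model P.p P.β D σ) s) P.q]
    exact (hd hs).2 0 (zero_mem_feas hmem hδ.1.le)
  | global => exact le_rfl

/-- The failing entry is three times a maximum over orders `ℓ ≥ j`, so some threshold of such an
order exceeds a third of the tolerance. -/
lemma StepCalc.exists_lt_acc_of_modelFlag (hP : P.Admissible)
    (h : StepCalc P ε F D acc x σ ω flag s δ Δm)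
    (hflag : flag = 2) (hs : ‖s‖ < P.longStep ε) (hmf : modelFlag P ε acc ω δ Δm = 0) :
    ∃ j ∈ Finset.Icc 1 P.p, P.modelTol ω ε / 3 < acc j := by
  obtain ⟨j, hj, hlt⟩ := of_verify_eq_zero (h.modelTest hflag).1.1.le (h.Δm_nonneg hflag hs) hmf
  obtain ⟨hj1, hjq⟩ := Finset.mem_Icc.1 hj
  rw [Params.modelAcc] at hlt
  obtain ⟨_, ⟨l, hl, rfl⟩, hl'⟩ := exists_lt_of_lt_csSup
    (⟨acc j, j, ⟨le_rfl, hjq.trans hP.q_le_p⟩, rfl⟩ : (acc '' Set.Icc j P.p).Nonempty)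
    (show P.modelTol ω ε / 3 < sSup (acc '' Set.Icc j P.p) by linarith)
  exact ⟨l, Finset.mem_Icc.2 ⟨hj1.trans hl.1, hl.2⟩, hl'⟩

/-- The bound on the measure of optimality at the end of a short step `s`. -/
noncomputable def Params.nextBound (P : Params) (L ε t : ℝ) : ℝ :=
  (L + P.sigmaMax L + P.θ * (1 + P.κω)) * (t ^ P.expo / genFact (P.p - P.q) P.β) +
    P.vth * ((1 - P.κω) / (1 + P.κω) * ε)

lemma longStep_le_one (hP : P.Admissible) (hε : ε ∈ Set.Ioo (0 : ℝ) 1) : P.longStep ε ≤ 1 := by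
  have h1 := expo_pos hP
  have h2 : ε ^ (1 / P.expo) ≤ 1 := Real.rpow_le_one hε.1.le hε.2.le (by positivity)
  have h3 : (0 : ℝ) ≤ ε ^ (1 / P.expo) := Real.rpow_nonneg hε.1.le _
  rw [Params.longStep]
  exact mul_le_one₀ hP.μ_mem.2 h3 h2

/-- The measure of the model at `s` is small by the stopping test. Passing to `f` costs `(L + σ) t
χ` plus the accuracy sum, which the second VERIFY bounds either relative to `Δm` or absolutely. -/
lemma StepCalc.next_le (S : Setup P F f f_low L x₀) (hε : ε ∈ Set.Ioo (0 : ℝ) 1) (hσ : 0 < σ)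
    (hσ' : σ ≤ P.sigmaMax L) (hω : 0 < ω) (hω1 : ω ≤ P.κω)
    (hD : ∀ j ∈ Finset.Icc 1 P.p, ‖D j - iteratedFDeriv ℝ j f x‖ ≤ acc j)
    (h : StepCalc P ε F D acc x σ ω flag s δ Δm) (hflag : flag = 2) (hs : ‖s‖ < P.longStep ε)
    (hmf : 0 < modelFlag P ε acc ω δ Δm) {d : EuclideanSpace ℝ (Fin n)}
    (hd : d ∈ feas F (x + s) δ) :
    inc (derivs f (x + s)) P.q d ≤ P.nextBound L ε ‖s‖ * chi P.q δ := by
  have hP := S.adm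
  have hflag' := hflag
  rw [h.flag_eq] at hflag'
  have hs0 : s ≠ 0 := ne_zero_of_inc_pos (of_verify_eq_two hflag').1
  have hs1 : ‖s‖ ≤ 1 := hs.le.trans (longStep_le_one hP hε)
  obtain ⟨hδ, ht⟩ := h.modelTest hflag
  have ht := ht.resolve_left (not_le.2 hs)
  have hchi := chi_nonneg P.q hδ.1.le
  have hκ := hP.κω_lt
  have hκ0 := hP.κω_pos
  have hg := genFact_pos hP.β_mem.1 (P.p - P.q)
  have hθ := hP.θ_pos
  set t := ‖s‖ ^ P.expo / genFact (P.p - P.q) P.β with htdef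
  have ht0 : 0 ≤ t := by positivity
  have ht' : phiBar (derivs (model P.p P.β D σ) s) F P.q δ (x + s) ≤ P.θ * t * chi P.q δ := by
    rw [htdef, ← mul_div_assoc]; exact ht
  have hm : inc (derivs (model P.p P.β D σ) s) P.q d ≤ P.θ * t * chi P.q δ :=
    (inc_le_phiBar _ _ hd).trans ht'
  have hclose : inc (derivs f (x + s)) P.q d ≤ inc (derivs (model P.p P.β D σ) s) P.q d +
      ((L + σ) * t * chi P.q δ +
        ∑ j ∈ Finset.Icc 1 P.q, P.modelAcc acc j / (j.factorial : ℝ) * δ ^ j) := by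
    rw [inc_eq, inc_eq, chi, Finset.mul_sum, ← Finset.sum_add_distrib, neg_add_eq_sub,
      ← neg_le_neg_iff, neg_neg, neg_sub, sub_le_iff_le_add, ← sub_le_iff_le_add',
      ← Finset.sum_sub_distrib]
    refine Finset.sum_le_sum fun l hl => ?_
    have h1 := (abs_le.1 (abs_iteratedFDeriv_sub_model_le (σ := σ) hP.β_mem.1 S.smooth S.L_nonneg
      S.holder hP.q_le_p hσ.le hD hs0 hs1 hl d)).1
    have h2 : 0 ≤ (L + σ) * (‖s‖ ^ ((P.p : ℝ) - P.q + P.β) / genFact (P.p - P.q) P.β) +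
        3 * sSup (acc '' Set.Icc l P.p) := by
      have hL := S.L_nonneg
      have h3 : 0 ≤ sSup (acc '' Set.Icc l P.p) := Real.sSup_nonneg (by
        rintro _ ⟨j, hj, rfl⟩
        exact (norm_nonneg _).trans
          (hD j (Finset.mem_Icc.2 ⟨(Finset.mem_Icc.1 hl).1.trans hj.1, hj.2⟩)))
      have := hσ.le
      positivity
    have h4 : ‖d‖ ^ l ≤ δ ^ l := pow_le_pow_left₀ (norm_nonneg _) hd.2 l
    have h5 := mul_le_mul_of_nonneg_left h4 h2
    have h6 : derivs (model P.p P.β D σ) s l (fun _ => d) - derivs f (x + s) l (fun _ => d) ≤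
        ((L + σ) * t + P.modelAcc acc l) * δ ^ l := by
      refine le_trans ?_ h5
      simp only [derivs]
      linarith
    have h7 : (0 : ℝ) ≤ 1 / (l.factorial : ℝ) := by positivity
    have h8 := mul_le_mul_of_nonneg_left h6 h7
    calc _ = 1 / (l.factorial : ℝ) * (derivs (model P.p P.β D σ) s l (fun _ => d) -
          derivs f (x + s) l (fun _ => d)) := by ring
      _ ≤ _ := h8
      _ = _ := by ring
  have hL := S.L_nonneg
  have hv0 : 0 ≤ P.vth * ((1 - P.κω) / (1 + P.κω) * ε) := by
    have := hP.vth_mem.1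
    have := hε.1
    have : 0 ≤ 1 - P.κω := by linarith
    positivity
  have hbase : (L + σ) * t ≤ (L + P.sigmaMax L) * t := by gcongr
  -- The absolute tolerance uses at most the fraction `vth` of the threshold in `NotOptimal`; the
  -- rest must come from the step.
  have htol : P.modelTol ω ε ≤ P.vth * ((1 - P.κω) / (1 + P.κω) * ε) := by
    rw [Params.modelTol]
    have h1 : P.vth * (1 - P.κω) / (1 + P.κω) ^ 2 * (ω * ε / 2) =
        P.vth * ((1 - P.κω) / (1 + P.κω) * ε) * (ω / 2 / (1 + P.κω)) := by
      field_simp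
    rw [h1]
    refine mul_le_of_le_one_right hv0 ?_
    rw [div_le_one (by linarith)]
    linarith
  have hfin : ∀ B, inc (derivs (model P.p P.β D σ) s) P.q d +
        ∑ j ∈ Finset.Icc 1 P.q, P.modelAcc acc j / (j.factorial : ℝ) * δ ^ j ≤ B * chi P.q δ →
      B ≤ P.θ * (1 + P.κω) * t + P.vth * ((1 - P.κω) / (1 + P.κω) * ε) →
      inc (derivs f (x + s)) P.q d ≤ P.nextBound L ε ‖s‖ * chi P.q δ := by
    intro B hB hB'
    calc _ ≤ (L + σ) * t * chi P.q δ + B * chi P.q δ := by linarith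
      _ = ((L + σ) * t + B) * chi P.q δ := by ring
      _ ≤ _ := by
        refine mul_le_mul_of_nonneg_right ?_ hchi
        rw [Params.nextBound]
        linarith
  have hθt : P.θ * t ≤ P.θ * (1 + P.κω) * t := by
    have : 0 ≤ P.θ * t := by positivity
    nlinarith
  rw [modelFlag] at hmf
  rcases verify_mem P.q δ Δm (P.modelAcc acc) ω (P.modelTol ω ε) with hv | hv | hv | hv
  · omega
  · refine hfin (P.θ * t + P.modelTol ω ε) ?_ (by linarith)
    have := sum_le_mul_chi hδ.1.le (of_verify_eq_one hv).2
    linarith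
  · obtain ⟨hΔ, hsum⟩ := of_verify_eq_two hv
    refine hfin (P.θ * (1 + P.κω) * t) ?_ (by linarith)
    -- Flag `2` requires `Δm > 0`, which excludes a global minimizer, for which `Δm = 0`.
    have hΔm : Δm ≤ P.θ * t * chi P.q δ := by
      cases h with
      | approximate _ d' _ _ _ hd' => exact (inc_le_phiBar _ _ (hd' hs).1).trans ht'
      | global => exact absurd hΔ (lt_irrefl _)
    have h1 : ω * Δm ≤ P.κω * (P.θ * t * chi P.q δ) := by gcongr
    calc _ ≤ P.θ * t * chi P.q δ + P.κω * (P.θ * t * chi P.q δ) := by linarith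
      _ = _ := by ring
  · refine hfin (P.θ * t + P.modelTol ω ε) ?_ (by linarith)
    have := (of_verify_eq_three hv).2.2
    linarith

end Step2

end ARpDA

namespace ARpDA
open Filter Topology

/-! ## Accepted steps -/

variable {n : ℕ} {P : Params} {F : Set (EuclideanSpace ℝ (Fin n))}
  {f : EuclideanSpace ℝ (Fin n) → ℝ} {f_low L ε ω σ δ : ℝ} {x₀ x s : EuclideanSpace ℝ (Fin n)}
  {D : Tensors n} {acc : ℕ → ℝ}

/-- The properties of the steps that reach Step 3. -/
structure GoodStep (P : Params) (L ε : ℝ) (F : Set (EuclideanSpace ℝ (Fin n)))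
    (f : EuclideanSpace ℝ (Fin n) → ℝ) (x : EuclideanSpace ℝ (Fin n)) (σ ω : ℝ) (D : Tensors n)
    (s : EuclideanSpace ℝ (Fin n)) (δ : ℝ) : Prop where
  δ_mem : δ ∈ Set.Ioc (0 : ℝ) 1
  mem : x + s ∈ F
  inc_pos : 0 < inc D P.p s
  le_inc : σ / genFact P.p P.β * ‖s‖ ^ ((P.p : ℝ) + P.β) ≤ inc D P.p s
  abs_sub_le : |inc D P.p s - inc (derivs f x) P.p s| ≤ ω * inc D P.p s
  long_or : P.longStep ε ≤ ‖s‖ ∨ ∀ d ∈ feas F (x + s) δ,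
    inc (derivs f (x + s)) P.q d ≤ P.nextBound L ε ‖s‖ * chi P.q δ

lemma StepCalc.goodStep {flag : ℕ} {Δm : ℝ} (S : Setup P F f f_low L x₀)
    (hε : ε ∈ Set.Ioo (0 : ℝ) 1) (hx : x ∈ F) (hσ : 0 < σ)
    (hσ' : σ ≤ P.sigmaMax L) (hω : 0 < ω) (hω1 : ω ≤ P.κω)
    (hD : ∀ j ∈ Finset.Icc 1 P.p, ‖D j - iteratedFDeriv ℝ j f x‖ ≤ acc j)
    (h : StepCalc P ε F D acc x σ ω flag s δ Δm)
    (hflag : flag = 2 ∧ (P.longStep ε ≤ ‖s‖ ∨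
        (‖s‖ < P.longStep ε ∧ 0 < modelFlag P ε acc ω δ Δm))) :
    GoodStep P L ε F f x σ ω D s δ := by
  obtain ⟨h2, hl⟩ := hflag
  have h2' := h2
  rw [h.flag_eq] at h2'
  obtain ⟨hpos, hsum⟩ := of_verify_eq_two h2'
  exact
    { δ_mem := (h.modelTest h2).1
      mem := h.mem
      inc_pos := hpos
      le_inc := h.le_inc S.adm hx
      abs_sub_le := (abs_inc_sub_le (D' := derivs f x) hD le_rfl).trans hsum
      long_or := hl.imp id fun ⟨hs, hmf⟩ d hd =>
        h.next_le S hε hσ hσ' hω hω1 hD h2 hs hmf hd }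

section Ratio

variable {v₀ v₁ : ℝ}

/-- The iteration is very successful if the regularization parameter is large. -/
lemma GoodStep.le_ratio (S : Setup P F f f_low L x₀) (h : GoodStep P L ε F f x σ ω D s δ)
    (hσ : 0 < σ) (hωσ : ω ≤ 1 / σ)
    (hv₁ : |v₁ - f (x + s)| ≤ ω * |inc D P.p s|) (hv₀ : |v₀ - f x| ≤ ω * |inc D P.p s|)
    (hbig : (L + 3) / (1 - P.η₂) ≤ σ) : P.η₂ ≤ (v₀ - v₁) / inc D P.p s := by
  have hP := S.adm
  rw [abs_of_pos h.inc_pos] at hv₁ hv₀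
  set Δ := inc D P.p s
  have hΔ := h.inc_pos
  have hη := hP.η₂_lt_one
  have hg := genFact_pos hP.β_mem.1 P.p
  rw [le_div_iff₀ hΔ]
  have hT := (abs_le.1 (abs_sub_sub_inc_le hP.one_le_p hP.β_mem.1 S.smooth S.holder x s)).1
  -- The regularization turns the Taylor error into `(L/σ) Δ`. The `3` in `L + 3` counts the errors
  -- of size `ω Δ ≤ Δ/σ`: the derivatives and two function values.
  have h1 : L / genFact P.p P.β * ‖s‖ ^ ((P.p : ℝ) + P.β) ≤ L * (1 / σ) * Δ := by
    calc _ = L * (1 / σ) * (σ / genFact P.p P.β * ‖s‖ ^ ((P.p : ℝ) + P.β)) := by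
          field_simp
      _ ≤ _ := by
        have := S.L_nonneg
        have := h.le_inc
        gcongr
  have h2 : ω * Δ ≤ 1 / σ * Δ := by gcongr
  have h3 : (L + 3) * (1 / σ) ≤ 1 - P.η₂ := by
    rw [mul_one_div, div_le_iff₀ hσ]
    rw [div_le_iff₀ (by linarith)] at hbig
    linarith
  have h4 := mul_le_mul_of_nonneg_right h3 hΔ.le
  have h5 := (abs_le.1 h.abs_sub_le).2
  have h6 := (abs_le.1 hv₁).2
  have h7 := (abs_le.1 hv₀).1
  linarith

/-- `σ` can increase only from below `(L + 3)/(1 - η₂)`, and then by a factor of at most `γ₃`. -/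
lemma GoodStep.sigma_le (S : Setup P F f f_low L x₀) (h : GoodStep P L ε F f x σ ω D s δ)
    (hσ : 0 < σ) (hσ' : σ ≤ P.sigmaMax L) (hωσ : ω ≤ 1 / σ)
    (hv₁ : |v₁ - f (x + s)| ≤ ω * |inc D P.p s|) (hv₀ : |v₀ - f x| ≤ ω * |inc D P.p s|) {σ' : ℝ}
    (hup : SigmaUpdate P ((v₀ - v₁) / inc D P.p s) σ σ') : σ' ≤ P.sigmaMax L := by
  have hP := S.adm
  by_cases hρ : P.η₂ ≤ (v₀ - v₁) / inc D P.p s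
  · exact (hup.1 hρ).2.trans hσ'
  · have hlt : σ < (L + 3) / (1 - P.η₂) := by
      by_contra! hbig
      exact hρ (h.le_ratio S hσ hωσ hv₁ hv₀ hbig)
    have hγ : σ' ≤ P.γ₃ * σ := by
      by_cases hρ1 : P.η₁ ≤ (v₀ - v₁) / inc D P.p s
      · refine (hup.2.1 ⟨hρ1, not_le.1 hρ⟩).2.trans ?_
        have := hP.γ₂_lt_γ₃.le
        gcongr
      · exact (hup.2.2 (not_le.1 hρ1)).2
    have hγ3 : 0 < P.γ₃ := by linarith [hP.one_lt_γ₂, hP.γ₂_lt_γ₃]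
    refine hγ.trans (le_trans ?_ (le_max_right _ _))
    rw [mul_div_assoc]
    gcongr

lemma SigmaUpdate.le (hP : P.Admissible) {ρ σ' : ℝ} (hσ : P.σ_min ≤ σ)
    (hup : SigmaUpdate P ρ σ σ') :
    P.σ_min ≤ σ' ∧ (P.η₁ ≤ ρ → P.γ₁ * σ ≤ σ') ∧ (ρ < P.η₁ → P.γ₂ * σ ≤ σ') := by
  have hσ0 := hP.σ_min_pos.trans_le hσ
  have h1 : P.γ₁ * σ ≤ σ := by nlinarith [hP.γ₁_lt_one]
  have h2 : σ ≤ P.γ₂ * σ := by nlinarith [hP.one_lt_γ₂]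
  rcases le_or_gt P.η₂ ρ with h | h
  · have h3 := (hup.1 h).1
    refine ⟨(le_max_left _ _).trans h3, fun _ => (le_max_right _ _).trans h3, fun h' => ?_⟩
    linarith [hP.η₁_le_η₂]
  · rcases le_or_gt P.η₁ ρ with h' | h'
    · have h3 := (hup.2.1 ⟨h', h⟩).1
      exact ⟨hσ.trans h3, fun _ => h1.trans h3, fun h'' => by linarith⟩
    · have h3 := (hup.2.2 h').1
      exact ⟨hσ.trans (h2.trans h3), fun h'' => by linarith, fun _ => h3⟩

/-- The decrease of the objective in a successful iteration. -/
lemma GoodStep.decrease (hP : P.Admissible) (h : GoodStep P L ε F f x σ ω D s δ)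
    (hσ : P.σ_min ≤ σ) (hω : ω ≤ P.κω)
    (hv₁ : |v₁ - f (x + s)| ≤ ω * |inc D P.p s|) (hv₀ : |v₀ - f x| ≤ ω * |inc D P.p s|)
    (hρ : P.η₁ ≤ (v₀ - v₁) / inc D P.p s) :
    P.η₁ * (1 - P.α) * P.σ_min / genFact P.p P.β * ‖s‖ ^ ((P.p : ℝ) + P.β) ≤
      f x - f (x + s) := by
  rw [abs_of_pos h.inc_pos] at hv₁ hv₀
  rw [le_div_iff₀ h.inc_pos] at hρ
  have hg := genFact_pos hP.β_mem.1 P.p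
  have h1 := (abs_le.1 hv₁).1
  have h2 := (abs_le.1 hv₀).2
  have hα : 0 < 1 - P.α := by linarith [hP.α_mem.2]
  have hη := hP.η₁_pos
  -- The two errors in the function values cost at most the fraction `α` of the decrease `η₁ Δ`.
  have h3 : 2 * (ω * inc D P.p s) ≤ P.α * P.η₁ * inc D P.p s := by
    rw [← mul_assoc]
    have := hP.two_κω_le
    exact mul_le_mul_of_nonneg_right (by linarith) h.inc_pos.le
  calc _ = P.η₁ * (1 - P.α) * (P.σ_min / genFact P.p P.β * ‖s‖ ^ ((P.p : ℝ) + P.β)) := by ring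
    _ ≤ P.η₁ * (1 - P.α) * (σ / genFact P.p P.β * ‖s‖ ^ ((P.p : ℝ) + P.β)) := by gcongr
    _ ≤ P.η₁ * (1 - P.α) * inc D P.p s := by
      have := h.le_inc
      gcongr
    _ ≤ _ := by linarith

end Ratio

/-! ## Constants -/

lemma le_sigmaMax (P : Params) (L : ℝ) : P.σ₀ ≤ P.sigmaMax L := le_max_left _ _

lemma sigmaMax_pos (hP : P.Admissible) (L : ℝ) : 0 < P.sigmaMax L :=
  hP.σ₀_pos.trans_le (le_sigmaMax P L)

lemma omegaMin_pos (hP : P.Admissible) (L : ℝ) : 0 < P.omegaMin L :=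
  lt_min hP.κω_pos (one_div_pos.2 (sigmaMax_pos hP L))

/-- The factor of `ε` in the lower bound for `‖s‖ ^ (p - q + β)` is the inverse of this. -/
noncomputable def Params.stepConst (P : Params) (L : ℝ) : ℝ :=
  (1 + P.κω) * (L + P.sigmaMax L + P.θ * (1 + P.κω)) /
    ((1 - P.κω) * (1 - P.vth) * genFact (P.p - P.q) P.β)

lemma stepConst_pos (hP : P.Admissible) (hL : 0 ≤ L) : 0 < P.stepConst L := by
  have h1 := hP.κω_pos
  have h2 : 0 < 1 - P.κω := by linarith [hP.κω_lt]
  have h3 : 0 < 1 - P.vth := by linarith [hP.vth_mem.2]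
  have h4 := genFact_pos hP.β_mem.1 (P.p - P.q)
  have h5 := sigmaMax_pos hP L
  have h6 := hP.θ_pos
  rw [Params.stepConst]
  positivity

lemma kappaP_eq (P : Params) (L : ℝ) : P.kappaP L =
    genFact P.p P.β / (P.η₁ * (1 - P.α) * P.σ_min) *
      max (1 / P.μ ^ ((P.p : ℝ) + P.β)) (P.stepConst L ^ (((P.p : ℝ) + P.β) / P.expo)) := rfl

lemma kappaP_pos (hP : P.Admissible) (L : ℝ) : 0 < P.kappaP L := by
  have h1 := genFact_pos hP.β_mem.1 P.p
  have h2 : 0 < 1 - P.α := by linarith [hP.α_mem.2]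
  have h3 := hP.η₁_pos
  have h4 := hP.σ_min_pos
  have h5 := hP.μ_mem.1
  have h6 : 0 < max (1 / P.μ ^ ((P.p : ℝ) + P.β))
      (P.stepConst L ^ (((P.p : ℝ) + P.β) / P.expo)) := lt_max_of_lt_left (by positivity)
  rw [kappaP_eq]
  positivity

/-- The guaranteed decrease of the objective in successful iterations, except perhaps the last. -/
noncomputable def Params.gain (P : Params) (L ε : ℝ) : ℝ := (P.kappaP L * P.rate ε)⁻¹

lemma gain_pos (hP : P.Admissible) (L : ℝ) (hε : 0 < ε) : 0 < P.gain L ε :=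
  inv_pos.2 (mul_pos (kappaP_pos hP L) (Real.rpow_pos_of_pos hε _))

/-- The two alternatives for `t`, raised to the appropriate powers, are the two entries of the
maximum in `kappaP`. -/
lemma gain_le (hP : P.Admissible) (hL : 0 ≤ L) (hε : 0 < ε) {t : ℝ} (ht : 0 ≤ t)
    (h : P.longStep ε ≤ t ∨ ε ≤ P.stepConst L * t ^ P.expo) :
    P.gain L ε ≤ P.η₁ * (1 - P.α) * P.σ_min / genFact P.p P.β * t ^ ((P.p : ℝ) + P.β) := by
  have h1 := genFact_pos hP.β_mem.1 P.p
  have h2 : 0 < 1 - P.α := by linarith [hP.α_mem.2]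
  have h3 := hP.η₁_pos
  have h4 := hP.σ_min_pos
  have h5 := hP.μ_mem.1
  have hβ := hP.β_mem.1
  have he := expo_pos hP
  set M := max (1 / P.μ ^ ((P.p : ℝ) + P.β)) (P.stepConst L ^ (((P.p : ℝ) + P.β) / P.expo))
  have hM : 0 < M := lt_max_of_lt_left (by positivity)
  set a := ε ^ (((P.p : ℝ) + P.β) / P.expo) with ha
  have ha0 : 0 < a := Real.rpow_pos_of_pos hε _
  have hrate : P.rate ε = a⁻¹ := by rw [Params.rate, Real.rpow_neg hε.le]
  have key : a ≤ M * t ^ ((P.p : ℝ) + P.β) := by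
    rcases h with h | h
    · have h6 : (P.longStep ε) ^ ((P.p : ℝ) + P.β) ≤ t ^ ((P.p : ℝ) + P.β) :=
        Real.rpow_le_rpow (by rw [Params.longStep]; positivity) h (by positivity)
      have h7 : (P.longStep ε) ^ ((P.p : ℝ) + P.β) = P.μ ^ ((P.p : ℝ) + P.β) * a := by
        rw [Params.longStep, Real.mul_rpow h5.le (by positivity), ← Real.rpow_mul hε.le, ha]
        congr 2
        ring
      calc a = 1 / P.μ ^ ((P.p : ℝ) + P.β) * (P.μ ^ ((P.p : ℝ) + P.β) * a) := by field_simp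
        _ ≤ M * t ^ ((P.p : ℝ) + P.β) := by
          rw [← h7]
          have := le_max_left (1 / P.μ ^ ((P.p : ℝ) + P.β))
            (P.stepConst L ^ (((P.p : ℝ) + P.β) / P.expo))
          gcongr
          rw [Params.longStep]
          positivity
    · have hc := stepConst_pos hP hL
      calc a ≤ (P.stepConst L * t ^ P.expo) ^ (((P.p : ℝ) + P.β) / P.expo) :=
            Real.rpow_le_rpow hε.le h (by positivity)
        _ = P.stepConst L ^ (((P.p : ℝ) + P.β) / P.expo) * t ^ ((P.p : ℝ) + P.β) := by
          rw [Real.mul_rpow hc.le (by positivity), ← Real.rpow_mul ht,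
            mul_div_cancel₀ _ he.ne']
        _ ≤ _ := by
          have := le_max_right (1 / P.μ ^ ((P.p : ℝ) + P.β))
            (P.stepConst L ^ (((P.p : ℝ) + P.β) / P.expo))
          gcongr
  have hk : P.gain L ε = P.η₁ * (1 - P.α) * P.σ_min / genFact P.p P.β * (a / M) := by
    rw [Params.gain, hrate, kappaP_eq]
    change (genFact P.p P.β / (P.η₁ * (1 - P.α) * P.σ_min) * M * a⁻¹)⁻¹ = _
    field_simp
  rw [hk]
  have h8 : a / M ≤ t ^ ((P.p : ℝ) + P.β) := by
    rw [div_le_iff₀ hM]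
    linarith
  gcongr

/-- A step is not too short if the algorithm does not terminate in the following Step 1. -/
lemma GoodStep.long_or_of_notOptimal (hP : P.Admissible)
    (h : GoodStep P L ε F f x σ ω D s δ) (hn : NotOptimal P ε F f (x + s) δ) :
    P.longStep ε ≤ ‖s‖ ∨ ε ≤ P.stepConst L * ‖s‖ ^ P.expo := by
  refine h.long_or.imp id fun hle => ?_
  obtain ⟨d, hd, hlt⟩ := hn
  have h1 := lt_of_mul_lt_mul_right (hlt.trans_le (hle d hd)) (chi_nonneg P.q h.δ_mem.1.le)
  have h2 := hP.κω_pos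
  have h3 : 0 < 1 - P.κω := by linarith [hP.κω_lt]
  have h4 : 0 < 1 - P.vth := by linarith [hP.vth_mem.2]
  have h5 := genFact_pos hP.β_mem.1 (P.p - P.q)
  rw [Params.nextBound] at h1
  -- The `vth` term of `nextBound` is moved to the side of the threshold, whence the factor `1 -
  -- vth`.
  have h6 : (1 - P.vth) * ((1 - P.κω) / (1 + P.κω)) * ε ≤
      (L + P.sigmaMax L + P.θ * (1 + P.κω)) * (‖s‖ ^ P.expo / genFact (P.p - P.q) P.β) := by
    linarith
  calc ε = (1 + P.κω) / ((1 - P.κω) * (1 - P.vth)) *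
        ((1 - P.vth) * ((1 - P.κω) / (1 + P.κω)) * ε) := by field_simp
    _ ≤ (1 + P.κω) / ((1 - P.κω) * (1 - P.vth)) *
        ((L + P.sigmaMax L + P.θ * (1 + P.κω)) * (‖s‖ ^ P.expo / genFact (P.p - P.q) P.β)) := by
      gcongr
    _ = _ := by rw [Params.stepConst]; field_simp

/-- The threshold for the accuracies below which no reduction takes place. -/
noncomputable def Params.threshold (P : Params) (L ε : ℝ) : ℝ :=
  P.vth * (1 - P.κω) / (6 * (1 + P.κω) ^ 2) * P.omegaMin L * ε

lemma threshold_pos (hP : P.Admissible) (L : ℝ) (hε : 0 < ε) : 0 < P.threshold L ε := by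
  have h1 := hP.κω_pos
  have h2 : 0 < 1 - P.κω := by linarith [hP.κω_lt]
  have h3 := omegaMin_pos hP L
  have h4 := hP.vth_mem.1
  rw [Params.threshold]
  positivity

/-- The `6` in the threshold is the `3` of `modelAcc` times the `2` in `ω ε / 2`. The check on the
model is the most demanding one, so a single threshold serves all checks. -/
lemma threshold_le_modelTol (hP : P.Admissible) (hε : 0 < ε) (hω : P.omegaMin L ≤ ω) :
    P.threshold L ε ≤ P.modelTol ω ε / 3 := by
  have h1 := hP.κω_pos
  have h2 : 0 < 1 - P.κω := by linarith [hP.κω_lt]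
  have h4 := hP.vth_mem.1
  have h5 : P.modelTol ω ε / 3 = P.vth * (1 - P.κω) / (6 * (1 + P.κω) ^ 2) * ω * ε := by
    rw [Params.modelTol]
    field_simp
    ring
  rw [h5, Params.threshold]
  gcongr

lemma threshold_le_half (hP : P.Admissible) (hε : 0 < ε) (hω : P.omegaMin L ≤ ω) :
    P.threshold L ε ≤ 1 / 2 * ω * ε := by
  have h1 := hP.κω_pos
  have h2 : 0 < 1 - P.κω := by linarith [hP.κω_lt]
  have h3 := omegaMin_pos hP L
  have h6 : P.vth * (1 - P.κω) / (6 * (1 + P.κω) ^ 2) ≤ 1 / 2 := by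
    rw [div_le_iff₀ (by positivity)]
    have : P.vth * (1 - P.κω) ≤ 1 := by
      have := mul_le_mul hP.vth_mem.2.le (by linarith : 1 - P.κω ≤ 1) h2.le zero_le_one
      linarith
    nlinarith
  rw [Params.threshold]
  gcongr

/-- The number of reductions of the accuracies is bounded. -/
lemma lt_nuMax (hP : P.Admissible) (hε : 0 < ε) {ν : ℕ}
    (h : P.threshold L ε < P.γe ^ ν * P.κe) : ν < P.nuMax L ε := by
  have hT := threshold_pos hP L hε
  have hγ := hP.γe_mem
  have hlog : Real.log P.γe < 0 := Real.log_neg hγ.1 hγ.2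
  have h1 := Real.log_lt_log hT h
  rw [Real.log_mul (pow_pos hγ.1 _).ne' hP.κe_pos.ne', Real.log_pow] at h1
  -- Division by `log γe < 0` reverses the inequality. The strict conclusion leaves room for the
  -- reduction about to be made.
  rw [Params.nuMax, Nat.lt_ceil, one_div_mul_eq_div, lt_div_iff_of_neg hlog]
  rw [Params.threshold] at h1
  linarith

/-- The bound on the number of iterations in terms of the number of successful iterations. -/
lemma le_tau (hP : P.Admissible) {gap : ℝ} {a b : ℕ} (ha : a ≤ P.succMax L gap ε)
    (hσ : P.σ₀ * P.γ₁ ^ a * P.γ₂ ^ b ≤ P.sigmaMax L) : a + b ≤ P.tau L gap ε := by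
  have hσ0 := hP.σ₀_pos
  have hγ1 := hP.γ₁_pos
  have hγ2 : 0 < P.γ₂ := by linarith [hP.one_lt_γ₂]
  have hl1 : Real.log P.γ₁ < 0 := Real.log_neg hγ1 hP.γ₁_lt_one
  have hl2 : 0 < Real.log P.γ₂ := Real.log_pos hP.one_lt_γ₂
  have h1 := Real.log_le_log (by positivity) hσ
  rw [Real.log_mul (by positivity) (by positivity), Real.log_mul (by positivity) (by positivity),
    Real.log_pow, Real.log_pow] at h1
  have h2 : Real.log (P.sigmaMax L / P.σ₀) = Real.log (P.sigmaMax L) - Real.log P.σ₀ :=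
    Real.log_div (sigmaMax_pos hP L).ne' hσ0.ne'
  refine Nat.le_floor ?_
  have h3 : (b : ℝ) ≤ a * (|Real.log P.γ₁| / Real.log P.γ₂) +
      1 / Real.log P.γ₂ * Real.log (P.sigmaMax L / P.σ₀) := by
    have h4 : (a : ℝ) * (|Real.log P.γ₁| / Real.log P.γ₂) +
        1 / Real.log P.γ₂ * Real.log (P.sigmaMax L / P.σ₀) =
        (a * |Real.log P.γ₁| + Real.log (P.sigmaMax L / P.σ₀)) / Real.log P.γ₂ := by
      field_simp
    rw [h4, le_div_iff₀ hl2, h2, abs_of_neg hl1]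
    linarith
  have h5 : (a : ℝ) * (1 + |Real.log P.γ₁| / Real.log P.γ₂) ≤
      P.succMax L gap ε * (1 + |Real.log P.γ₁| / Real.log P.γ₂) := by
    gcongr
  push_cast
  linarith

end ARpDA

namespace ARpDA
open Filter Topology

/-! ## Invariants of the algorithm -/

variable {n : ℕ} {P : Params} {F : Set (EuclideanSpace ℝ (Fin n))}
  {f : EuclideanSpace ℝ (Fin n) → ℝ} {f_low L ε : ℝ} {x₀ : EuclideanSpace ℝ (Fin n)}
  {D : Tensors n} {acc₀ : ℕ → ℝ} {ν i : ℕ} {st st' : State n}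

/-- The part of the invariant that does not depend on the phase; `ν` is the number of reductions of
the derivative accuracies so far. -/
structure CoreInv (P : Params) (L ε : ℝ) (F : Set (EuclideanSpace ℝ (Fin n)))
    (f : EuclideanSpace ℝ (Fin n) → ℝ) (x₀ : EuclideanSpace ℝ (Fin n)) (acc₀ : ℕ → ℝ) (ν : ℕ)
    (st : State n) : Prop where
  mem : st.x ∈ F
  δ_mem : st.δ ∈ Set.Ioc (0 : ℝ) 1
  le_σ : P.σ_min ≤ st.σ
  σ_le : st.σ ≤ P.sigmaMax L
  ω_eq : st.ω = min P.κω (1 / st.σ)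
  acc_eq : ∀ j, st.acc j = P.γe ^ ν * acc₀ j
  ν_le : ν ≤ P.nuMax L ε
  norm_sub_le : ∀ j ∈ st.avail, ‖st.D j - iteratedFDeriv ℝ j f st.x‖ ≤ st.acc j
  -- An available derivative is lost only by a reduction or a successful step, and either event pays
  -- for one new evaluation.
  dEvals_le : ∀ j, st.dEvals j ≤ ν + st.succ + if j ∈ st.avail then 1 else 0
  fEvals_le : st.fEvals ≤ 2 * st.k
  succ_le : st.succ ≤ st.k
  growth : P.σ₀ * P.γ₁ ^ st.succ * P.γ₂ ^ (st.k - st.succ) ≤ st.σ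
  -- The last successful step is left out: it may be very short if the next Step 1 terminates.
  gain_le : ((st.succ : ℝ) - 1) * P.gain L ε ≤ f x₀ - f st.x

/-- The part of the invariant that depends on the phase. -/
def PhaseInv (P : Params) (L ε : ℝ) (F : Set (EuclideanSpace ℝ (Fin n)))
    (f : EuclideanSpace ℝ (Fin n) → ℝ) (x₀ : EuclideanSpace ℝ (Fin n)) (st : State n) : Prop :=
  match st.phase with
  -- The gain of the last successful step is credited only if the algorithm is not about to stop
  -- here.
  | Phase.step1 => NotOptimal P ε F f st.x st.δ → (st.succ : ℝ) * P.gain L ε ≤ f x₀ - f st.x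
  | Phase.step2 => (st.succ : ℝ) * P.gain L ε ≤ f x₀ - f st.x
  | Phase.step3 s δ => (st.succ : ℝ) * P.gain L ε ≤ f x₀ - f st.x ∧
      GoodStep P L ε F f st.x st.σ st.ω st.D s δ
  | Phase.halted s => Conclusion P ε F f st.x s

/-- The number of phases of the current iteration that are completed. -/
def Phase.idx : Phase n → ℕ
  | Phase.step1 => 0
  | Phase.step2 => 1
  | Phase.step3 _ _ => 2
  | Phase.halted _ => 3

/-- The invariant for the states reached by `i` transitions. -/
def Inv (P : Params) (L ε : ℝ) (F : Set (EuclideanSpace ℝ (Fin n)))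
    (f : EuclideanSpace ℝ (Fin n) → ℝ) (x₀ : EuclideanSpace ℝ (Fin n)) (acc₀ : ℕ → ℝ) (i : ℕ)
    (st : State n) : Prop :=
  ∃ ν, CoreInv P L ε F f x₀ acc₀ ν st ∧ PhaseInv P L ε F f x₀ st ∧
    -- Each transition raises the right-hand side: it makes a reduction, advances the phase, or
    -- passes from the last phase to a new iteration (`-2 + 3`).
    i ≤ 3 * st.k + ν + st.phase.idx

namespace CoreInv

variable (h : CoreInv P L ε F f x₀ acc₀ ν st)
include h

lemma σ_pos (hP : P.Admissible) : 0 < st.σ := hP.σ_min_pos.trans_le h.le_σ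

lemma ω_pos (hP : P.Admissible) : 0 < st.ω := by
  rw [h.ω_eq]
  exact lt_min hP.κω_pos (one_div_pos.2 (h.σ_pos hP))

lemma ω_le : st.ω ≤ P.κω := by rw [h.ω_eq]; exact min_le_left _ _

lemma ω_le_one (hP : P.Admissible) : st.ω ≤ 1 := by linarith [h.ω_le, hP.κω_lt]

lemma ω_le_inv : st.ω ≤ 1 / st.σ := by rw [h.ω_eq]; exact min_le_right _ _

lemma omegaMin_le (hP : P.Admissible) : P.omegaMin L ≤ st.ω := by
  have := h.σ_pos hP
  have := h.σ_le
  rw [h.ω_eq, Params.omegaMin]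
  gcongr

lemma withPhase (ph : Phase n) : CoreInv P L ε F f x₀ acc₀ ν { st with phase := ph } :=
  ⟨h.mem, h.δ_mem, h.le_σ, h.σ_le, h.ω_eq, h.acc_eq, h.ν_le, h.norm_sub_le, h.dEvals_le,
    h.fEvals_le, h.succ_le, h.growth, h.gain_le⟩

lemma accurate {r : ℕ} (hD : st.Evaluates f r D) {j : ℕ} (hj : j ∈ st.avail ∪ Finset.Icc 1 r) :
    ‖D j - iteratedFDeriv ℝ j f st.x‖ ≤ st.acc j := by
  by_cases hja : j ∈ st.avail
  · rw [hD.1 j hja]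
    exact h.norm_sub_le j hja
  · exact hD.2 j (Finset.mem_sdiff.2 ⟨(Finset.mem_union.1 hj).resolve_left hja, hja⟩)

lemma withDerivs {r : ℕ} (hD : st.Evaluates f r D) :
    CoreInv P L ε F f x₀ acc₀ ν (st.withDerivs r D) where
  mem := h.mem
  δ_mem := h.δ_mem
  le_σ := h.le_σ
  σ_le := h.σ_le
  ω_eq := h.ω_eq
  acc_eq := h.acc_eq
  ν_le := h.ν_le
  norm_sub_le _ hj := h.accurate hD hj
  dEvals_le j := by
    have h1 := h.dEvals_le j
    simp only [State.withDerivs, Finset.mem_sdiff, Finset.mem_union]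
    by_cases h2 : j ∈ st.avail <;> by_cases h3 : j ∈ Finset.Icc 1 r <;> simp [h2, h3] at h1 ⊢ <;>
      omega
  fEvals_le := h.fEvals_le
  succ_le := h.succ_le
  growth := h.growth
  gain_le := h.gain_le

lemma tighten (hP : P.Admissible) (hε : 0 < ε) (hacc : P.AdmissibleAcc acc₀)
    (hlt : ∃ j ∈ Finset.Icc 1 P.p, P.threshold L ε < st.acc j) :
    CoreInv P L ε F f x₀ acc₀ (ν + 1) (st.tighten P.γe) where
  mem := h.mem
  δ_mem := h.δ_mem
  le_σ := h.le_σ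
  σ_le := h.σ_le
  ω_eq := h.ω_eq
  acc_eq j := by
    change P.γe * st.acc j = _
    rw [h.acc_eq j]
    ring
  ν_le := by
    obtain ⟨j, hj, hlt⟩ := hlt
    rw [h.acc_eq j] at hlt
    refine lt_nuMax hP hε (hlt.trans_le ?_)
    have := hP.γe_mem.1
    have := (hacc j hj).2
    gcongr
  norm_sub_le _ hj := absurd hj (Finset.notMem_empty _)
  -- Emptying `avail` loses the indicator, which the increase of `ν` replaces.
  dEvals_le j := by
    have h1 := h.dEvals_le j
    simp only [State.tighten, Finset.notMem_empty, if_false]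
    split_ifs at h1 <;> omega
  fEvals_le := h.fEvals_le
  succ_le := h.succ_le
  growth := h.growth
  gain_le := h.gain_le

end CoreInv

lemma inv_start (S : Setup P F f f_low L x₀) (hε : 0 < ε) (acc₀ : ℕ → ℝ) :
    Inv P L ε F f x₀ acc₀ 0 (start P x₀ acc₀) := by
  have hg := gain_pos S.adm L hε
  refine ⟨0, ⟨S.mem, S.adm.δ_init_mem, S.adm.σ_min_le, le_sigmaMax P L, rfl, fun j => ?_,
    Nat.zero_le _, fun _ hj => absurd hj (Finset.notMem_empty _), fun j => Nat.zero_le _, le_rfl,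
    le_rfl, ?_, ?_⟩, fun _ => ?_, Nat.zero_le _⟩
  · simp [start]
  · simp [start]
  · simp only [start, Nat.cast_zero, zero_sub, neg_one_mul, sub_self]
    linarith
  · simp [start]

lemma CoreInv.goodStep_decrease (S : Setup P F f f_low L x₀)
    (h : CoreInv P L ε F f x₀ acc₀ ν st) {s : EuclideanSpace ℝ (Fin n)} {δ v₀ v₁ : ℝ} {c : ℕ}
    (hstep : Step3Calc f P.p st s δ v₀ v₁ c) (hgood : GoodStep P L ε F f st.x st.σ st.ω st.D s δ)
    (hρ : P.η₁ ≤ ratio P.p st s v₀ v₁) :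
    P.η₁ * (1 - P.α) * P.σ_min / genFact P.p P.β * ‖s‖ ^ ((P.p : ℝ) + P.β) ≤
      f st.x - f (st.x + s) :=
  hgood.decrease S.adm h.le_σ h.ω_le hstep.2.1 hstep.2.2.1 hρ

lemma inv_step3_success (S : Setup P F f f_low L x₀) (hε : 0 < ε)
    (h : Inv P L ε F f x₀ acc₀ i st) {s : EuclideanSpace ℝ (Fin n)} {δ v₀ v₁ σ' : ℝ} {c : ℕ}
    (hstep : Step3Calc f P.p st s δ v₀ v₁ c) (hρ : P.η₁ ≤ ratio P.p st s v₀ v₁)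
    (hσ : SigmaUpdate P (ratio P.p st s v₀ v₁) st.σ σ') :
    Inv P L ε F f x₀ acc₀ (i + 1)
      { st with
        phase := Phase.step1
        k := st.k + 1
        succ := st.succ + 1
        fEvals := st.fEvals + c
        x := st.x + s
        δ := δ
        σ := σ'
        ω := min P.κω (1 / σ')
        avail := ∅
        fval := some v₁ } := by
  obtain ⟨ν, hc, hp, hi⟩ := h
  have hP := S.adm
  rw [PhaseInv, hstep.1] at hp
  obtain ⟨hgain, hgood⟩ := hp
  obtain ⟨hσ1, hσ2, _⟩ := hσ.le hP hc.le_σ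
  have hdec := hc.goodStep_decrease S hstep hgood hρ
  have hdec0 : 0 ≤ f st.x - f (st.x + s) := by
    refine le_trans ?_ hdec
    have h1 := genFact_pos hP.β_mem.1 P.p
    have h2 : 0 < 1 - P.α := by linarith [hP.α_mem.2]
    have h3 := hP.η₁_pos
    have h4 := hP.σ_min_pos
    positivity
  rw [hstep.1] at hi
  refine ⟨ν, ⟨hgood.mem, hgood.δ_mem, hσ1,
    hgood.sigma_le S (hc.σ_pos hP) hc.σ_le hc.ω_le_inv hstep.2.1 hstep.2.2.1 hσ, rfl, hc.acc_eq,
    hc.ν_le, fun _ hj => absurd hj (Finset.notMem_empty _), fun j => ?_, ?_, ?_, ?_, ?_⟩,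
    fun hn => ?_, ?_⟩
  · have := hc.dEvals_le j
    simp only [Finset.notMem_empty, if_false]
    split_ifs at this <;> omega
  · have := hc.fEvals_le
    have : c ≤ 2 := by rcases hstep.2.2.2 with h | h <;> omega
    change st.fEvals + c ≤ 2 * (st.k + 1)
    omega
  · exact Nat.succ_le_succ hc.succ_le
  · change P.σ₀ * P.γ₁ ^ (st.succ + 1) * P.γ₂ ^ (st.k + 1 - (st.succ + 1)) ≤ σ'
    rw [Nat.add_sub_add_right]
    refine le_trans ?_ (hσ2 hρ)
    have := hP.γ₁_pos
    calc _ = P.γ₁ * (P.σ₀ * P.γ₁ ^ st.succ * P.γ₂ ^ (st.k - st.succ)) := by ring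
      _ ≤ _ := by
        have := hc.growth
        gcongr
  · change (((st.succ + 1 : ℕ) : ℝ) - 1) * P.gain L ε ≤ f x₀ - f (st.x + s)
    push_cast
    rw [add_sub_cancel_right]
    linarith
  -- Non-optimality at the new iterate bounds `‖s‖` from below, so the full gain is earned.
  · change ((st.succ + 1 : ℕ) : ℝ) * P.gain L ε ≤ f x₀ - f (st.x + s)
    have h1 := gain_le hP S.L_nonneg hε (norm_nonneg s) (hgood.long_or_of_notOptimal hP hn)
    push_cast
    linarith
  · simp only [Phase.idx] at hi ⊢
    omega

/-- The iterate and the thresholds do not change, so the available derivatives and the credited gain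
survive unconditionally, although the radius is new. -/
lemma inv_step3_failure (S : Setup P F f f_low L x₀)
    (h : Inv P L ε F f x₀ acc₀ i st) {s : EuclideanSpace ℝ (Fin n)} {δ v₀ v₁ σ' : ℝ} {c : ℕ}
    (hstep : Step3Calc f P.p st s δ v₀ v₁ c) (hρ : ratio P.p st s v₀ v₁ < P.η₁)
    (hσ : SigmaUpdate P (ratio P.p st s v₀ v₁) st.σ σ') :
    Inv P L ε F f x₀ acc₀ (i + 1)
      { st with
        phase := Phase.step1
        k := st.k + 1
        fEvals := st.fEvals + c
        δ := δ
        σ := σ'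
        ω := min P.κω (1 / σ')
        fval := some v₀ } := by
  obtain ⟨ν, hc, hp, hi⟩ := h
  have hP := S.adm
  rw [PhaseInv, hstep.1] at hp
  obtain ⟨hgain, hgood⟩ := hp
  obtain ⟨hσ1, _, hσ2⟩ := hσ.le hP hc.le_σ
  rw [hstep.1] at hi
  refine ⟨ν, ⟨hc.mem, hgood.δ_mem, hσ1,
    hgood.sigma_le S (hc.σ_pos hP) hc.σ_le hc.ω_le_inv hstep.2.1 hstep.2.2.1 hσ, rfl, hc.acc_eq,
    hc.ν_le, hc.norm_sub_le, hc.dEvals_le, ?_, ?_, ?_, hc.gain_le⟩, fun _ => hgain, ?_⟩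
  · have := hc.fEvals_le
    have : c ≤ 2 := by rcases hstep.2.2.2 with h | h <;> omega
    change st.fEvals + c ≤ 2 * (st.k + 1)
    omega
  · exact hc.succ_le.trans (Nat.le_succ _)
  · change P.σ₀ * P.γ₁ ^ st.succ * P.γ₂ ^ (st.k + 1 - st.succ) ≤ σ'
    rw [Nat.succ_sub hc.succ_le, pow_succ]
    refine le_trans ?_ (hσ2 hρ)
    have : 0 < P.γ₂ := by linarith [hP.one_lt_γ₂]
    calc _ = P.γ₂ * (P.σ₀ * P.γ₁ ^ st.succ * P.γ₂ ^ (st.k - st.succ)) := by ring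
      _ ≤ _ := by
        have := hc.growth
        gcongr
  · simp only [Phase.idx] at hi ⊢
    omega

lemma Inv.trans (S : Setup P F f f_low L x₀) (hε : ε ∈ Set.Ioo (0 : ℝ) 1)
    (hacc : P.AdmissibleAcc acc₀) (h : Inv P L ε F f x₀ acc₀ i st)
    (ht : Trans P ε F f st st') : Inv P L ε F f x₀ acc₀ (i + 1) st' := by
  have hP := S.adm
  obtain ⟨ν, hc, hp, hi⟩ := id h
  have hω := hc.ω_pos hP
  have hsub : ∀ {r : ℕ} {D : Tensors n}, st.Evaluates f r D → ∀ j ∈ Finset.Icc 1 r,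
      ‖D j - iteratedFDeriv ℝ j f st.x‖ ≤ st.acc j := fun hD j hj =>
    hc.accurate hD (Finset.mem_union_right _ hj)
  cases ht with
  | step1_halt D d hcalc hflag =>
    obtain ⟨hph, hD, hd, hmax⟩ := hcalc
    rw [hph] at hi
    refine ⟨ν, (hc.withDerivs hD).withPhase _, ?_, ?_⟩
    · exact conclusion_of_step1 hε.1 hc.mem hc.δ_mem hω (hc.ω_le_one hP) (hsub hD) hd hmax hflag
    · simp only [Phase.idx, State.withDerivs] at hi ⊢
      omega
  | step1_pass D d hcalc hflag =>
    obtain ⟨hph, hD, hd, hmax⟩ := hcalc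
    rw [PhaseInv, hph] at hp
    rw [hph] at hi
    refine ⟨ν, (hc.withDerivs hD).withPhase _, ?_, ?_⟩
    · exact hp (notOptimal_of_step1 hP hε.1 hc.δ_mem hω hc.ω_le (hsub hD) hd hmax hflag)
    · simp only [Phase.idx, State.withDerivs] at hi ⊢
      omega
  | step1_again D d hcalc hflag =>
    obtain ⟨hph, hD, hd, hmax⟩ := hcalc
    obtain ⟨j, hj, hlt⟩ := exists_lt_acc_of_step1 hc.mem hc.δ_mem hmax hflag
    have hj' : j ∈ Finset.Icc 1 P.p := Finset.Icc_subset_Icc_right hP.q_le_p hj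
    refine ⟨ν + 1, (hc.withDerivs hD).tighten hP hε.1 hacc
      ⟨j, hj', (threshold_le_half hP hε.1 (hc.omegaMin_le hP)).trans_lt hlt⟩, ?_, ?_⟩
    · rw [PhaseInv, hph] at hp
      rw [PhaseInv]
      simp only [State.tighten, State.withDerivs, hph]
      exact hp
    · simp only [State.tighten, State.withDerivs]
      omega
  | step2_halt D flag s δ Δm hcalc hflag =>
    obtain ⟨hph, hD, hstep⟩ := hcalc
    rw [hph] at hi
    refine ⟨ν, (hc.withDerivs hD).withPhase _, ?_, ?_⟩
    · exact hstep.conclusion hP hε.1 hc.mem (hc.σ_pos hP) hω (hc.ω_le_one hP) (hsub hD) hflag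
    · simp only [Phase.idx, State.withDerivs] at hi ⊢
      omega
  | step2_pass D flag s δ Δm hcalc hflag =>
    obtain ⟨hph, hD, hstep⟩ := hcalc
    rw [PhaseInv, hph] at hp
    rw [hph] at hi
    refine ⟨ν, (hc.withDerivs hD).withPhase _, ?_, ?_⟩
    · exact ⟨hp, hstep.goodStep S hε hc.mem (hc.σ_pos hP) hc.σ_le hω hc.ω_le (hsub hD) hflag⟩
    · simp only [Phase.idx, State.withDerivs] at hi ⊢
      omega
  | step2_again D flag s δ Δm hcalc hflag =>
    obtain ⟨hph, hD, hstep⟩ := hcalc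
    have hlt : ∃ j ∈ Finset.Icc 1 P.p, P.threshold L ε < st.acc j := by
      rcases hflag with h0 | ⟨h2, hs, hmf⟩
      · obtain ⟨j, hj, hlt⟩ := hstep.exists_lt_acc_of_flag hP hc.mem (hc.σ_pos hP) h0
        exact ⟨j, hj, (threshold_le_half hP hε.1 (hc.omegaMin_le hP)).trans_lt hlt⟩
      · obtain ⟨j, hj, hlt⟩ := hstep.exists_lt_acc_of_modelFlag hP h2 hs hmf
        exact ⟨j, hj, (threshold_le_modelTol hP hε.1 (hc.omegaMin_le hP)).trans_lt hlt⟩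
    refine ⟨ν + 1, (hc.withDerivs hD).tighten hP hε.1 hacc hlt, ?_, ?_⟩
    · rw [PhaseInv, hph] at hp
      rw [PhaseInv]
      simp only [State.tighten, State.withDerivs, hph]
      exact hp
    · simp only [State.tighten, State.withDerivs]
      omega
  | step3_success s δ v₀ v₁ c σ' hcalc hρ hσ => exact inv_step3_success S hε.1 h hcalc hρ hσ
  | step3_failure s δ v₀ v₁ c σ' hcalc hρ hσ => exact inv_step3_failure S h hcalc hρ hσ

lemma Inv.of_run (S : Setup P F f f_low L x₀) (hε : ε ∈ Set.Ioo (0 : ℝ) 1)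
    (hacc : P.AdmissibleAcc acc₀) {run : ℕ → State n} (h0 : run 0 = start P x₀ acc₀)
    (hrun : ∀ i, Trans P ε F f (run i) (run (i + 1))) (i : ℕ) :
    Inv P L ε F f x₀ acc₀ i (run i) := by
  induction i with
  | zero => rw [h0]; exact inv_start S hε.1 acc₀
  | succ i ih => exact ih.trans S hε hacc (hrun i)

lemma Reachable.exists_inv (S : Setup P F f f_low L x₀) (hε : ε ∈ Set.Ioo (0 : ℝ) 1)
    (hacc : P.AdmissibleAcc acc₀) (h : Reachable P ε F f x₀ acc₀ st) :
    ∃ i, Inv P L ε F f x₀ acc₀ i st := by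
  induction h with
  | refl => exact ⟨0, inv_start S hε.1 acc₀⟩
  | tail _ ht ih =>
    obtain ⟨i, hi⟩ := ih
    exact ⟨i + 1, hi.trans S hε hacc ht⟩

/-! ## Bounds -/

/-- The total decrease is at most `f x₀ - f_low`; the `+ 1` in `succMax` is the uncredited last
step. -/
lemma CoreInv.succ_le_succMax (S : Setup P F f f_low L x₀) (hε : 0 < ε)
    (h : CoreInv P L ε F f x₀ acc₀ ν st) : st.succ ≤ P.succMax L (f x₀ - f_low) ε := by
  have h1 := h.gain_le
  have h2 := S.low_le st.x
  have hk : 0 < P.kappaP L * P.rate ε :=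
    mul_pos (kappaP_pos S.adm L) (Real.rpow_pos_of_pos hε _)
  rw [Params.gain, ← div_eq_mul_inv, div_le_iff₀ hk] at h1
  have h3 : (st.succ : ℝ) - 1 ≤ P.kappaP L * (f x₀ - f_low) * P.rate ε := by
    calc _ ≤ (f x₀ - f st.x) * (P.kappaP L * P.rate ε) := h1
      _ ≤ (f x₀ - f_low) * (P.kappaP L * P.rate ε) := by gcongr
      _ = _ := by ring
  rw [Params.succMax, ← Nat.sub_le_iff_le_add]
  rcases Nat.eq_zero_or_pos st.succ with h0 | h0
  · simp [h0]
  · refine Nat.le_floor ?_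
    rwa [Nat.cast_sub h0, Nat.cast_one]

lemma CoreInv.k_le_tau (S : Setup P F f f_low L x₀) (hε : 0 < ε)
    (h : CoreInv P L ε F f x₀ acc₀ ν st) : st.k ≤ P.tau L (f x₀ - f_low) ε := by
  have h1 := le_tau S.adm (h.succ_le_succMax S hε) (h.growth.trans h.σ_le)
  rwa [Nat.add_sub_cancel' h.succ_le] at h1

lemma CoreInv.bounds (S : Setup P F f f_low L x₀) (hε : 0 < ε)
    (h : CoreInv P L ε F f x₀ acc₀ ν st) :
    st.succ ≤ P.succMax L (f x₀ - f_low) ε ∧ st.k ≤ P.tau L (f x₀ - f_low) ε ∧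
      st.fEvals ≤ 2 * P.tau L (f x₀ - f_low) ε ∧
      ∀ j, st.dEvals j ≤ P.nuMax L ε + P.tau L (f x₀ - f_low) ε + 1 := by
  have h1 := h.k_le_tau S hε
  have h2 := h.fEvals_le
  have h3 := h.succ_le
  have h4 := h.ν_le
  refine ⟨h.succ_le_succMax S hε, h1, by omega, fun j => ?_⟩
  have h5 := h.dEvals_le j
  split_ifs at h5 <;> omega

lemma Phase.idx_le (ph : Phase n) : ph.idx ≤ 3 := by
  cases ph <;> simp [Phase.idx]

lemma Inv.le (S : Setup P F f f_low L x₀) (hε : 0 < ε) (h : Inv P L ε F f x₀ acc₀ i st) :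
    i ≤ 3 * P.tau L (f x₀ - f_low) ε + P.nuMax L ε + 3 := by
  obtain ⟨ν, hc, _, hi⟩ := h
  have := hc.k_le_tau S hε
  have := hc.ν_le
  have := st.phase.idx_le
  omega

end ARpDA

namespace ARpDA
open Filter Topology

/-! ## The algorithm can proceed until it terminates -/

section Progress

variable {n : ℕ} {P : Params} {F : Set (EuclideanSpace ℝ (Fin n))}
  {f : EuclideanSpace ℝ (Fin n) → ℝ} {f_low L ε : ℝ} {x₀ : EuclideanSpace ℝ (Fin n)}
  {acc₀ : ℕ → ℝ} {ν i : ℕ} {st : State n}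

open Classical in
lemma exists_evaluates (f : EuclideanSpace ℝ (Fin n) → ℝ) {r : ℕ}
    (hacc : ∀ j ∈ Finset.Icc 1 r, 0 ≤ st.acc j) : ∃ D, st.Evaluates f r D := by
  refine ⟨fun j => if j ∈ st.avail then st.D j else iteratedFDeriv ℝ j f st.x,
    fun j hj => if_pos hj, fun j hj => ?_⟩
  obtain ⟨h1, h2⟩ := Finset.mem_sdiff.1 hj
  simpa [h2] using hacc j h1

/-- One global minimizer serves everywhere. If descent is possible it is itself a descent step that
passes the test, and flags `1` and `3` lead to Step 2.3 with the same step. -/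
lemma exists_stepCalc (hP : P.Admissible) (hF : IsClosed F) (ε ω : ℝ) {σ : ℝ} (hσ : 0 < σ)
    {x : EuclideanSpace ℝ (Fin n)} (hx : x ∈ F) (D : Tensors n) (acc : ℕ → ℝ) :
    ∃ flag s δ Δm, StepCalc P ε F D acc x σ ω flag s δ Δm := by
  obtain ⟨s, hsF, hmin⟩ := exists_model_min (p := P.p) hF hx hP.β_mem.1 hσ D
  have htest : s ≠ 0 → ∃ δ, ModelTest P ε F D x σ s δ := fun hs =>
    exists_modelTest hP ε D σ hs hmin
  have hglobal : ((¬ ∃ s', Descent P F D x σ s') ∨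
        ∃ s' δ', Descent P F D x σ s' ∧ ModelTest P ε F D x σ s' δ' ∧
          (stepFlag P ε D acc ω s' = 1 ∨ stepFlag P ε D acc ω s' = 3)) →
      ∃ flag s δ Δm, StepCalc P ε F D acc x σ ω flag s δ Δm := by
    intro hreach
    by_cases hflag : stepFlag P ε D acc ω s = 2
    · obtain ⟨δ, hδ⟩ := htest (ne_zero_of_inc_pos (of_verify_eq_two hflag).1)
      exact ⟨_, s, δ, 0, StepCalc.global s δ hreach hsF hmin fun _ => hδ⟩
    -- The radius `1` is a dummy: a test is required only for flag `2`.
    · exact ⟨_, s, 1, 0, StepCalc.global s 1 hreach hsF hmin fun h => absurd h hflag⟩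
  by_cases hdesc : ∃ s', Descent P F D x σ s'
  · obtain ⟨s', hs'⟩ := hdesc
    have hlt : model P.p P.β D σ s < model P.p P.β D σ 0 := (hmin s' hs'.2.1).trans_lt hs'.2.2
    have hs0 : s ≠ 0 := by
      rintro rfl
      exact hlt.false
    have hs : Descent P F D x σ s := ⟨hs0, hsF, hlt⟩
    obtain ⟨δ, hδ⟩ := htest hs0
    obtain ⟨d, hd, hmax⟩ := exists_isMax_inc hF hsF hδ.1.1.le (derivs (model P.p P.β D σ) s) P.q
    rcases verify_mem P.p ‖s‖ (inc D P.p s) acc ω (1 / 2 * ω * ε) with h | h | h | h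
    · exact ⟨_, s, δ, _, StepCalc.approximate s d δ hs hδ (fun _ => ⟨hd, hmax⟩) (Or.inl h)⟩
    · exact hglobal (Or.inr ⟨s, δ, hs, hδ, Or.inl h⟩)
    · exact ⟨_, s, δ, _, StepCalc.approximate s d δ hs hδ (fun _ => ⟨hd, hmax⟩) (Or.inr h)⟩
    · exact hglobal (Or.inr ⟨s, δ, hs, hδ, Or.inr h⟩)
  · exact hglobal (Or.inl hdesc)

lemma exists_sigmaUpdate (hP : P.Admissible) (ρ : ℝ) {σ : ℝ} (hσ : P.σ_min ≤ σ) :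
    ∃ σ', SigmaUpdate P ρ σ σ' := by
  have hσ0 := hP.σ_min_pos.trans_le hσ
  have h1 : P.γ₁ * σ ≤ σ := by nlinarith [hP.γ₁_lt_one]
  have h2 : σ ≤ P.γ₂ * σ := by nlinarith [hP.one_lt_γ₂]
  have h3 : P.γ₂ * σ ≤ P.γ₃ * σ := by nlinarith [hP.γ₂_lt_γ₃]
  rcases le_or_gt P.η₁ ρ with h | h
  · exact ⟨σ, fun _ => ⟨max_le hσ h1, le_rfl⟩, fun _ => ⟨le_rfl, h2⟩, fun h' => by linarith⟩
  · exact ⟨P.γ₂ * σ, fun h' => by linarith [hP.η₁_le_η₂], fun h' => by linarith [h'.1],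
      fun _ => ⟨le_rfl, h3⟩⟩

lemma Inv.halted_or_trans (S : Setup P F f f_low L x₀) (hacc : P.AdmissibleAcc acc₀)
    (h : Inv P L ε F f x₀ acc₀ i st) :
    (∃ s, st.phase = Phase.halted s) ∨ ∃ st', Trans P ε F f st st' := by
  obtain ⟨ν, hc, hp, _⟩ := h
  have hP := S.adm
  have hnn : ∀ j ∈ Finset.Icc 1 P.p, 0 ≤ st.acc j := fun j hj => by
    rw [hc.acc_eq]
    exact mul_nonneg (pow_nonneg hP.γe_mem.1.le _) (hacc j hj).1
  cases hph : st.phase with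
  | halted s => exact Or.inl ⟨s, rfl⟩
  | step1 =>
    right
    obtain ⟨D, hD⟩ := exists_evaluates f fun j hj =>
      hnn j (Finset.Icc_subset_Icc_right hP.q_le_p hj)
    obtain ⟨d, hd, hmax⟩ := exists_isMax_inc S.closed hc.mem hc.δ_mem.1.le D P.q
    have hcalc : Step1Calc P F f st D d := ⟨hph, hD, hd, hmax⟩
    rcases verify_mem P.q st.δ (inc D P.q d) st.acc st.ω (1 / 2 * st.ω * ε) with h | h | h | h
    · exact ⟨_, Trans.step1_again st D d hcalc h⟩
    · exact ⟨_, Trans.step1_halt st D d hcalc (Or.inl h)⟩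
    · by_cases ht : OptTest P ε F st D
      · exact ⟨_, Trans.step1_halt st D d hcalc (Or.inr (Or.inr ⟨h, ht⟩))⟩
      · exact ⟨_, Trans.step1_pass st D d hcalc ⟨h, ht⟩⟩
    · exact ⟨_, Trans.step1_halt st D d hcalc (Or.inr (Or.inl h))⟩
  | step2 =>
    right
    obtain ⟨D, hD⟩ := exists_evaluates f hnn
    obtain ⟨flag, s, δ, Δm, hstep⟩ :=
      exists_stepCalc hP S.closed ε st.ω (hc.σ_pos hP) hc.mem D st.acc
    have hcalc : Step2Calc P ε F f st D flag s δ Δm := ⟨hph, hD, hstep⟩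
    have hflag := hstep.flag_eq
    rcases verify_mem P.p ‖s‖ (inc D P.p s) st.acc st.ω (1 / 2 * st.ω * ε) with h | h | h | h
    · exact ⟨_, Trans.step2_again st D flag s δ Δm hcalc (Or.inl (hflag.trans h))⟩
    · exact ⟨_, Trans.step2_halt st D flag s δ Δm hcalc (Or.inl (hflag.trans h))⟩
    · have h2 := hflag.trans h
      rcases le_or_gt (P.longStep ε) ‖s‖ with hs | hs
      · exact ⟨_, Trans.step2_pass st D flag s δ Δm hcalc ⟨h2, Or.inl hs⟩⟩
      · rcases Nat.eq_zero_or_pos (modelFlag P ε st.acc st.ω δ Δm) with hm | hm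
        · exact ⟨_, Trans.step2_again st D flag s δ Δm hcalc (Or.inr ⟨h2, hs, hm⟩)⟩
        · exact ⟨_, Trans.step2_pass st D flag s δ Δm hcalc ⟨h2, Or.inr ⟨hs, hm⟩⟩⟩
    · exact ⟨_, Trans.step2_halt st D flag s δ Δm hcalc (Or.inr (hflag.trans h))⟩
  | step3 s δ =>
    right
    have hnn' : 0 ≤ st.ω * |inc st.D P.p s| := mul_nonneg (hc.ω_pos hP).le (abs_nonneg _)
    -- Exact function values are always an admissible choice.
    have hcalc : Step3Calc f P.p st s δ (f st.x) (f (st.x + s)) 2 :=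
      ⟨hph, by simpa using hnn', by simpa using hnn', Or.inr rfl⟩
    obtain ⟨σ', hσ'⟩ :=
      exists_sigmaUpdate hP (ratio P.p st s (f st.x) (f (st.x + s))) hc.le_σ
    rcases le_or_gt P.η₁ (ratio P.p st s (f st.x) (f (st.x + s))) with h | h
    · exact ⟨_, Trans.step3_success st s δ _ _ 2 σ' hcalc h hσ'⟩
    · exact ⟨_, Trans.step3_failure st s δ _ _ 2 σ' hcalc h hσ'⟩

end Progress

/-! ## Orders of the bounds -/

section Order

variable {P : Params} {L : ℝ}

lemma one_le_rate (hP : P.Admissible) {ε : ℝ} (hε : ε ∈ Set.Ioo (0 : ℝ) 1) : 1 ≤ P.rate ε := by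
  have h1 := expo_pos hP
  have h2 := hP.β_mem.1
  refine Real.one_le_rpow_of_pos_of_le_one_of_nonpos hε.1 hε.2.le ?_
  have : 0 ≤ ((P.p : ℝ) + P.β) / P.expo := by positivity
  linarith

/-- As `rate ε ≥ 1`, the additive constants are absorbed into the multiple of `rate ε`. -/
lemma exists_tau_le (hP : P.Admissible) (L : ℝ) {gap : ℝ} (hgap : 0 ≤ gap) :
    ∃ C, 0 ≤ C ∧ ∀ ε ∈ Set.Ioo (0 : ℝ) 1, (P.tau L gap ε : ℝ) ≤ C * P.rate ε := by
  have hl2 : 0 < Real.log P.γ₂ := Real.log_pos hP.one_lt_γ₂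
  have hB : 0 ≤ Real.log (P.sigmaMax L / P.σ₀) :=
    Real.log_nonneg ((one_le_div hP.σ₀_pos).2 (le_sigmaMax P L))
  have hk := kappaP_pos hP L
  set A := 1 + |Real.log P.γ₁| / Real.log P.γ₂
  have hA : 0 ≤ A := by positivity
  set B := 1 / Real.log P.γ₂ * Real.log (P.sigmaMax L / P.σ₀)
  have hB' : 0 ≤ B := by positivity
  refine ⟨(P.kappaP L * gap + 1) * A + B, by positivity, fun ε hε => ?_⟩
  have hr := one_le_rate hP hε
  have h1 : (P.succMax L gap ε : ℝ) ≤ (P.kappaP L * gap + 1) * P.rate ε := by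
    have h2 := Nat.floor_le (show 0 ≤ P.kappaP L * gap * P.rate ε by positivity)
    rw [Params.succMax]
    push_cast
    linarith
  have h3 : (P.tau L gap ε : ℝ) ≤ P.succMax L gap ε * A + B := Nat.floor_le (by positivity)
  calc (P.tau L gap ε : ℝ) ≤ (P.kappaP L * gap + 1) * P.rate ε * A + B * P.rate ε := by
        refine h3.trans (add_le_add (mul_le_mul_of_nonneg_right h1 hA) ?_)
        exact le_mul_of_one_le_right hB' hr
    _ = _ := by ring

lemma exists_nuMax_le (hP : P.Admissible) (L : ℝ) :
    ∃ C, 0 ≤ C ∧ ∀ ε ∈ Set.Ioo (0 : ℝ) 1, (P.nuMax L ε : ℝ) ≤ C * (|Real.log ε| + 1) := by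
  have hlog : 0 < |Real.log P.γe| := abs_pos.2 (Real.log_neg hP.γe_mem.1 hP.γe_mem.2).ne
  set a := P.vth * (1 - P.κω) / (6 * (1 + P.κω) ^ 2) * P.omegaMin L
  have ha : 0 < a := by simpa [Params.threshold] using threshold_pos hP L one_pos
  refine ⟨1 / |Real.log P.γe| * (|Real.log a| + 1 + |Real.log P.κe|) + 1, by positivity,
    fun ε hε => ?_⟩
  set R := 1 / Real.log P.γe * (Real.log (a * ε) - Real.log P.κe)
  have h1 : (P.nuMax L ε : ℝ) ≤ |R| + 1 := by
    have h2 : P.nuMax L ε ≤ ⌈|R|⌉₊ := Nat.ceil_mono (le_abs_self R)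
    have h3 : (P.nuMax L ε : ℝ) ≤ ⌈|R|⌉₊ := by exact_mod_cast h2
    exact h3.trans (Nat.ceil_lt_add_one (abs_nonneg R)).le
  have h4 : |R| ≤ 1 / |Real.log P.γe| * (|Real.log a| + |Real.log ε| + |Real.log P.κe|) := by
    rw [abs_mul, abs_div, abs_one, Real.log_mul ha.ne' hε.1.ne']
    gcongr
    exact (abs_sub _ _).trans (by gcongr; exact abs_add_le _ _)
  have h5 : |Real.log a| + |Real.log ε| + |Real.log P.κe| ≤
      (|Real.log a| + 1 + |Real.log P.κe|) * (|Real.log ε| + 1) := by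
    nlinarith [abs_nonneg (Real.log a), abs_nonneg (Real.log ε), abs_nonneg (Real.log P.κe),
      mul_nonneg (abs_nonneg (Real.log a)) (abs_nonneg (Real.log ε)),
      mul_nonneg (abs_nonneg (Real.log P.κe)) (abs_nonneg (Real.log ε))]
  calc (P.nuMax L ε : ℝ)
      ≤ 1 / |Real.log P.γe| * (|Real.log a| + |Real.log ε| + |Real.log P.κe|) + 1 := by linarith
    _ ≤ 1 / |Real.log P.γe| * ((|Real.log a| + 1 + |Real.log P.κe|) * (|Real.log ε| + 1)) +
        (|Real.log ε| + 1) := by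
      gcongr
      linarith [abs_nonneg (Real.log ε)]
    _ = _ := by ring

end Order

end ARpDA

/-! ### The theorem. -/

theorem mainTheorem3 {n : ℕ} (P : ARpDA.Params) (hP : P.Admissible)
    (F : Set (EuclideanSpace ℝ (Fin n))) (hF : IsClosed F)
    (f : EuclideanSpace ℝ (Fin n) → ℝ) (hf : ContDiff ℝ P.p f)
    (f_low : ℝ) (hlow : ∀ x, f_low ≤ f x)
    (L : ℝ) (hL : 0 ≤ L)
    (hHolder : ∀ x y,
      ‖iteratedFDeriv ℝ P.p f x - iteratedFDeriv ℝ P.p f y‖ ≤ L * ‖x - y‖ ^ P.β)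
    (x₀ : EuclideanSpace ℝ (Fin n)) (hx₀ : x₀ ∈ F) :
    (∀ ε ∈ Set.Ioo (0 : ℝ) 1, ∀ acc : ℕ → ℝ, P.AdmissibleAcc acc →
      -- every run of the algorithm can be continued until it terminates, and is finite
      (∀ st, ARpDA.Reachable P ε F f x₀ acc st →
        (∃ s, st.phase = ARpDA.Phase.halted s) ∨ ∃ st', ARpDA.Trans P ε F f st st') ∧
      (¬ ∃ run : ℕ → ARpDA.State n, run 0 = ARpDA.start P x₀ acc ∧
        ∀ i, ARpDA.Trans P ε F f (run i) (run (i + 1))) ∧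
      -- the final iterate is an approximate minimizer
      (∀ st s, ARpDA.Reachable P ε F f x₀ acc st → st.phase = ARpDA.Phase.halted s →
        st.x ∈ F ∧
        ((∃ δ ∈ Set.Ioc (0 : ℝ) 1,
            ARpDA.phi f F P.q δ st.x ≤ ε * ARpDA.chi P.q δ) ∨
          ∃ v, s = some v ∧ v ≠ 0 ∧
            ARpDA.phi f F P.p ‖v‖ st.x ≤ ε * ARpDA.chi P.p ‖v‖)) ∧
      -- the numbers of iterations and evaluations are bounded
      (∀ st, ARpDA.Reachable P ε F f x₀ acc st →
        st.succ ≤ P.succMax L (f x₀ - f_low) ε ∧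
        st.k ≤ P.tau L (f x₀ - f_low) ε ∧
        st.fEvals ≤ 2 * P.tau L (f x₀ - f_low) ε ∧
        ∀ j ∈ Finset.Icc 1 P.p,
          st.dEvals j ≤ P.nuMax L ε + P.tau L (f x₀ - f_low) ε + 1)) ∧
    -- the bounds in order, with a constant that does not depend on the accuracy
    ∃ C : ℝ, ∀ ε ∈ Set.Ioo (0 : ℝ) 1, ∀ acc : ℕ → ℝ, P.AdmissibleAcc acc →
      ∀ st, ARpDA.Reachable P ε F f x₀ acc st →
        (st.k : ℝ) ≤ C * P.rate ε ∧
        (st.fEvals : ℝ) ≤ C * P.rate ε ∧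
        ∀ j ∈ Finset.Icc 1 P.p,
          (st.dEvals j : ℝ) ≤ C * (|Real.log ε| + P.rate ε) := by

  have S : ARpDA.Setup P F f f_low L x₀ := ⟨hP, hF, hf, hlow, hL, hHolder, hx₀⟩
  refine ⟨fun ε hε acc hacc => ⟨fun st hst => ?_, ?_, fun st s hst hs => ?_, fun st hst => ?_⟩, ?_⟩
  · obtain ⟨i, hi⟩ := hst.exists_inv S hε hacc
    exact hi.halted_or_trans S hacc
  · rintro ⟨run, h0, hrun⟩
    -- The chosen index is one more than `Inv.le` allows.
    have h := (ARpDA.Inv.of_run S hε hacc h0 hrun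
      (3 * P.tau L (f x₀ - f_low) ε + P.nuMax L ε + 4)).le S hε.1
    omega
  · obtain ⟨i, ν, hc, hp, _⟩ := hst.exists_inv S hε hacc
    rw [ARpDA.PhaseInv, hs] at hp
    exact ⟨hc.mem, hp⟩
  · obtain ⟨i, ν, hc, _, _⟩ := hst.exists_inv S hε hacc
    obtain ⟨h1, h2, h3, h4⟩ := hc.bounds S hε.1
    exact ⟨h1, h2, h3, fun j _ => h4 j⟩
  · obtain ⟨C₁, hC₁, hτ⟩ := ARpDA.exists_tau_le hP L (sub_nonneg.2 (hlow x₀))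
    obtain ⟨C₂, hC₂, hν⟩ := ARpDA.exists_nuMax_le hP L
    -- The factor `2` is needed for the evaluations of `f`, `C₂` for the reductions, and `1` for the
    -- last evaluation of a derivative.
    refine ⟨2 * C₁ + C₂ + 1, fun ε hε acc hacc st hst => ?_⟩
    obtain ⟨i, ν, hc, _, _⟩ := hst.exists_inv S hε hacc
    obtain ⟨_, h2, h3, h4⟩ := hc.bounds S hε.1
    have hr := ARpDA.one_le_rate hP hε
    have hτ' := hτ ε hε
    have hν' := hν ε hε
    have hlog := abs_nonneg (Real.log ε)
    have e1 : 0 ≤ C₁ * P.rate ε := by positivity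
    have e2 : 0 ≤ C₂ * P.rate ε := by positivity
    have e3 : C₂ * 1 ≤ C₂ * P.rate ε := by gcongr
    have e4 : 0 ≤ C₁ * |Real.log ε| := by positivity
    refine ⟨?_, ?_, fun j _ => ?_⟩
    · have : (st.k : ℝ) ≤ P.tau L (f x₀ - f_low) ε := by exact_mod_cast h2
      linarith
    · have : (st.fEvals : ℝ) ≤ 2 * P.tau L (f x₀ - f_low) ε := by exact_mod_cast h3
      linarith
    · have : (st.dEvals j : ℝ) ≤ P.nuMax L ε + P.tau L (f x₀ - f_low) ε + 1 := by
        exact_mod_cast h4 j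
      linarith
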